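/- Let $n\in\{2,3\}$ and let $\Omega\subset\mathbb R^n$ be a bounded open set with boundary of class $C^2$ and outward unit normal $\nu$. Let $\mathcal G_D$ be the Dirichlet Green's function of $-\Delta$ in $\Omega$ and $\mathcal G_N$ a Neumann Green's function, that is, square-integrable kernels on $\Omega\times\Omega$ such that for every $f\in L^2(\Omega)$ the function $u=\int_\Omega \mathcal G_D(\cdot,y)f(y)\,dy$ is the weak solution in $H^1_0(\Omega)$ of $-\Delta u=f$ with $u=0$ on $\partial\Omega$, and $v=\int_\Omega \mathcal G_N(\cdot,y)f(y)\,dy\in H^1(\Omega)$ is a weak solution of $-\Delta v=f$ with $\partial v/\partial\nu=-\frac1{|\partial\Omega|}\int_\Omega f$ on $\partial\Omega$, where $\mathcal G_N$ is symmetric (it is then unique up to an additive constant). Let $\mathcal K=\mathcal G_D-\mathcal G_N$. (a) A function $Y\in L^2(\Omega)$ is orthogonal in $L^2(\Omega)$ to all square-integrable harmonic functions in $\Omega$ (constants included) if and only if $\int_\Omega\mathcal K(x,y)Y(y)\,dy=0$ for almost every $x\in\Omega$ and $\int_\Omega Y=0$. (b) For every such $Y$, among the functions $\Phi$ satisfying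 $\Delta\Phi=-Y$ weakly in $\Omega$ there is one with $\Phi=0$ and $\partial\Phi/\partial\nu=0$ on $\partial\Omega$. Precisely: there is such a $\Phi$ which lies in $H^2_0(\Omega)$ (the closure of $C_c^\infty(\Omega)$ in $H^2(\Omega)$, so that the traces of $\Phi$ and $\partial\Phi/\partial\nu$ vanish), is continuous on $\overline\Omega$, and vanishes at every point of $\partial\Omega$; and if moreover $Y\in L^p(\Omega)$ for some $p\in(n,\infty]$ (for instance if $Y$ is bounded), then $\Phi\in C^1(\overline\Omega)$ and $\partial\Phi/\partial\nu(z)=0$ at every $z\in\partial\Omega$. In the latter case $\Phi$ is invisible to all boundary measurements: for every function $\Psi$ and every $z\in\partial\Omega$ we have $(\Psi+\Phi)(z)=\Psi(z)$, and for every $d\in\mathbb R$, $\Psi$ has normal derivative $d$ at $z$ if and only if $\Psi+\Phi$ does. -/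

import Mathlib

open MeasureTheory Filter Topology Set
open scoped ContDiff InnerProductSpace ENNReal

/-- Euclidean space of dimension `n`. -/
abbrev Euc (n : ℕ) : Type := EuclideanSpace ℝ (Fin n)

noncomputable section

namespace InvCond

variable {n : ℕ}

/-! ### Domains with boundary of class `C²`, outward normals, boundary derivatives -/

/-- `ρ` is a `C²` defining function of `Ω` in the neighbourhood `U` of the point `z`. -/
def IsLocalDefining (Ω : Set (Euc n)) (z : Euc n) (U : Set (Euc n)) (ρ : Euc n → ℝ) : Prop :=
  IsOpen U ∧ z ∈ U ∧ ContDiffOn ℝ 2 ρ U ∧ gradient ρ z ≠ 0 ∧ Ω ∩ U = {x ∈ U | ρ x < 0}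

/-- The boundary of `Ω` is of class `C²` (with `Ω` locally on one side of it). -/
def HasC2Boundary (Ω : Set (Euc n)) : Prop :=
  ∀ z ∈ frontier Ω, ∃ U ρ, IsLocalDefining Ω z U ρ

/-- `ν` is the outward unit normal to `∂Ω` at `z`. -/
def IsOutwardNormal (Ω : Set (Euc n)) (z ν : Euc n) : Prop :=
  ∃ U ρ, IsLocalDefining Ω z U ρ ∧ ν = ‖gradient ρ z‖⁻¹ • gradient ρ z

/-- `∂Φ/∂n (z) = d`: the one-sided derivative of `Φ`, taken from inside `Ω`, at the boundary
point `z` in the direction of the outward normal. -/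
def HasNormalDeriv (Ω : Set (Euc n)) (Φ : Euc n → ℝ) (z : Euc n) (d : ℝ) : Prop :=
  ∀ ν, IsOutwardNormal Ω z ν → HasDerivWithinAt (fun t : ℝ => Φ (z + t • ν)) d (Iic 0) 0

/-- `Φ ∈ C¹(closure Ω)`: `Φ` is continuous on the closure of `Ω`, differentiable in `Ω`, and its
gradient extends continuously to the closure. -/
def IsC1UpToBoundary (Ω : Set (Euc n)) (Φ : Euc n → ℝ) : Prop :=
  ContinuousOn Φ (closure Ω) ∧
    ∃ g : Euc n → Euc n, ContinuousOn g (closure Ω) ∧ ∀ x ∈ Ω, HasGradientAt Φ (g x) x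

/-! ### Square-integrable functions, weak derivatives and Sobolev spaces -/

/-- `f ∈ L²(Ω)`. -/
def MemL2 (Ω : Set (Euc n)) (f : Euc n → ℝ) : Prop :=
  MemLp f 2 (volume.restrict Ω)

/-- `φ ∈ C_c^∞(Ω)`. -/
def IsTestFunction (Ω : Set (Euc n)) (φ : Euc n → ℝ) : Prop :=
  ContDiff ℝ ∞ φ ∧ HasCompactSupport φ ∧ tsupport φ ⊆ Ω

/-- `u ∈ H^k_0(Ω)`, the closure of `C_c^∞(Ω)` in the Sobolev space `H^k(Ω)`: there are test
functions converging to `u` in `L²(Ω)` all of whose derivatives of order `≤ k` converge in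
`L²(Ω)`. -/
def MemSobolevZero (Ω : Set (Euc n)) (k : ℕ) (u : Euc n → ℝ) : Prop :=
  MemL2 Ω u ∧ ∃ φ : ℕ → Euc n → ℝ,
    (∀ i, IsTestFunction Ω (φ i)) ∧
    Tendsto (fun i => eLpNorm (fun x => φ i x - u x) 2 (volume.restrict Ω)) atTop (𝓝 0) ∧
    ∀ m ≤ k, ∃ F : Euc n → ContinuousMultilinearMap ℝ (fun _ : Fin m => Euc n) ℝ,
      MemLp F 2 (volume.restrict Ω) ∧
      Tendsto (fun i => eLpNorm (fun x => iteratedFDeriv ℝ m (φ i) x - F x) 2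
        (volume.restrict Ω)) atTop (𝓝 0)

/-- `g` is the weak gradient of `u` in `Ω`. -/
def HasWeakGradient (Ω : Set (Euc n)) (u : Euc n → ℝ) (g : Euc n → Euc n) : Prop :=
  ∀ φ, IsTestFunction Ω φ →
    ∫ x in Ω, u x • gradient φ x = - ∫ x in Ω, φ x • g x

/-- `Δu = f` in `Ω`, in the weak sense. -/
def HasWeakLaplacian (Ω : Set (Euc n)) (u f : Euc n → ℝ) : Prop :=
  ∀ φ, IsTestFunction Ω φ →
    ∫ x in Ω, u x * Laplacian.laplacian φ x = ∫ x in Ω, f x * φ x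

/-! ### Dirichlet and Neumann problems, Green's functions -/

/-- `u` is the weak solution of `-Δu = f` in `Ω`, `u = 0` on `∂Ω`. -/
def IsDirichletSolution (Ω : Set (Euc n)) (f u : Euc n → ℝ) : Prop :=
  MemSobolevZero Ω 1 u ∧ HasWeakLaplacian Ω u (fun x => - f x)

/-- The mean of `φ` over `∂Ω` with respect to surface measure. -/
def boundaryMean (Ω : Set (Euc n)) (φ : Euc n → ℝ) : ℝ :=
  ⨍ z in frontier Ω, φ z ∂(Measure.hausdorffMeasure ((n : ℝ) - 1) : Measure (Euc n))

/-- `v ∈ H¹(Ω)` is a weak solution of `-Δv = f` in `Ω` with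
`∂v/∂n = -(1/|∂Ω|) ∫_Ω f` (a constant) on `∂Ω`; such `v` is unique up to a constant. -/
def IsNeumannSolution (Ω : Set (Euc n)) (f v : Euc n → ℝ) : Prop :=
  MemL2 Ω v ∧ ∃ g : Euc n → Euc n,
    MemLp g 2 (volume.restrict Ω) ∧ HasWeakGradient Ω v g ∧
    ∀ φ : Euc n → ℝ, ContDiff ℝ ∞ φ →
      ∫ x in Ω, ⟪g x, gradient φ x⟫_ℝ
        = (∫ x in Ω, f x * φ x) - (∫ x in Ω, f x) * boundaryMean Ω φ

/-- The integral operator on `Ω` with kernel `G`. -/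
def kernelOp (Ω : Set (Euc n)) (G : Euc n → Euc n → ℝ) (f : Euc n → ℝ) (x : Euc n) : ℝ :=
  ∫ y in Ω, G x y * f y

/-- `G` is square-integrable on `Ω × Ω` (in dimensions 2 and 3 Green's functions are). -/
def IsL2Kernel (Ω : Set (Euc n)) (G : Euc n → Euc n → ℝ) : Prop :=
  MemLp (fun p : Euc n × Euc n => G p.1 p.2) 2
    ((volume.restrict Ω).prod (volume.restrict Ω))

/-- `G` is the Dirichlet Green's function of `-Δ` in `Ω`: `-Δ_x G(x,y) = δ(x-y)`,
`G(x,y) = 0` for `x ∈ ∂Ω`, i.e. `G` is the kernel of the solution operator of the Dirichlet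
problem. -/
def IsDirichletGreen (Ω : Set (Euc n)) (G : Euc n → Euc n → ℝ) : Prop :=
  IsL2Kernel Ω G ∧ ∀ f, MemL2 Ω f → IsDirichletSolution Ω f (kernelOp Ω G f)

/-- `G` is a Neumann Green's function of `-Δ` in `Ω`: `G` is symmetric, `-Δ_x G(x,y) = δ(x-y)`,
`∂G/∂n_x (x,y) = -1/|∂Ω|` for `x ∈ ∂Ω`, i.e. `G` is the symmetric kernel of a solution operator of
the Neumann problem.  It is unique up to an additive constant. -/
def IsNeumannGreen (Ω : Set (Euc n)) (G : Euc n → Euc n → ℝ) : Prop :=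
  IsL2Kernel Ω G ∧ (∀ x ∈ Ω, ∀ y ∈ Ω, G x y = G y x) ∧
    ∀ f, MemL2 Ω f → IsNeumannSolution Ω f (kernelOp Ω G f)

/-- `Y ∈ L²(Ω)` is annihilated by the integral operator with kernel `K`. -/
def InKernel (Ω : Set (Euc n)) (K : Euc n → Euc n → ℝ) (Y : Euc n → ℝ) : Prop :=
  MemL2 Ω Y ∧ ∀ᵐ x ∂(volume.restrict Ω), kernelOp Ω K Y x = 0

/-- `Y ∈ L²(Ω)` is orthogonal to all (square-integrable) harmonic functions in `Ω`, the constants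
included. -/
def OrthogonalToHarmonic (Ω : Set (Euc n)) (Y : Euc n → ℝ) : Prop :=
  MemL2 Ω Y ∧ ∀ h : Euc n → ℝ, InnerProductSpace.HarmonicOnNhd h Ω → MemL2 Ω h →
    ∫ x in Ω, Y x * h x = 0

end InvCond

end

/-! Let `Y` be orthogonal to the square-integrable harmonic functions. By Weyl's lemma
(`exists_harmonic_ae_eq`) the orthogonal complement in L² of the Laplacians of test functions
consists of harmonic functions, so `-Y` is an L² limit of Laplacians of test functions φ_i.
Integration by parts bounds every second derivative of a test function by its Laplacian in L², and
in dimensions two and three this also controls the supremum (`exists_bound_of_laplacian`). Hence φ_i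
converges uniformly and in H² to some Φ in H²_0, continuous, zero off Ω, with ΔΦ = -Y.

This Φ equals both Green potentials of `Y`: the Dirichlet one by uniqueness in H¹_0, and the Neumann
one because the symmetry of the kernel moves the operator onto an arbitrary f, after which Green's
identity for φ_i has no boundary term. So the difference kernel annihilates `Y`. This direction uses
no regularity of the boundary.

Conversely, if both potentials of `Y` agree and `Y` has mean zero, the common function u lies in
H¹_0 and has zero Neumann data, so its equations hold against all smooth functions, up to the
boundary. One would like to test with a harmonic h, but h is merely L² near the boundary. A
partition of unity χ_k localises to pieces on which a fixed direction v points into Ω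
(`HasC2Boundary.exists_segment`). There the translate h(x - tv) is smooth up to the boundary, so it
pairs to zero with Δ(χ_k u), and t → 0 by continuity of translations in L². The sources Δ(χ_k u) add
up to -Y (`integral_mul_harmonic_eq_zero`).

For C¹ regularity, the fields z/(|z|²+c)^(n/2) have divergences that form, up to a constant mass, an
approximation of the identity. The mean of Φ against it has as gradient the convolution of the field
with ΔΦ. As c → 0 the fields converge in L^s on balls when (n-1)s < n, so Hölder's inequality with
`Y` in L^q, q > n, makes the gradients converge uniformly. Being C¹ across the boundary and zero
outside, Φ has zero normal derivative. -/

noncomputable section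

namespace InvCond

variable {n : ℕ}

/-! ### Partial derivatives -/

/-- The partial derivative in the `i`-th coordinate direction. -/
def pd (i : Fin n) (f : Euc n → ℝ) (x : Euc n) : ℝ := fderiv ℝ f x (EuclideanSpace.single i 1)

theorem gradient_apply (f : Euc n → ℝ) (x : Euc n) (i : Fin n) : gradient f x i = pd i f x := by
  have h : ⟪gradient f x, EuclideanSpace.single i (1 : ℝ)⟫_ℝ = pd i f x := by
    rw [gradient, InnerProductSpace.toDual_symm_apply, pd]
  rw [← h, EuclideanSpace.inner_single_right]
  simp

theorem inner_eq_sum (u v : Euc n) : ⟪u, v⟫_ℝ = ∑ i, u i * v i := by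
  simp [PiLp.inner_apply, mul_comm]

theorem euc_eq_sum (v : Euc n) : v = ∑ i, v i • EuclideanSpace.single i (1 : ℝ) := by
  ext j
  simp [Finset.sum_apply, Pi.single_apply]

theorem clm_apply_eq_sum (L : Euc n →L[ℝ] ℝ) (v : Euc n) :
    L v = ∑ i, v i * L (EuclideanSpace.single i 1) := by
  conv_lhs => rw [euc_eq_sum v]
  simp [map_sum]

theorem ContDiff.pd {m k : ℕ∞} {f : Euc n → ℝ} (hf : ContDiff ℝ k f) (hmk : m + 1 ≤ k)
    (i : Fin n) : ContDiff ℝ m (pd i f) :=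
  (ContDiff.fderiv_right hf (by exact_mod_cast hmk)).clm_apply contDiff_const

theorem contDiff_pd {f : Euc n → ℝ} (hf : ContDiff ℝ ∞ f) (i : Fin n) : ContDiff ℝ ∞ (pd i f) :=
  ContDiff.pd (m := ⊤) (k := ⊤) hf le_rfl i

theorem tsupport_pd_subset (f : Euc n → ℝ) (i : Fin n) : tsupport (pd i f) ⊆ tsupport f :=
  tsupport_fderiv_apply_subset ℝ _

theorem hasCompactSupport_pd {f : Euc n → ℝ} (hf : HasCompactSupport f) (i : Fin n) :
    HasCompactSupport (pd i f) :=
  hf.of_isClosed_subset (isClosed_tsupport _) (tsupport_pd_subset f i)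

theorem pd_pd {f : Euc n → ℝ} {x : Euc n} (hf : ContDiffAt ℝ 2 f x) (i j : Fin n) :
    pd i (pd j f) x = fderiv ℝ (fderiv ℝ f) x (EuclideanSpace.single i 1)
      (EuclideanSpace.single j 1) := by
  have h : DifferentiableAt ℝ (fderiv ℝ f) x :=
    (hf.fderiv_right (m := 1) le_rfl).differentiableAt one_ne_zero
  unfold pd
  rw [fderiv_clm_apply h (by fun_prop)]
  simp

theorem pd_comm {f : Euc n → ℝ} {x : Euc n} (hf : ContDiffAt ℝ 2 f x) (i j : Fin n) :
    pd i (pd j f) x = pd j (pd i f) x := by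
  rw [pd_pd hf, pd_pd hf]
  exact (hf.isSymmSndFDerivAt (by simp)) _ _

theorem laplacian_eq_sum_pd {f : Euc n → ℝ} {x : Euc n} (hf : ContDiffAt ℝ 2 f x) :
    Laplacian.laplacian f x = ∑ i, pd i (pd i f) x := by
  rw [InnerProductSpace.laplacian_eq_iteratedFDeriv_orthonormalBasis f
    (EuclideanSpace.basisFun (Fin n) ℝ)]
  simp [iteratedFDeriv_two_apply, pd_pd hf]

theorem pd_mul {f g : Euc n → ℝ} {x : Euc n} (hf : DifferentiableAt ℝ f x)
    (hg : DifferentiableAt ℝ g x) (i : Fin n) :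
    pd i (fun y => f y * g y) x = pd i f x * g x + f x * pd i g x := by
  unfold pd
  rw [fderiv_fun_mul hf hg]
  simp; ring

theorem _root_.ContDiff.nat {f : Euc n → ℝ} (hf : ContDiff ℝ ∞ f) (k : ℕ) : ContDiff ℝ k f :=
  hf.of_le (by exact_mod_cast le_top)

theorem laplacian_mul {f g : Euc n → ℝ} (hf : ContDiff ℝ ∞ f) (hg : ContDiff ℝ ∞ g) (x : Euc n) :
    Laplacian.laplacian (fun y => f y * g y) x = Laplacian.laplacian f x * g x
      + 2 * ∑ i, pd i f x * pd i g x + f x * Laplacian.laplacian g x := by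
  have df : Differentiable ℝ f := hf.differentiable (by simp)
  have dg : Differentiable ℝ g := hg.differentiable (by simp)
  have e : ∀ i, pd i (fun y => f y * g y) = fun y => pd i f y * g y + f y * pd i g y := by
    intro i; ext y; exact pd_mul (df y) (dg y) i
  rw [laplacian_eq_sum_pd ((hf.mul hg).nat 2).contDiffAt,
    laplacian_eq_sum_pd (hf.nat 2).contDiffAt, laplacian_eq_sum_pd (hg.nat 2).contDiffAt]
  rw [Finset.sum_mul, Finset.mul_sum, Finset.mul_sum, ← Finset.sum_add_distrib,
    ← Finset.sum_add_distrib]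
  refine Finset.sum_congr rfl fun i _ => ?_
  have dfi := (contDiff_pd hf i).differentiable (by simp)
  have dgi := (contDiff_pd hg i).differentiable (by simp)
  rw [e i]
  have : pd i (fun y => pd i f y * g y + f y * pd i g y) x =
      pd i (fun y => pd i f y * g y) x + pd i (fun y => f y * pd i g y) x := by
    unfold pd
    rw [fderiv_fun_add]
    · simp
    · exact (dfi x).mul (dg x)
    · exact (df x).mul (dgi x)
  rw [this, pd_mul (dfi x) (dg x), pd_mul (df x) (dgi x)]
  ring

theorem contDiff_laplacian {f : Euc n → ℝ} (hf : ContDiff ℝ ∞ f) :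
    ContDiff ℝ ∞ (Laplacian.laplacian f) := by
  have : Laplacian.laplacian f = fun x => ∑ i, pd i (pd i f) x := by
    ext x; exact laplacian_eq_sum_pd (hf.nat 2).contDiffAt
  rw [this]
  exact ContDiff.sum fun i _ => contDiff_pd (contDiff_pd hf i) i

theorem tsupport_laplacian_subset (f : Euc n → ℝ) :
    tsupport (Laplacian.laplacian f) ⊆ tsupport f := by
  refine closure_minimal (fun x hx => ?_) (isClosed_tsupport f)
  by_contra h
  apply hx
  have := InnerProductSpace.laplacian_congr_nhds (notMem_tsupport_iff_eventuallyEq.1 h)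
  rw [this.self_of_nhds, Pi.zero_def, InnerProductSpace.laplacian_const]
  rfl

theorem hasCompactSupport_laplacian {f : Euc n → ℝ} (hf : HasCompactSupport f) :
    HasCompactSupport (Laplacian.laplacian f) :=
  hf.of_isClosed_subset (isClosed_tsupport _) (tsupport_laplacian_subset f)

/-! ### Integration by parts -/

theorem integral_mul_pd {f g : Euc n → ℝ} (hf : ContDiff ℝ 1 f) (hg : ContDiff ℝ 1 g)
    (hc : HasCompactSupport g) (i : Fin n) : ∫ x, f x * pd i g x = - ∫ x, pd i f x * g x := by
  have cf : Continuous (pd i f) := (ContDiff.pd (m := 0) (k := 1) hf le_rfl i).continuous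
  have cg : Continuous (pd i g) := (ContDiff.pd (m := 0) (k := 1) hg le_rfl i).continuous
  refine integral_mul_fderiv_eq_neg_fderiv_mul_of_integrable ?_ ?_ ?_ ?_ ?_
  · exact (cf.mul hg.continuous).integrable_of_hasCompactSupport hc.mul_left
  · exact (hf.continuous.mul cg).integrable_of_hasCompactSupport (hasCompactSupport_pd hc i).mul_left
  · exact (hf.continuous.mul hg.continuous).integrable_of_hasCompactSupport hc.mul_left
  · exact fun x _ => hf.differentiable one_ne_zero x
  · exact fun x _ => hg.differentiable one_ne_zero x

/-! ### Test functions -/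

section Test

variable {Ω : Set (Euc n)} {φ : Euc n → ℝ}

theorem IsTestFunction.pd (h : IsTestFunction Ω φ) (i : Fin n) : IsTestFunction Ω (pd i φ) :=
  ⟨contDiff_pd h.1 i, hasCompactSupport_pd h.2.1 i, (tsupport_pd_subset φ i).trans h.2.2⟩

theorem IsTestFunction.laplacian (h : IsTestFunction Ω φ) :
    IsTestFunction Ω (Laplacian.laplacian φ) :=
  ⟨contDiff_laplacian h.1, hasCompactSupport_laplacian h.2.1,
    (tsupport_laplacian_subset φ).trans h.2.2⟩

theorem IsTestFunction.contDiff (h : IsTestFunction Ω φ) (k : ℕ) : ContDiff ℝ k φ :=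
  h.1.of_le (by exact_mod_cast le_top)

theorem IsTestFunction.laplacian_eq (h : IsTestFunction Ω φ) (x : Euc n) :
    Laplacian.laplacian φ x = ∑ i, InvCond.pd i (InvCond.pd i φ) x :=
  laplacian_eq_sum_pd (h.contDiff 2).contDiffAt

theorem IsTestFunction.eq_zero (h : IsTestFunction Ω φ) {x : Euc n} (hx : x ∉ Ω) : φ x = 0 :=
  image_eq_zero_of_notMem_tsupport fun hx' => hx (h.2.2 hx')

theorem IsTestFunction.memLp (h : IsTestFunction Ω φ) (p : ℝ≥0∞) (μ : Measure (Euc n))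
    [IsFiniteMeasureOnCompacts μ] : MemLp φ p μ :=
  h.1.continuous.memLp_of_hasCompactSupport h.2.1

theorem IsTestFunction.setIntegral_mul (h : IsTestFunction Ω φ) (f : Euc n → ℝ) :
    ∫ x in Ω, f x * φ x = ∫ x, f x * φ x :=
  setIntegral_eq_integral_of_forall_compl_eq_zero fun x hx => by rw [h.eq_zero hx, mul_zero]

theorem IsTestFunction.setIntegral_mul_left (h : IsTestFunction Ω φ) (f : Euc n → ℝ) :
    ∫ x in Ω, φ x * f x = ∫ x, φ x * f x :=
  setIntegral_eq_integral_of_forall_compl_eq_zero fun x hx => by rw [h.eq_zero hx, zero_mul]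

theorem IsTestFunction.mul_left (h : IsTestFunction Ω φ) {χ : Euc n → ℝ} (hχ : ContDiff ℝ ∞ χ) :
    IsTestFunction Ω (fun x => χ x * φ x) :=
  ⟨hχ.mul h.1, h.2.1.mul_left, (tsupport_mul_subset_right).trans h.2.2⟩

theorem IsTestFunction.mono (h : IsTestFunction Ω φ) {Ω' : Set (Euc n)} (hΩ : Ω ⊆ Ω') :
    IsTestFunction Ω' φ := ⟨h.1, h.2.1, h.2.2.trans hΩ⟩

theorem IsTestFunction.add {ψ : Euc n → ℝ} (h : IsTestFunction Ω φ) (h' : IsTestFunction Ω ψ) :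
    IsTestFunction Ω (φ + ψ) :=
  ⟨h.1.add h'.1, h.2.1.add h'.2.1, (tsupport_add _ _).trans (union_subset h.2.2 h'.2.2)⟩

theorem IsTestFunction.const_smul (h : IsTestFunction Ω φ) (c : ℝ) :
    IsTestFunction Ω (c • φ) :=
  ⟨h.1.const_smul c, h.2.1.smul_left (f := fun _ => c),
    (tsupport_smul_subset_right (fun _ => c) φ).trans h.2.2⟩

theorem isTestFunction_zero : IsTestFunction Ω (0 : Euc n → ℝ) :=
  ⟨contDiff_const, HasCompactSupport.zero, by simp [tsupport]⟩

theorem integral_mul_laplacian {f : Euc n → ℝ} (hf : ContDiff ℝ 1 f) (h : IsTestFunction Ω φ) :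
    ∫ x, f x * Laplacian.laplacian φ x = - ∑ i, ∫ x, pd i f x * pd i φ x := by
  have e : ∀ x, f x * Laplacian.laplacian φ x = ∑ i, f x * pd i (pd i φ) x := fun x => by
    rw [h.laplacian_eq, Finset.mul_sum]
  simp_rw [e]
  rw [integral_finsetSum, ← Finset.sum_neg_distrib]
  · exact Finset.sum_congr rfl fun i _ =>
      integral_mul_pd hf ((h.pd i).contDiff 1) (h.pd i).2.1 i
  · exact fun i _ => (hf.continuous.mul ((h.pd i).pd i).1.continuous).integrable_of_hasCompactSupport
      ((h.pd i).pd i).2.1.mul_left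

theorem integral_mul_laplacian_comm {f : Euc n → ℝ} (hf : ContDiff ℝ 2 f)
    (h : IsTestFunction Ω φ) :
    ∫ x, f x * Laplacian.laplacian φ x = ∫ x, Laplacian.laplacian f x * φ x := by
  rw [integral_mul_laplacian (hf.of_le one_le_two) h, ← Finset.sum_neg_distrib]
  have cpd : ∀ i, ContDiff ℝ 1 (pd i f) := fun i => ContDiff.pd (m := 1) (k := 2) hf le_rfl i
  have c2 : ∀ i, Continuous (pd i (pd i f)) := fun i =>
    (ContDiff.pd (m := 0) (k := 1) (cpd i) le_rfl i).continuous
  have e : ∀ x, Laplacian.laplacian f x * φ x = ∑ i, pd i (pd i f) x * φ x := fun x => by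
    rw [laplacian_eq_sum_pd hf.contDiffAt, Finset.sum_mul]
  simp_rw [e]
  rw [integral_finsetSum]
  · refine Finset.sum_congr rfl fun i _ => ?_
    rw [integral_mul_pd (cpd i) (h.contDiff 1) h.2.1 i, neg_neg]
  · exact fun i _ => ((c2 i).mul h.1.continuous).integrable_of_hasCompactSupport h.2.1.mul_left

end Test

/-! ### Passing to the limit in `L²` -/

theorem tendsto_integral_mul_of_L2 {α : Type*} [MeasurableSpace α] {μ : Measure α}
    {f : ℕ → α → ℝ} {u g : α → ℝ} (hf : ∀ i, MemLp (f i) 2 μ) (hu : MemLp u 2 μ)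
    (hg : MemLp g 2 μ) (h : Tendsto (fun i => eLpNorm (fun x => f i x - u x) 2 μ) atTop (𝓝 0)) :
    Tendsto (fun i => ∫ x, f i x * g x ∂μ) atTop (𝓝 (∫ x, u x * g x ∂μ)) := by
  refine tendsto_integral_of_L1' _ (hu.integrable_mul hg).aestronglyMeasurable
    (Eventually.of_forall fun i => (hf i).integrable_mul hg) ?_
  have h0 : Tendsto (fun i => eLpNorm (fun x => f i x - u x) 2 μ * eLpNorm g 2 μ) atTop (𝓝 0) := by
    simpa using ENNReal.Tendsto.mul_const h (Or.inr hg.2.ne)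
  refine tendsto_of_tendsto_of_tendsto_of_le_of_le tendsto_const_nhds h0 (fun _ => zero_le)
    fun i => ?_
  have := eLpNorm_smul_le_mul_eLpNorm (p := 2) (q := 2) (r := 1) hg.1 ((hf i).sub hu).1
  refine le_trans (le_of_eq ?_) this
  congr 1
  ext x
  simp [sub_mul]

/-! ### A radial mollifier -/

theorem hasFDerivAt_radial {f : ℝ → ℝ} (hf : Differentiable ℝ f) (c : ℝ) (x y : Euc n) :
    HasFDerivAt (fun y : Euc n => f (c * ‖y - x‖ ^ 2))
      (deriv f (c * ‖y - x‖ ^ 2) • (c • (2 • (innerSL ℝ (y - x))))) y := by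
  have h1 : HasFDerivAt (fun y : Euc n => ‖y - x‖ ^ 2) (2 • (innerSL ℝ (y - x))) y := by
    simpa using ((hasFDerivAt_id y).sub_const x).norm_sq
  exact (hf _).hasDerivAt.comp_hasFDerivAt y (h1.const_mul c)

theorem pd_radial {f : ℝ → ℝ} (hf : Differentiable ℝ f) (c : ℝ) (x : Euc n) (i : Fin n) :
    pd i (fun y : Euc n => f (c * ‖y - x‖ ^ 2)) =
      fun y => deriv f (c * ‖y - x‖ ^ 2) * (2 * c * (y i - x i)) := by
  ext y
  unfold pd
  rw [(hasFDerivAt_radial hf c x y).fderiv]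
  simp [EuclideanSpace.inner_single_right]
  left; ring

theorem pd_coord_sub (c : ℝ) (x y : Euc n) (i j : Fin n) :
    pd i (fun y : Euc n => c * (y j - x j)) y = if i = j then c else 0 := by
  have h : HasFDerivAt (fun y : Euc n => c * (y j - x j)) (c • (EuclideanSpace.proj j : Euc n →L[ℝ] ℝ)) y :=
    ((EuclideanSpace.proj j : Euc n →L[ℝ] ℝ).hasFDerivAt.sub_const (x j)).const_mul c
  unfold pd
  rw [h.fderiv]
  simp [eq_comm]

theorem contDiff_radial {f : ℝ → ℝ} (hf : ContDiff ℝ ∞ f) (c : ℝ) (x : Euc n) :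
    ContDiff ℝ ∞ (fun y : Euc n => f (c * ‖y - x‖ ^ 2)) :=
  hf.comp (contDiff_const.mul ((contDiff_id.sub contDiff_const).norm_sq ℝ))

theorem sum_sq_sub (x y : Euc n) : ∑ i, (y i - x i) ^ 2 = ‖y - x‖ ^ 2 := by
  simp [EuclideanSpace.norm_sq_eq]

theorem laplacian_radial {f : ℝ → ℝ} (hf : ContDiff ℝ ∞ f) (c : ℝ) (x y : Euc n) :
    Laplacian.laplacian (fun y : Euc n => f (c * ‖y - x‖ ^ 2)) y =
      2 * c * (n * deriv f (c * ‖y - x‖ ^ 2)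
        + 2 * (c * ‖y - x‖ ^ 2) * deriv (deriv f) (c * ‖y - x‖ ^ 2)) := by
  have hf' : ContDiff ℝ ∞ (deriv f) := (contDiff_infty_iff_deriv.1 hf).2
  have d1 : Differentiable ℝ f := hf.differentiable (by simp)
  have d2 : Differentiable ℝ (deriv f) := hf'.differentiable (by simp)
  rw [laplacian_eq_sum_pd ((contDiff_radial hf c x).nat 2).contDiffAt]
  have : ∀ i, pd i (pd i fun y : Euc n => f (c * ‖y - x‖ ^ 2)) y =
      deriv (deriv f) (c * ‖y - x‖ ^ 2) * (4 * c ^ 2 * (y i - x i) ^ 2)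
      + 2 * c * deriv f (c * ‖y - x‖ ^ 2) := by
    intro i
    rw [pd_radial d1, pd_mul ((contDiff_radial hf' c x).differentiable (by simp) y) (by fun_prop),
      pd_radial d2, pd_coord_sub]
    simp; ring
  simp_rw [this]
  rw [Finset.sum_add_distrib, ← Finset.mul_sum, ← Finset.mul_sum, sum_sq_sub]
  simp; ring

/-- A smooth decreasing profile, equal to `1` on `(-∞, 0]` and to `0` on `[1, ∞)`. -/
def profile (s : ℝ) : ℝ := Real.smoothTransition (1 - s)

theorem contDiff_profile : ContDiff ℝ ∞ profile :=
  Real.smoothTransition.contDiff.comp (contDiff_const.sub contDiff_id)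

theorem contDiff_deriv_profile : ContDiff ℝ ∞ (deriv profile) :=
  (contDiff_infty_iff_deriv.1 contDiff_profile).2

theorem profile_eq_zero {s : ℝ} (hs : 1 ≤ s) : profile s = 0 :=
  Real.smoothTransition.zero_of_nonpos (by linarith)

theorem deriv_profile_nonpos (s : ℝ) : deriv profile s ≤ 0 :=
  Antitone.deriv_nonpos fun _ _ h => Real.smoothTransition.monotone (by linarith)

theorem deriv_profile_eq_zero {s : ℝ} (hs : 1 ≤ s) : deriv profile s = 0 := by
  have h1 : EqOn (deriv profile) 0 (Ioi 1) := fun t ht => by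
    have : profile =ᶠ[𝓝 t] fun _ => 0 :=
      eventually_of_mem (Ioi_mem_nhds ht) fun u hu => profile_eq_zero (le_of_lt hu)
    rw [this.deriv_eq]; simp
  have h2 := h1.closure contDiff_deriv_profile.continuous continuous_const
  rw [closure_Ioi] at h2
  exact h2 hs

/-- The radial mollifier at scale `1 / b` (not normalised). -/
def mollifier (b : ℝ) (z : Euc n) : ℝ := b ^ n * -deriv profile (b ^ 2 * ‖z‖ ^ 2)

theorem contDiff_mollifier (b : ℝ) : ContDiff ℝ ∞ (mollifier (n := n) b) := by
  have := contDiff_radial (n := n) contDiff_deriv_profile (b ^ 2) 0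
  simp only [sub_zero] at this
  exact contDiff_const.mul this.neg

theorem mollifier_eq_zero {b : ℝ} (hb : 0 < b) {z : Euc n} (hz : 1 / b ≤ ‖z‖) :
    mollifier b z = 0 := by
  have : 1 ≤ b ^ 2 * ‖z‖ ^ 2 := by
    rw [div_le_iff₀ hb] at hz
    nlinarith
  simp [mollifier, deriv_profile_eq_zero this]

theorem hasCompactSupport_mollifier {b : ℝ} (hb : 0 < b) :
    HasCompactSupport (mollifier (n := n) b) :=
  HasCompactSupport.intro (isCompact_closedBall 0 (1 / b)) fun z hz => mollifier_eq_zero hb (by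
    rw [mem_closedBall_zero_iff, not_le] at hz; exact hz.le)

theorem mollifier_nonneg {b : ℝ} (hb : 0 < b) (z : Euc n) : 0 ≤ mollifier b z :=
  mul_nonneg (by positivity) (by linarith [deriv_profile_nonpos (b ^ 2 * ‖z‖ ^ 2)])

theorem mollifier_neg (b : ℝ) (z : Euc n) : mollifier b (-z) = mollifier b z := by
  simp [mollifier]

theorem integral_mollifier {b : ℝ} (hb : 0 < b) :
    ∫ z : Euc n, mollifier b z = ∫ z : Euc n, mollifier 1 z := by
  have h := Measure.integral_comp_smul_of_nonneg (μ := volume)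
    (fun z : Euc n => mollifier 1 z) b (hR := hb.le)
  have e : ∀ z : Euc n, mollifier b z = b ^ n * mollifier 1 (b • z) := fun z => by
    simp [mollifier, norm_smul, mul_pow]
  simp_rw [e]
  rw [integral_const_mul, h]
  simp
  field_simp

/-- The profile falls from 1 to 0 on [0, 1], so by the mean value theorem its slope is -1 at some s.
The mollifier is therefore positive at a point with |z|² = s. -/
theorem integral_mollifier_pos (hn : 0 < n) : 0 < ∫ z : Euc n, mollifier 1 z := by
  obtain ⟨s, hs, hs'⟩ := exists_deriv_eq_slope profile zero_lt_one
    contDiff_profile.continuous.continuousOn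
    (contDiff_profile.differentiable (by simp)).differentiableOn
  have h1 : deriv profile s = -1 := by
    rw [hs']; simp [profile]
  refine Continuous.integral_pos_of_hasCompactSupport_nonneg_nonzero
    (x := EuclideanSpace.single ⟨0, hn⟩ (Real.sqrt s)) (contDiff_mollifier 1).continuous
    (hasCompactSupport_mollifier one_pos) (mollifier_nonneg one_pos) ?_
  simp [mollifier, Real.sq_sqrt hs.1.le, h1]

theorem exists_mollifier_le : ∃ C, 0 ≤ C ∧ ∀ b : ℝ, 0 < b → ∀ z : Euc n, mollifier b z ≤ C * b ^ n := by
  obtain ⟨C, hC⟩ := isCompact_Icc (a := (0 : ℝ)) (b := 1) |>.exists_bound_of_continuousOn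
    contDiff_deriv_profile.continuous.continuousOn
  have hC0 : 0 ≤ C := (norm_nonneg _).trans (hC 0 (by simp))
  refine ⟨C, hC0, fun b hb z => ?_⟩
  rw [mollifier, mul_comm]
  gcongr
  by_cases h : b ^ 2 * ‖z‖ ^ 2 ≤ 1
  · exact (neg_le_abs _).trans (hC _ ⟨by positivity, h⟩)
  · rw [deriv_profile_eq_zero (not_le.1 h).le]; simpa using hC0

theorem isTestFunction_profile {Ω : Set (Euc n)} {x : Euc n} {b : ℝ} (hb : 0 < b)
    (h : Metric.closedBall x (1 / b) ⊆ Ω) :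
    IsTestFunction Ω (fun y => profile (b ^ 2 * ‖y - x‖ ^ 2)) := by
  have hz : ∀ y, y ∉ Metric.closedBall x (1 / b) → profile (b ^ 2 * ‖y - x‖ ^ 2) = 0 := by
    intro y hy
    rw [Metric.mem_closedBall, not_le, dist_eq_norm, div_lt_iff₀ hb] at hy
    exact profile_eq_zero (by nlinarith)
  refine ⟨contDiff_radial contDiff_profile _ x,
    HasCompactSupport.intro (isCompact_closedBall x (1 / b)) hz, ?_⟩
  refine (closure_minimal (fun y hy => ?_) Metric.isClosed_closedBall).trans h
  by_contra hy'
  exact hy (hz y hy')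

/-- The reason for building the mollifier from `deriv profile`. With s = b²|y - x|², both sides
equal -b^(n-1) (n f'(s) + 2 s f''(s)) for f = `profile`. A change of scale thus adds only the
Laplacian of a compactly supported function. -/
theorem hasDerivAt_mollifier {b : ℝ} (hb : 0 < b) (x y : Euc n) :
    HasDerivAt (fun b => mollifier b (y - x))
      (-(b ^ n / (2 * b ^ 3)) *
        Laplacian.laplacian (fun y : Euc n => profile (b ^ 2 * ‖y - x‖ ^ 2)) y) b := by
  have hd : Differentiable ℝ (deriv profile) := contDiff_deriv_profile.differentiable (by simp)
  have h1 : HasDerivAt (fun b : ℝ => b ^ 2 * ‖y - x‖ ^ 2) (2 * b * ‖y - x‖ ^ 2) b := by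
    simpa using (hasDerivAt_pow 2 b).mul_const (‖y - x‖ ^ 2)
  have h2 := ((hd (b ^ 2 * ‖y - x‖ ^ 2)).hasDerivAt.comp b h1).neg
  have h3 := (hasDerivAt_pow n b).mul h2
  refine h3.congr_deriv ?_
  rw [laplacian_radial contDiff_profile]
  -- The power rule produces the truncated exponent `n - 1`, so dimension zero is treated apart.
  rcases n with _ | m
  · simp; field_simp
  · simp; field_simp; ring

/-! ### Weyl's lemma -/

section Weyl

variable {Ω : Set (Euc n)} {w : Euc n → ℝ}

theorem integrableOn_of_memL2 (hΩb : Bornology.IsBounded Ω) (hw : MemL2 Ω w) :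
    IntegrableOn w Ω := by
  have : IsFiniteMeasure (volume.restrict Ω) := ⟨by
    rw [Measure.restrict_apply_univ]; exact hΩb.measure_lt_top⟩
  exact hw.integrable one_le_two

theorem hasDerivAt_integral_mollifier (hΩo : IsOpen Ω) (hΩb : Bornology.IsBounded Ω)
    (hw : MemL2 Ω w) {b : ℝ} (hb : 0 < b) (x : Euc n) :
    HasDerivAt (fun b => ∫ y in Ω, mollifier b (y - x) * w y)
      (-(b ^ n / (2 * b ^ 3)) * ∫ y in Ω, w y *
        Laplacian.laplacian (fun y : Euc n => profile (b ^ 2 * ‖y - x‖ ^ 2)) y) b := by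
  have hwi := integrableOn_of_memL2 hΩb hw
  -- The closed formula for the derivative in the scale. It is jointly continuous on a compact set,
  -- which gives the constant needed for differentiation under the integral.
  let D : ℝ × Euc n → ℝ := fun p => -(p.1 ^ n / (2 * p.1 ^ 3)) *
      (2 * p.1 ^ 2 * (n * deriv profile (p.1 ^ 2 * ‖p.2 - x‖ ^ 2)
        + 2 * (p.1 ^ 2 * ‖p.2 - x‖ ^ 2) * deriv (deriv profile) (p.1 ^ 2 * ‖p.2 - x‖ ^ 2)))
  have c1 : Continuous (deriv profile) := contDiff_deriv_profile.continuous
  have c2 : Continuous (deriv (deriv profile)) :=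
    (contDiff_infty_iff_deriv.1 contDiff_deriv_profile).2.continuous
  have hD : ContinuousOn D (Icc (b / 2) (2 * b) ×ˢ closure Ω) := by
    intro p hp
    have hp1 : 0 < p.1 := by linarith [hp.1.1]
    refine ContinuousAt.continuousWithinAt ?_
    have : 2 * p.1 ^ 3 ≠ 0 := by positivity
    fun_prop (disch := assumption)
  obtain ⟨C, hC⟩ := (isCompact_Icc.prod hΩb.isCompact_closure).exists_bound_of_continuousOn hD
  have hs : Ioo (b / 2) (2 * b) ∈ 𝓝 b := Ioo_mem_nhds (by linarith) (by linarith)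
  have cm : ∀ b : ℝ, Continuous fun y : Euc n => mollifier b (y - x) := fun b =>
    (contDiff_mollifier b).continuous.comp (by fun_prop)
  have hlap : ∀ b y, -(b ^ n / (2 * b ^ 3)) *
      Laplacian.laplacian (fun y : Euc n => profile (b ^ 2 * ‖y - x‖ ^ 2)) y = D (b, y) := by
    intro b y
    rw [laplacian_radial contDiff_profile]
  have key := hasDerivAt_integral_of_dominated_loc_of_deriv_le (μ := volume.restrict Ω)
    (F := fun b y => mollifier b (y - x) * w y) (F' := fun b y => D (b, y) * w y)
    (bound := fun y => C * ‖w y‖) (x₀ := b) hs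
    (Eventually.of_forall fun b => (cm b).aestronglyMeasurable.mul hwi.aestronglyMeasurable)
    ?_ ?_ ?_ (hwi.norm.const_mul C) ?_
  · refine key.2.congr_deriv ?_
    rw [← integral_const_mul]
    refine integral_congr_ae (Eventually.of_forall fun y => ?_)
    simp only [← hlap]; ring
  · obtain ⟨M, -, hM⟩ := exists_mollifier_le (n := n)
    refine Integrable.bdd_mul (c := M * b ^ n) hwi (cm b).aestronglyMeasurable
      (Eventually.of_forall fun y => ?_)
    rw [Real.norm_of_nonneg (mollifier_nonneg hb _)]
    exact hM b hb _
  · refine AEStronglyMeasurable.mul (Continuous.aestronglyMeasurable ?_) hwi.aestronglyMeasurable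
    simp_rw [← hlap]
    exact (contDiff_laplacian (contDiff_radial contDiff_profile _ x)).continuous.const_mul _
  · refine (ae_restrict_iff' hΩo.measurableSet).2 (Eventually.of_forall fun y hy b' hb' => ?_)
    rw [norm_mul]
    gcongr
    exact hC (b', y) ⟨Ioo_subset_Icc_self hb', subset_closure hy⟩
  · refine Eventually.of_forall fun y b' hb' => ?_
    rw [← hlap]
    exact (hasDerivAt_mollifier (by linarith [hb'.1]) x y).mul_const _

/-- A weak mean value property. The derivative in the scale is a multiple of the pairing of `w` with
the Laplacian of a profile supported in the ball of radius 1/b, which stays inside Ω for all scales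
at least `b₀`. -/
theorem integral_mollifier_eq (hΩo : IsOpen Ω) (hΩb : Bornology.IsBounded Ω)
    (hw : MemL2 Ω w) (hweak : ∀ φ, IsTestFunction Ω φ →
      ∫ x in Ω, w x * Laplacian.laplacian φ x = 0) {b₀ b : ℝ} (hb₀ : 0 < b₀) (hb : b₀ ≤ b)
    {x : Euc n} (hx : Metric.closedBall x (1 / b₀) ⊆ Ω) :
    ∫ y in Ω, mollifier b (y - x) * w y = ∫ y in Ω, mollifier b₀ (y - x) * w y := by
  have hd : ∀ c ∈ Icc b₀ b, HasDerivAt (fun b => ∫ y in Ω, mollifier b (y - x) * w y) 0 c := by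
    intro c hc
    have hc0 : 0 < c := hb₀.trans_le hc.1
    refine (hasDerivAt_integral_mollifier hΩo hΩb hw hc0 x).congr_deriv ?_
    rw [hweak _ (isTestFunction_profile hc0 ((Metric.closedBall_subset_closedBall ?_).trans hx)),
      mul_zero]
    exact one_div_le_one_div_of_le hb₀ hc.1
  exact constant_of_has_deriv_right_zero (fun c hc => (hd c hc).continuousAt.continuousWithinAt)
    (fun c hc => (hd c (Ico_subset_Icc_self hc)).hasDerivWithinAt) b ⟨hb, le_rfl⟩

/-- Convergence holds at Lebesgue points: the mollifier is at most C bⁿ and lives on a ball of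
volume proportional to b⁻ⁿ, so the error is at most a constant times the average of |w - w(x)| on
that ball. -/
theorem ae_tendsto_integral_mollifier (hΩo : IsOpen Ω) (hΩb : Bornology.IsBounded Ω)
    (hw : MemL2 Ω w) : ∀ᵐ x ∂(volume.restrict Ω),
      Tendsto (fun b : ℝ => ∫ y in Ω, mollifier b (y - x) * w y) atTop
        (𝓝 ((∫ z : Euc n, mollifier 1 z) * w x)) := by
  have hwi := integrableOn_of_memL2 hΩb hw
  have hw0 : Integrable (Ω.indicator w) := (integrable_indicator_iff hΩo.measurableSet).2 hwi
  obtain ⟨C, hC0, hC⟩ := exists_mollifier_le (n := n)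
  have hleb := ae_restrict_of_ae (s := Ω)
    (IsUnifLocDoublingMeasure.ae_tendsto_average_norm_sub volume hw0.locallyIntegrable 1)
  filter_upwards [hleb, ae_restrict_mem hΩo.measurableSet] with x hx hxΩ
  have hδ : Tendsto (fun b : ℝ => 1 / b) atTop (𝓝[>] 0) := by
    simpa using tendsto_inv_atTop_nhdsGT_zero
  have hav := hx (fun _ : ℝ => x) (fun b : ℝ => 1 / b) hδ (by
    filter_upwards [eventually_gt_atTop 0] with b hb
    exact Metric.mem_closedBall_self (by positivity))
  have hV : Tendsto (fun b : ℝ => C * (volume (Metric.ball (0 : Euc n) 1)).toReal *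
      ⨍ y in Metric.closedBall x (1 / b), ‖Ω.indicator w y - Ω.indicator w x‖) atTop (𝓝 0) := by
    simpa using hav.const_mul (C * (volume (Metric.ball (0 : Euc n) 1)).toReal)
  rw [tendsto_iff_norm_sub_tendsto_zero]
  refine tendsto_of_tendsto_of_tendsto_of_le_of_le' tendsto_const_nhds hV
    (Eventually.of_forall fun _ => norm_nonneg _) ?_
  filter_upwards [eventually_gt_atTop 0] with b hb
  have cm : Continuous fun y : Euc n => mollifier b (y - x) :=
    (contDiff_mollifier b).continuous.comp (by fun_prop)
  have cs : HasCompactSupport fun y : Euc n => mollifier b (y - x) := by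
    refine HasCompactSupport.intro (isCompact_closedBall x (1 / b)) fun y hy => ?_
    rw [Metric.mem_closedBall, not_le, dist_eq_norm] at hy
    exact mollifier_eq_zero hb hy.le
  have hbd : ∀ y, ‖mollifier b (y - x)‖ ≤ C * b ^ n := fun y => by
    rw [Real.norm_of_nonneg (mollifier_nonneg hb _)]; exact hC b hb _
  have i1 : Integrable fun y => mollifier b (y - x) * Ω.indicator w y :=
    hw0.bdd_mul cm.aestronglyMeasurable (Eventually.of_forall hbd)
  have i2 : Integrable fun y => mollifier b (y - x) * Ω.indicator w x :=
    (cm.integrable_of_hasCompactSupport cs).mul_const _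
  have e1 : ∫ y in Ω, mollifier b (y - x) * w y = ∫ y, mollifier b (y - x) * Ω.indicator w y := by
    rw [← integral_indicator hΩo.measurableSet]
    congr 1; ext y
    by_cases hy : y ∈ Ω <;> simp [hy]
  have e2 : (∫ z : Euc n, mollifier 1 z) * w x = ∫ y, mollifier b (y - x) * Ω.indicator w x := by
    rw [integral_mul_const, integral_sub_right_eq_self (fun y => mollifier b y) x,
      integral_mollifier hb, indicator_of_mem hxΩ]
  rw [e1, e2, ← integral_sub i1 i2]
  have e3 : ∫ y, (mollifier b (y - x) * Ω.indicator w y - mollifier b (y - x) * Ω.indicator w x)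
      = ∫ y in Metric.closedBall x (1 / b),
        mollifier b (y - x) * (Ω.indicator w y - Ω.indicator w x) := by
    rw [setIntegral_eq_integral_of_forall_compl_eq_zero]
    · congr 1; ext y; ring
    · intro y hy
      rw [Metric.mem_closedBall, not_le, dist_eq_norm] at hy
      rw [mollifier_eq_zero hb hy.le, zero_mul]
  rw [e3]
  have i3 : IntegrableOn (fun y => ‖Ω.indicator w y - Ω.indicator w x‖)
      (Metric.closedBall x (1 / b)) :=
    (hw0.integrableOn.sub (integrableOn_const (by exact measure_closedBall_lt_top.ne))).norm
  calc ‖∫ y in Metric.closedBall x (1 / b),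
        mollifier b (y - x) * (Ω.indicator w y - Ω.indicator w x)‖
      ≤ ∫ y in Metric.closedBall x (1 / b),
        (C * b ^ n) * ‖Ω.indicator w y - Ω.indicator w x‖ := by
        refine norm_integral_le_of_norm_le (i3.const_mul _) (Eventually.of_forall fun y => ?_)
        rw [norm_mul]
        gcongr
        exact hbd y
    _ = _ := by
        rw [integral_const_mul, setAverage_eq, Measure.real,
          Measure.addHaar_closedBall _ _ (by positivity : 0 ≤ 1 / b), ENNReal.toReal_mul,
          ENNReal.toReal_ofReal (by positivity)]
        have : (volume (Metric.ball (0 : Euc n) 1)).toReal ≠ 0 :=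
          (ENNReal.toReal_pos (Metric.measure_ball_pos _ _ one_pos).ne'
            measure_ball_lt_top.ne).ne'
        simp
        field_simp

/-- **Weyl's lemma** for square-integrable functions. -/
theorem exists_harmonic_ae_eq (hn : 0 < n) (hΩo : IsOpen Ω) (hΩb : Bornology.IsBounded Ω)
    (hw : MemL2 Ω w) (hweak : ∀ φ, IsTestFunction Ω φ →
      ∫ x in Ω, w x * Laplacian.laplacian φ x = 0) :
    ∃ h : Euc n → ℝ, ContDiffOn ℝ ∞ h Ω ∧ InnerProductSpace.HarmonicOnNhd h Ω ∧
      h =ᵐ[volume.restrict Ω] w := by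
  have hwi := integrableOn_of_memL2 hΩb hw
  have hw0 : Integrable (Ω.indicator w) := (integrable_indicator_iff hΩo.measurableSet).2 hwi
  set m := ∫ z : Euc n, mollifier 1 z with hm
  have hm0 : m ≠ 0 := (integral_mollifier_pos hn).ne'
  -- The normalised mollification of `w`: smooth on the whole space, and independent of `b` at each
  -- point whose ball of radius 1/b fits in Ω. The harmonic representative is glued from these.
  let W : ℝ → Euc n → ℝ := fun b x => m⁻¹ * ∫ y in Ω, mollifier b (y - x) * w y
  have hWc : ∀ b b' x, 0 < b → 0 < b' → Metric.closedBall x (1 / b) ⊆ Ω →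
      Metric.closedBall x (1 / b') ⊆ Ω → W b x = W b' x := by
    intro b b' x hb hb' h h'
    simp only [W]
    rw [← integral_mollifier_eq hΩo hΩb hw hweak hb (le_max_left b b') h,
      ← integral_mollifier_eq hΩo hΩb hw hweak hb' (le_max_right b b') h']
  have hWs : ∀ b, 0 < b → ContDiff ℝ ∞ (W b) := by
    intro b hb
    have h1 := (hasCompactSupport_mollifier (n := n) hb).contDiff_convolution_right (μ := volume)
      (ContinuousLinearMap.mul ℝ ℝ) hw0.locallyIntegrable (contDiff_mollifier b)
    have h2 : W b = fun x => m⁻¹ * convolution (Ω.indicator w) (mollifier b)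
        (ContinuousLinearMap.mul ℝ ℝ) volume x := by
      ext x
      simp only [W, convolution]
      congr 1
      rw [← integral_indicator hΩo.measurableSet]
      congr 1; ext y
      by_cases hy : y ∈ Ω
      · simp [hy, mul_comm, ← mollifier_neg b (x - y)]
      · simp [hy]
    rw [h2]
    exact contDiff_const.mul h1
  -- Radius 2/b leaves room: every y within 1/b of x still has its own ball of radius 1/b inside Ω,
  -- so one fixed scale serves a whole neighbourhood.
  have hex : ∀ x ∈ Ω, ∃ b, 0 < b ∧ Metric.closedBall x (2 / b) ⊆ Ω := by
    intro x hx
    obtain ⟨ε, hε, h⟩ := Metric.nhds_basis_closedBall.mem_iff.1 (hΩo.mem_nhds hx)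
    refine ⟨2 / ε, by positivity, ?_⟩
    rwa [div_div_cancel₀ two_ne_zero]
  have hsub : ∀ x y : Euc n, ∀ b, y ∈ Metric.ball x (1 / b) →
      Metric.closedBall y (1 / b) ⊆ Metric.closedBall x (2 / b) := by
    intro x y b hy
    refine Metric.closedBall_subset_closedBall' ?_
    have := Metric.mem_ball.1 hy
    have e : 2 / b = 1 / b + 1 / b := by ring
    linarith
  choose! β hβ0 hβ using hex
  have hβ' : ∀ x ∈ Ω, Metric.closedBall x (1 / β x) ⊆ Ω := fun x hx =>
    (hsub x x _ (Metric.mem_ball_self (by have := hβ0 x hx; positivity))).trans (hβ x hx)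
  have hlim : ∀ᵐ x ∂(volume.restrict Ω), W (β x) x = w x := by
    filter_upwards [ae_tendsto_integral_mollifier hΩo hΩb hw, ae_restrict_mem hΩo.measurableSet]
      with x hx hxΩ
    have h1 : Tendsto (fun b : ℝ => W b x) atTop (𝓝 (w x)) := by
      have := hx.const_mul m⁻¹
      rwa [inv_mul_cancel_left₀ hm0] at this
    refine tendsto_nhds_unique (tendsto_const_nhds.congr' ?_) h1
    filter_upwards [eventually_ge_atTop (β x)] with b hb
    have := hβ0 x hxΩ
    exact hWc _ _ _ this (this.trans_le hb) (hβ' x hxΩ) ((Metric.closedBall_subset_closedBall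
      (one_div_le_one_div_of_le this hb)).trans (hβ' x hxΩ))
  have hball : ∀ x ∈ Ω, Metric.ball x (1 / β x) ⊆ Ω := fun x hx =>
    Metric.ball_subset_closedBall.trans (hβ' x hx)
  have hmem : ∀ x ∈ Ω, x ∈ Metric.ball x (1 / β x) := fun x hx =>
    Metric.mem_ball_self (by have := hβ0 x hx; positivity)
  have heq : ∀ x ∈ Ω, ∀ y ∈ Metric.ball x (1 / β x), W (β y) y = W (β x) y := fun x hx y hy =>
    hWc _ _ _ (hβ0 y (hball x hx hy)) (hβ0 x hx) (hβ' y (hball x hx hy))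
      ((hsub x y _ hy).trans (hβ x hx))
  have hnear : ∀ x ∈ Ω, (fun x => W (β x) x) =ᶠ[𝓝 x] W (β x) := fun x hx =>
    eventually_of_mem (Metric.isOpen_ball.mem_nhds (hmem x hx)) (heq x hx)
  refine ⟨fun x => W (β x) x, fun x hx => ((hWs _ (hβ0 x hx)).contDiffAt.congr_of_eventuallyEq
    (hnear x hx)).contDiffWithinAt, fun x hx => ?_, hlim⟩
  replace hball := hball x hx
  replace hmem := hmem x hx
  replace heq := heq x hx
  replace hnear := hnear x hx
  set b := β x with hbdef
  have hb : 0 < b := hβ0 x hx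
  rw [InnerProductSpace.harmonicAt_congr_nhds hnear]
  refine ⟨((hWs b hb).nat 2).contDiffAt, ?_⟩
  refine eventually_of_mem (Metric.isOpen_ball.mem_nhds hmem) ?_
  have hcont := (contDiff_laplacian (hWs b hb)).continuous
  -- The Laplacian of the mollification is continuous, so it suffices that it vanishes as a
  -- distribution. Tested against g it moves onto g, and on the ball the mollification agrees a.e.
  -- with `w`, whose weak Laplacian is zero.
  refine Measure.eqOn_open_of_ae_eq (μ := volume) ?_ Metric.isOpen_ball hcont.continuousOn
    continuousOn_const
  refine (ae_restrict_iff' measurableSet_ball).2 ?_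
  refine Metric.isOpen_ball.ae_eq_zero_of_integral_contDiff_smul_eq_zero
    (hcont.locallyIntegrable.locallyIntegrableOn _) fun g hg hgc hgs => ?_
  have tg : IsTestFunction (Metric.ball x (1 / b)) g := ⟨hg, hgc, hgs⟩
  have tΩ : IsTestFunction Ω g := tg.mono hball
  have e := integral_mul_laplacian_comm ((hWs b hb).nat 2) tg
  simp_rw [smul_eq_mul, mul_comm (g _)]
  rw [← e, ← tg.laplacian.setIntegral_mul, ← hweak g tΩ, tΩ.laplacian.setIntegral_mul,
    ← tg.laplacian.setIntegral_mul w]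
  refine integral_congr_ae ?_
  filter_upwards [ae_restrict_of_ae_restrict_of_subset hball hlim,
    ae_restrict_mem measurableSet_ball] with y hy hyb
  rw [← heq y hyb, hy]

end Weyl

/-! ### The regularised gradient of the fundamental solution -/

/-- The `i`-th component of `z / (|z|² + c)^(n/2)`, up to a constant factor the (regularised)
gradient of the fundamental solution of the Laplacian. -/
def riesz (c : ℝ) (i : Fin n) (z : Euc n) : ℝ := z i * (‖z‖ ^ 2 + c) ^ (-(n : ℝ) / 2)

/-- The divergence of the regularised vector field `riesz c`. -/
def rieszDiv (c : ℝ) (z : Euc n) : ℝ := n * c * (‖z‖ ^ 2 + c) ^ (-(n : ℝ) / 2 - 1)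

theorem contDiff_riesz {c : ℝ} (hc : 0 < c) (i : Fin n) : ContDiff ℝ ∞ (riesz c i) := by
  have h1 : ContDiff ℝ ∞ fun z : Euc n => ‖z‖ ^ 2 + c := (contDiff_norm_sq ℝ).add contDiff_const
  have h2 : ContDiff ℝ ∞ fun z : Euc n => z i := (EuclideanSpace.proj i : Euc n →L[ℝ] ℝ).contDiff
  exact h2.mul (h1.rpow_const_of_ne fun z => by positivity)

theorem continuous_rieszDiv {c : ℝ} (hc : 0 < c) : Continuous (rieszDiv (n := n) c) := by
  have h1 : ContDiff ℝ ∞ fun z : Euc n => ‖z‖ ^ 2 + c := (contDiff_norm_sq ℝ).add contDiff_const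
  exact (contDiff_const.mul (h1.rpow_const_of_ne (p := -(n : ℝ) / 2 - 1)
    fun z => by positivity)).continuous

theorem pd_riesz {c : ℝ} (hc : 0 < c) (i j : Fin n) (z : Euc n) :
    pd j (riesz c i) z = (if i = j then (‖z‖ ^ 2 + c) ^ (-(n : ℝ) / 2) else 0)
      - n * z i * z j * (‖z‖ ^ 2 + c) ^ (-(n : ℝ) / 2 - 1) := by
  have h1 : HasFDerivAt (fun z : Euc n => ‖z‖ ^ 2 + c) (2 • (innerSL ℝ z)) z :=
    (hasStrictFDerivAt_norm_sq z).hasFDerivAt.add_const c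
  have h2 := h1.rpow_const (p := -(n : ℝ) / 2) (Or.inl (by positivity))
  have h3 : HasFDerivAt (fun z : Euc n => z i) (EuclideanSpace.proj i : Euc n →L[ℝ] ℝ) z :=
    (EuclideanSpace.proj i : Euc n →L[ℝ] ℝ).hasFDerivAt
  have h4 : HasFDerivAt (riesz c i) _ z := h3.mul h2
  unfold pd
  rw [h4.fderiv]
  simp [EuclideanSpace.inner_single_right]
  by_cases hij : i = j
  · simp [hij]; ring
  · simp [hij]; ring

theorem pd_riesz_comm {c : ℝ} (hc : 0 < c) (i j : Fin n) : pd j (riesz c i) = pd i (riesz c j) := by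
  ext z
  rw [pd_riesz hc, pd_riesz hc]
  by_cases hij : i = j
  · simp [hij]
  · simp only [hij, Ne.symm hij, if_false]; ring

theorem sum_pd_riesz {c : ℝ} (hc : 0 < c) (z : Euc n) :
    ∑ i, pd i (riesz c i) z = rieszDiv c z := by
  simp_rw [pd_riesz hc]
  have hq : 0 < ‖z‖ ^ 2 + c := by positivity
  have e : (‖z‖ ^ 2 + c) ^ (-(n : ℝ) / 2) = (‖z‖ ^ 2 + c) ^ (-(n : ℝ) / 2 - 1) * (‖z‖ ^ 2 + c) := by
    rw [Real.rpow_sub_one hq.ne']; field_simp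
  have e2 : ∑ i : Fin n, (n : ℝ) * z i * z i * (‖z‖ ^ 2 + c) ^ (-(n : ℝ) / 2 - 1) =
      n * ‖z‖ ^ 2 * (‖z‖ ^ 2 + c) ^ (-(n : ℝ) / 2 - 1) := by
    rw [EuclideanSpace.norm_sq_eq]
    simp_rw [Finset.mul_sum, Finset.sum_mul]
    refine Finset.sum_congr rfl fun i _ => ?_
    rw [Real.norm_eq_abs, sq_abs]; ring
  rw [Finset.sum_sub_distrib, e2]
  simp only [if_true, Finset.sum_const, Finset.card_univ, Fintype.card_fin, nsmul_eq_mul]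
  rw [e, rieszDiv]; ring

/-- A majorant independent of `c`, valid also for the singular kernel c = 0. At the origin the left
side vanishes because of the factor `z i`, whatever convention gives a value to the power on the
right. -/
theorem norm_riesz_le {c : ℝ} (hc : 0 ≤ c) (i : Fin n) (z : Euc n) :
    ‖riesz c i z‖ ≤ ‖z‖ ^ (1 - (n : ℝ)) := by
  rcases eq_or_ne z 0 with rfl | hz
  · simp [riesz]; positivity
  have hz' : 0 < ‖z‖ := norm_pos_iff.2 hz
  rw [riesz, norm_mul, Real.norm_of_nonneg (by positivity : 0 ≤ (‖z‖ ^ 2 + c) ^ (-(n : ℝ) / 2))]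
  calc ‖z i‖ * (‖z‖ ^ 2 + c) ^ (-(n : ℝ) / 2) ≤ ‖z‖ * (‖z‖ ^ 2) ^ (-(n : ℝ) / 2) := by
        gcongr ?_ * ?_
        · exact PiLp.norm_apply_le z i
        · refine Real.rpow_le_rpow_of_nonpos (by positivity) (by linarith) ?_
          have : (0 : ℝ) ≤ n := by positivity
          linarith
    _ = _ := by
        rw [← Real.rpow_natCast, ← Real.rpow_mul hz'.le, sub_eq_add_neg, Real.rpow_add hz',
          Real.rpow_one]
        congr 2
        push_cast; ring

theorem measurable_riesz (c : ℝ) (i : Fin n) : Measurable (riesz c i) := by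
  unfold riesz
  fun_prop

theorem tendsto_riesz (i : Fin n) (z : Euc n) :
    Tendsto (fun c => riesz c i z) (𝓝[>] 0) (𝓝 (riesz 0 i z)) := by
  rcases eq_or_ne z 0 with rfl | hz
  · simp [riesz]
  have hz' : 0 < ‖z‖ := norm_pos_iff.2 hz
  have h : ContinuousAt (fun c => riesz c i z) 0 := by
    unfold riesz
    refine continuousAt_const.mul (ContinuousAt.rpow_const (by fun_prop) (Or.inl ?_))
    rw [add_zero]; positivity
  exact h.tendsto.mono_left nhdsWithin_le_nhds

/-- In polar coordinates the integrand becomes r^((n-1)+(1-n)s), integrable at 0 when the exponent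
exceeds -1. That is the condition (n-1)s < n. -/
theorem eLpNorm_norm_rpow_lt_top (hn : 0 < n) {s : ℝ} (hs0 : 0 < s) (hs : (n - 1) * s < n) {R : ℝ}
    (hR : 0 < R) : ∫⁻ z in Metric.ball (0 : Euc n) R,
      ENNReal.ofReal (‖z‖ ^ (1 - (n : ℝ))) ^ s ≠ ⊤ := by
  have : Nontrivial (Euc n) := by
    have : Nonempty (Fin n) := ⟨⟨0, hn⟩⟩
    infer_instance
  have h := (integrableOn_fun_norm_addHaar (E := Euc n) volume
    (f := fun y : ℝ => (y ^ (1 - (n : ℝ))) ^ s) (r := R)).2 ?_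
  · have h2 := h.2
    rw [hasFiniteIntegral_iff_ofReal (Eventually.of_forall fun z => by positivity)] at h2
    refine ne_of_lt (lt_of_le_of_lt (le_of_eq ?_) h2)
    refine lintegral_congr fun z => ?_
    rw [ENNReal.ofReal_rpow_of_nonneg (by positivity) hs0.le]
  · have h1 : -1 < (n - 1 : ℝ) + (1 - n) * s := by linarith
    refine ((intervalIntegral.integrableOn_Ioo_rpow_iff hR).2 h1).congr_fun ?_ measurableSet_Ioo
    intro y hy
    simp only [smul_eq_mul, finrank_euclideanSpace, Fintype.card_fin]
    rw [Real.rpow_add hy.1, Real.rpow_mul hy.1.le, ← Real.rpow_natCast, Nat.cast_sub hn, Nat.cast_one]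

/-- The uniform bound for the `Lˢ` norms of the kernels `riesz c i` on a ball. -/
def rieszBound (n : ℕ) (s R : ℝ) : ℝ≥0∞ :=
  (∫⁻ z in Metric.ball (0 : Euc n) R, ENNReal.ofReal (‖z‖ ^ (1 - (n : ℝ))) ^ s) ^ (1 / s)

theorem rieszBound_ne_top (hn : 0 < n) {s : ℝ} (hs0 : 0 < s) (hs : (n - 1) * s < n) {R : ℝ}
    (hR : 0 < R) : rieszBound n s R ≠ ⊤ :=
  ENNReal.rpow_ne_top_of_nonneg (by positivity) (eLpNorm_norm_rpow_lt_top hn hs0 hs hR)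

theorem eLpNorm_riesz_le {c : ℝ} (hc : 0 ≤ c) (i : Fin n) {s : ℝ} (hs0 : 0 < s) (R : ℝ) :
    eLpNorm (riesz c i) (ENNReal.ofReal s) (volume.restrict (Metric.ball 0 R)) ≤
      rieszBound n s R := by
  rw [eLpNorm_eq_lintegral_rpow_enorm_toReal (by simpa using hs0) (by simp),
    ENNReal.toReal_ofReal hs0.le, rieszBound]
  gcongr with z
  rw [← ofReal_norm]
  exact ENNReal.ofReal_le_ofReal (norm_riesz_le hc i z)

theorem tendsto_eLpNorm_riesz_sub (hn : 0 < n) (i : Fin n) {s : ℝ} (hs0 : 0 < s)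
    (hs : (n - 1) * s < n) {R : ℝ} (hR : 0 < R) :
    Tendsto (fun c => eLpNorm (fun z => riesz c i z - riesz 0 i z) (ENNReal.ofReal s)
      (volume.restrict (Metric.ball 0 R))) (𝓝[>] 0) (𝓝 0) := by
  simp_rw [eLpNorm_eq_lintegral_rpow_enorm_toReal (p := ENNReal.ofReal s) (by simpa using hs0)
    (by simp), ENNReal.toReal_ofReal hs0.le]
  have h0 : Tendsto (fun c => ∫⁻ z in Metric.ball (0 : Euc n) R, ‖riesz c i z - riesz 0 i z‖ₑ ^ s)
      (𝓝[>] 0) (𝓝 (∫⁻ z in Metric.ball (0 : Euc n) R, 0)) := by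
    refine tendsto_lintegral_filter_of_dominated_convergence
      (fun z => 2 ^ s * ENNReal.ofReal (‖z‖ ^ (1 - (n : ℝ))) ^ s) ?_ ?_ ?_ ?_
    · refine Eventually.of_forall fun c => ?_
      exact (((measurable_riesz c i).sub (measurable_riesz 0 i)).enorm).pow_const s
    · filter_upwards [self_mem_nhdsWithin] with c hc
      refine Eventually.of_forall fun z => ?_
      rw [← ENNReal.mul_rpow_of_nonneg _ _ hs0.le]
      gcongr
      refine (enorm_sub_le).trans ?_
      rw [two_mul, ← ofReal_norm, ← ofReal_norm]
      gcongr
      · exact norm_riesz_le (le_of_lt hc) i z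
      · exact norm_riesz_le le_rfl i z
    · rw [lintegral_const_mul' _ _ (by simp)]
      exact ENNReal.mul_ne_top (by simp) (eLpNorm_norm_rpow_lt_top hn hs0 hs hR)
    · refine Eventually.of_forall fun z => ?_
      have h1 := ((tendsto_riesz i z).sub_const (riesz 0 i z)).enorm
      have h2 := (ENNReal.continuous_rpow_const (y := s)).tendsto _ |>.comp h1
      simpa [hs0, Function.comp_def] using h2
  have h1 := (ENNReal.continuous_rpow_const (y := 1 / s)).tendsto _ |>.comp h0
  simpa [hs0, Function.comp_def] using h1

theorem integrable_rieszDiv_one : Integrable (rieszDiv (n := n) 1) := by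
  have h := integrable_rpow_neg_one_add_norm_sq (E := Euc n) (μ := volume) (r := n + 2) (by simp)
  refine (h.const_mul (n : ℝ)).congr (Eventually.of_forall fun z => ?_)
  simp only [rieszDiv, mul_one]
  rw [add_comm 1 (‖z‖ ^ 2)]
  congr 2; ring

theorem integral_rieszDiv_one_pos (hn : 0 < n) : 0 < ∫ z : Euc n, rieszDiv 1 z := by
  have hn' : (0 : ℝ) < n := by exact_mod_cast hn
  have hpos : ∀ z : Euc n, 0 < rieszDiv 1 z := fun z => by unfold rieszDiv; positivity
  rw [integral_pos_iff_support_of_nonneg (fun z => (hpos z).le) integrable_rieszDiv_one]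
  have : Function.support (rieszDiv (n := n) 1) = univ := by
    ext z; simpa using (hpos z).ne'
  rw [this]
  exact Measure.measure_univ_pos.2 (NeZero.ne _)

/-! ### The associated approximation of the identity -/

/-- Convolution with the approximation of the identity `rieszDiv c`. -/
def rieszMean (c : ℝ) (f : Euc n → ℝ) (x : Euc n) : ℝ := ∫ z, rieszDiv c z * f (x - z)

/-- With c = ε² the kernel is the L¹-normalised dilation by ε of the kernel at c = 1. Its mass
therefore does not depend on c. -/
theorem rieszMean_eq {ε : ℝ} (hε : 0 < ε) (f : Euc n → ℝ) (x : Euc n) :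
    rieszMean (ε ^ 2) f x = ∫ z, rieszDiv 1 z * f (x - ε • z) := by
  have h := Measure.integral_comp_smul_of_nonneg (μ := volume)
    (fun z : Euc n => rieszDiv (ε ^ 2) z * f (x - z)) ε (hR := hε.le)
  have e : ∀ z : Euc n, rieszDiv (ε ^ 2) (ε • z) * f (x - ε • z) =
      (ε ^ n)⁻¹ * (rieszDiv 1 z * f (x - ε • z)) := fun z => by
    have h1 : ‖ε • z‖ ^ 2 + ε ^ 2 = ε ^ 2 * (‖z‖ ^ 2 + 1) := by
      rw [norm_smul, Real.norm_of_nonneg hε.le]; ring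
    have h2 : (ε ^ 2) ^ (-(n : ℝ) / 2 - 1) = (ε ^ n)⁻¹ * (ε ^ 2)⁻¹ := by
      rw [← Real.rpow_natCast ε 2, ← Real.rpow_mul hε.le, ← Real.rpow_natCast ε n,
        ← Real.rpow_neg hε.le, ← Real.rpow_neg hε.le, ← Real.rpow_add hε]
      congr 1; push_cast; ring
    rw [rieszDiv, rieszDiv, h1, Real.mul_rpow (by positivity) (by positivity), h2]
    field_simp
  simp_rw [e] at h
  rw [integral_const_mul] at h
  simp only [smul_eq_mul, finrank_euclideanSpace, Fintype.card_fin] at h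
  have h3 : (ε ^ n)⁻¹ ≠ 0 := by positivity
  exact (mul_left_cancel₀ h3 h).symm

theorem integrable_rieszDiv {c : ℝ} (hc : 0 < c) : Integrable (rieszDiv (n := n) c) := by
  have h := integrable_rieszDiv_one (n := n)
  refine (h.comp_smul (R := (Real.sqrt c)⁻¹) (by positivity)).const_mul
    (c * c ^ (-(n : ℝ) / 2 - 1)) |>.congr (Eventually.of_forall fun z => ?_)
  have h1 : ‖z‖ ^ 2 + c = c * (‖(Real.sqrt c)⁻¹ • z‖ ^ 2 + 1) := by
    rw [norm_smul, norm_inv, Real.norm_of_nonneg (Real.sqrt_nonneg c), mul_pow, inv_pow,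
      Real.sq_sqrt hc.le]
    field_simp
  simp only [rieszDiv]
  rw [h1, Real.mul_rpow hc.le (by positivity)]
  ring

theorem tendsto_rieszMean {f : Euc n → ℝ} (hf : Continuous f) {M : ℝ} (hM : ∀ x, ‖f x‖ ≤ M)
    (x : Euc n) : Tendsto (fun ε : ℝ => rieszMean (ε ^ 2) f x) (𝓝[>] 0)
      (𝓝 ((∫ z : Euc n, rieszDiv 1 z) * f x)) := by
  have h1 : Tendsto (fun ε : ℝ => ∫ z, rieszDiv 1 z * f (x - ε • z)) (𝓝[>] 0)
      (𝓝 (∫ z : Euc n, rieszDiv 1 z * f x)) := by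
    refine tendsto_integral_filter_of_dominated_convergence (fun z => ‖rieszDiv 1 z‖ * M) ?_ ?_ ?_ ?_
    · refine Eventually.of_forall fun ε => ?_
      exact ((continuous_rieszDiv one_pos).mul (hf.comp (by fun_prop))).aestronglyMeasurable
    · refine Eventually.of_forall fun ε => Eventually.of_forall fun z => ?_
      rw [norm_mul]; gcongr; exact hM _
    · exact integrable_rieszDiv_one.norm.mul_const M
    · refine Eventually.of_forall fun z => ?_
      have : ContinuousAt (fun ε : ℝ => rieszDiv 1 z * f (x - ε • z)) 0 := by fun_prop
      simpa using this.tendsto.mono_left nhdsWithin_le_nhds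
  rw [← integral_mul_const]
  refine h1.congr' ?_
  filter_upwards [self_mem_nhdsWithin] with ε hε
  rw [rieszMean_eq hε]

section Potential

variable {Ω : Set (Euc n)} {φ : Euc n → ℝ}

theorem IsTestFunction.comp_sub (h : IsTestFunction Ω φ) (x : Euc n) :
    IsTestFunction univ (fun z => φ (x - z)) :=
  ⟨h.1.comp (contDiff_const.sub contDiff_id),
    h.2.1.comp_homeomorph (Homeomorph.subLeft x), subset_univ _⟩

theorem pd_comp_sub {f : Euc n → ℝ} (hf : Differentiable ℝ f) (x : Euc n) (i : Fin n) :
    pd i (fun z => f (x - z)) = fun z => - pd i f (x - z) := by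
  ext z
  have h1 : HasFDerivAt (fun z => x - z) (-(ContinuousLinearMap.id ℝ (Euc n))) z :=
    (hasFDerivAt_id z).const_sub x
  unfold pd
  have h2 : HasFDerivAt (fun z => f (x - z)) _ z := (hf (x - z)).hasFDerivAt.comp z h1
  rw [h2.fderiv]
  simp

theorem IsTestFunction.laplacian_comp_sub (h : IsTestFunction Ω φ) (x z : Euc n) :
    Laplacian.laplacian (fun z => φ (x - z)) z = Laplacian.laplacian φ (x - z) := by
  rw [(h.comp_sub x).laplacian_eq, h.laplacian_eq]
  refine Finset.sum_congr rfl fun i _ => ?_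
  rw [pd_comp_sub (h.1.differentiable (by simp))]
  have : InvCond.pd i (fun z => - InvCond.pd i φ (x - z)) z =
      - InvCond.pd i (fun z => InvCond.pd i φ (x - z)) z := by
    unfold InvCond.pd
    rw [fderiv_fun_neg]; rfl
  rw [this, pd_comp_sub ((h.pd i).1.differentiable (by simp)), neg_neg]

theorem integral_rieszDiv_mul {c : ℝ} (hc : 0 < c) (h : IsTestFunction Ω φ) :
    ∫ z, rieszDiv c z * φ z = - ∑ i, ∫ z, riesz c i z * pd i φ z := by
  simp_rw [← sum_pd_riesz hc, Finset.sum_mul]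
  rw [integral_finsetSum, ← Finset.sum_neg_distrib]
  · refine Finset.sum_congr rfl fun i _ => ?_
    rw [integral_mul_pd ((contDiff_riesz hc i).nat 1) (h.contDiff 1) h.2.1, neg_neg]
  · exact fun i _ => ((contDiff_pd (contDiff_riesz hc i) i).continuous.mul
      h.1.continuous).integrable_of_hasCompactSupport h.2.1.mul_left

/-- The field `riesz c` is radial, hence curl-free (`pd_riesz_comm`), so the `j`-th derivative of
its divergence is the Laplacian of its `j`-th component. -/
theorem integral_rieszDiv_mul_pd {c : ℝ} (hc : 0 < c) (h : IsTestFunction Ω φ) (j : Fin n) :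
    ∫ z, rieszDiv c z * pd j φ z = - ∫ z, riesz c j z * Laplacian.laplacian φ z := by
  rw [integral_rieszDiv_mul hc (h.pd j)]
  congr 1
  simp_rw [h.laplacian_eq, Finset.mul_sum]
  rw [integral_finsetSum]
  · refine Finset.sum_congr rfl fun i _ => ?_
    have e : ∀ z, pd i (pd j φ) z = pd j (pd i φ) z := fun z =>
      pd_comm (h.contDiff 2).contDiffAt i j
    simp_rw [e]
    rw [integral_mul_pd ((contDiff_riesz hc i).nat 1) ((h.pd i).contDiff 1) (h.pd i).2.1,
      integral_mul_pd ((contDiff_riesz hc j).nat 1) ((h.pd i).contDiff 1) (h.pd i).2.1,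
      pd_riesz_comm hc]
  · exact fun i _ => ((contDiff_riesz hc j).continuous.mul
      ((h.pd i).pd i).1.continuous).integrable_of_hasCompactSupport ((h.pd i).pd i).2.1.mul_left

theorem IsTestFunction.setIntegral_sub_mul (h : IsTestFunction Ω φ) (κ : Euc n → ℝ) (x : Euc n) :
    ∫ z, κ z * φ (x - z) = ∫ y in Ω, κ (x - y) * φ y := by
  rw [h.setIntegral_mul, ← integral_sub_left_eq_self _ volume x]
  simp

/-- As c → 0 this becomes the representation of φ by its gradient, from which the supremum bound is
read off. -/
theorem rieszMean_eq_sum {c : ℝ} (hc : 0 < c) (h : IsTestFunction Ω φ) (x : Euc n) :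
    rieszMean c φ x = ∑ i, ∫ y in Ω, riesz c i (x - y) * pd i φ y := by
  rw [rieszMean, integral_rieszDiv_mul hc (h.comp_sub x), ← Finset.sum_neg_distrib]
  refine Finset.sum_congr rfl fun i _ => ?_
  rw [← (h.pd i).setIntegral_sub_mul, ← integral_neg]
  congr 1; ext z
  rw [pd_comp_sub (h.1.differentiable (by simp))]
  ring

/-- The linear form with coefficients `v`. -/
def linForm (v : Fin n → ℝ) : Euc n →L[ℝ] ℝ :=
  ∑ i, v i • (EuclideanSpace.proj i : Euc n →L[ℝ] ℝ)

theorem linForm_apply (v : Fin n → ℝ) (u : Euc n) : linForm v u = ∑ i, v i * u i := by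
  simp [linForm]

theorem norm_linForm_le (v : Fin n → ℝ) : ‖linForm v‖ ≤ ∑ i, |v i| := by
  refine ContinuousLinearMap.opNorm_le_bound _ (by positivity) fun u => ?_
  rw [linForm_apply, Finset.sum_mul]
  refine (norm_sum_le _ _).trans (Finset.sum_le_sum fun i _ => ?_)
  rw [norm_mul, Real.norm_eq_abs]
  gcongr
  exact PiLp.norm_apply_le u i

/-- The gradient of the mean is expressed through the Laplacian of φ alone. This form survives when
only the Laplacians of a sequence are known to converge. -/
theorem hasFDerivAt_rieszMean {c : ℝ} (hc : 0 < c) (h : IsTestFunction Ω φ) (x : Euc n) :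
    HasFDerivAt (rieszMean c φ)
      (linForm fun j => ∫ y in Ω, riesz c j (x - y) * Laplacian.laplacian φ y) x := by
  have hli := (integrable_rieszDiv (n := n) hc).locallyIntegrable
  have h1 := h.2.1.hasFDerivAt_convolution_right (μ := volume) (ContinuousLinearMap.mul ℝ ℝ) hli
    (h.contDiff 1) x
  refine HasFDerivAt.congr_fderiv (f := rieszMean c φ) h1 ?_
  ext u
  rw [convolution_precompR_apply _ hli (h.2.1.fderiv ℝ)
    ((h.contDiff 1).continuous_fderiv one_ne_zero), linForm_apply]
  simp only [convolution, ContinuousLinearMap.mul_apply']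
  simp_rw [clm_apply_eq_sum _ u, Finset.mul_sum]
  rw [integral_finsetSum]
  · refine Finset.sum_congr rfl fun j _ => ?_
    have e1 := integral_rieszDiv_mul_pd hc (h.comp_sub x) j
    simp_rw [pd_comp_sub (h.1.differentiable (by simp)), h.laplacian_comp_sub] at e1
    rw [h.laplacian.setIntegral_sub_mul] at e1
    simp_rw [mul_neg] at e1
    rw [integral_neg, neg_inj] at e1
    rw [← e1, mul_comm, ← integral_const_mul]
    congr 1; ext z
    rw [InvCond.pd]; ring
  · intro j _
    have hp := ((h.pd j).comp_sub x)
    exact (((continuous_rieszDiv hc).mul hp.1.continuous).integrable_of_hasCompactSupport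
      hp.2.1.mul_left).const_mul (u j) |>.congr (Eventually.of_forall fun z => by
        simp only [InvCond.pd, Pi.mul_apply]; ring)

theorem eLpNorm_comp_sub_le {R : ℝ} (hR : Ω ⊆ Metric.ball 0 R) {x : Euc n}
    (hx : x ∈ Metric.ball (0 : Euc n) R) (s : ℝ≥0∞) {κ : Euc n → ℝ} (hκ : Measurable κ) :
    eLpNorm (fun y => κ (x - y)) s (volume.restrict Ω) ≤
      eLpNorm κ s (volume.restrict (Metric.ball 0 (2 * R))) := by
  have mp := (Measure.measurePreserving_sub_left (volume : Measure (Euc n)) x).restrict_preimage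
    (s := Metric.ball 0 (2 * R)) measurableSet_ball
  rw [← eLpNorm_comp_measurePreserving hκ.aestronglyMeasurable mp]
  refine eLpNorm_mono_measure _ (Measure.restrict_mono ?_ le_rfl)
  intro y hy
  have h1 := mem_ball_zero_iff.1 (hR hy)
  have h2 := mem_ball_zero_iff.1 hx
  rw [mem_preimage, mem_ball_zero_iff]
  linarith [norm_sub_le x y]

theorem integrable_comp_sub_mul {R : ℝ} (hR : Ω ⊆ Metric.ball 0 R) {x : Euc n}
    (hx : x ∈ Metric.ball (0 : Euc n) R) {s q : ℝ≥0∞} [s.HolderTriple q 1] {κ f : Euc n → ℝ}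
    (hκ : Measurable κ) (hκs : eLpNorm κ s (volume.restrict (Metric.ball 0 (2 * R))) ≠ ⊤)
    (hf : MemLp f q (volume.restrict Ω)) :
    Integrable (fun y => κ (x - y) * f y) (volume.restrict Ω) := by
  have h : MemLp (fun y => κ (x - y)) s (volume.restrict Ω) :=
    ⟨(hκ.comp (by fun_prop)).aestronglyMeasurable,
      (eLpNorm_comp_sub_le hR hx s hκ).trans_lt hκs.lt_top⟩
  exact h.integrable_mul hf

/-- Hölder's inequality for convolutions on a bounded set. -/
theorem enorm_integral_sub_mul_le {R : ℝ} (hR : Ω ⊆ Metric.ball 0 R) {x : Euc n}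
    (hx : x ∈ Metric.ball (0 : Euc n) R) {s q : ℝ≥0∞} [s.HolderTriple q 1] {κ f : Euc n → ℝ}
    (hκ : Measurable κ) (hf : AEStronglyMeasurable f (volume.restrict Ω)) :
    ‖∫ y in Ω, κ (x - y) * f y‖ₑ ≤
      eLpNorm κ s (volume.restrict (Metric.ball 0 (2 * R))) * eLpNorm f q (volume.restrict Ω) := by
  have hm : Measurable fun y => κ (x - y) := hκ.comp (by fun_prop)
  refine (enorm_integral_le_lintegral_enorm _).trans ?_
  rw [← eLpNorm_one_eq_lintegral_enorm]
  refine (eLpNorm_smul_le_mul_eLpNorm (p := s) (q := q) (r := 1) hf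
    hm.aestronglyMeasurable).trans ?_
  gcongr
  exact eLpNorm_comp_sub_le hR hx s hκ

end Potential

/-! ### A priori estimates for test functions -/

theorem eLpNorm_two_le_of_integral_sq_le {α β : Type*} [MeasurableSpace α] [MeasurableSpace β]
    {μ : Measure α} {ν : Measure β} {f : α → ℝ} {g : β → ℝ} (hf : MemLp f 2 μ) (hg : MemLp g 2 ν)
    (h : ∫ x, f x ^ 2 ∂μ ≤ ∫ x, g x ^ 2 ∂ν) : eLpNorm f 2 μ ≤ eLpNorm g 2 ν := by
  rw [hf.eLpNorm_eq_integral_rpow_norm two_ne_zero ENNReal.ofNat_ne_top,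
    hg.eLpNorm_eq_integral_rpow_norm two_ne_zero ENNReal.ofNat_ne_top]
  refine ENNReal.ofReal_le_ofReal (Real.rpow_le_rpow (by positivity) ?_ (by positivity))
  simpa using h

theorem clm_norm_le_sum {F : Type*} [NormedAddCommGroup F] [NormedSpace ℝ F]
    (L : Euc n →L[ℝ] F) : ‖L‖ ≤ ∑ i, ‖L (EuclideanSpace.single i 1)‖ := by
  refine L.opNorm_le_bound (by positivity) fun u => ?_
  conv_lhs => rw [euc_eq_sum u]
  rw [map_sum, Finset.sum_mul]
  refine (norm_sum_le _ _).trans (Finset.sum_le_sum fun i _ => ?_)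
  rw [map_smul, norm_smul, mul_comm]
  gcongr
  exact PiLp.norm_apply_le u i

section Estimates

variable {Ω : Set (Euc n)} {φ : Euc n → ℝ}

theorem integral_sq_pd_pd (h : IsTestFunction Ω φ) (i j : Fin n) :
    ∫ x, pd i (pd j φ) x ^ 2 = ∫ x, pd i (pd i φ) x * pd j (pd j φ) x := by
  have e : ∀ k l, pd k (pd l φ) = pd l (pd k φ) := fun k l => by
    ext x; exact pd_comm (h.contDiff 2).contDiffAt k l
  have e3 : pd j (pd i (pd j φ)) = pd i (pd j (pd j φ)) := by
    ext x; exact pd_comm ((h.pd j).contDiff 2).contDiffAt j i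
  simp_rw [pow_two]
  conv_lhs => enter [2, x]; rw [e i j]
  calc ∫ x, pd j (pd i φ) x * pd j (pd i φ) x
      = - ∫ x, pd i φ x * pd j (pd j (pd i φ)) x := by
        rw [integral_mul_pd ((h.pd i).contDiff 1) (((h.pd i).pd j).contDiff 1)
          ((h.pd i).pd j).2.1, neg_neg]
    _ = - ∫ x, pd i φ x * pd i (pd j (pd j φ)) x := by rw [e j i, e3]
    _ = _ := by
        rw [integral_mul_pd ((h.pd i).contDiff 1) (((h.pd j).pd j).contDiff 1)
          ((h.pd j).pd j).2.1, neg_neg]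

/-- Expanding the square of Δφ and integrating each product by parts twice gives the sum of the
squared L² norms of all second derivatives. Each of them is therefore bounded with constant 1. -/
theorem eLpNorm_pd_pd_le (h : IsTestFunction Ω φ) (i j : Fin n) :
    eLpNorm (InvCond.pd i (InvCond.pd j φ)) 2 volume ≤
      eLpNorm (Laplacian.laplacian φ) 2 volume := by
  refine eLpNorm_two_le_of_integral_sq_le (((h.pd j).pd i).memLp 2 _) (h.laplacian.memLp 2 _) ?_
  have hint : ∀ k l, Integrable fun x => InvCond.pd k (InvCond.pd k φ) x *
      InvCond.pd l (InvCond.pd l φ) x := fun k l =>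
    (((h.pd k).pd k).1.continuous.mul ((h.pd l).pd l).1.continuous).integrable_of_hasCompactSupport
      ((h.pd l).pd l).2.1.mul_left
  have e : ∫ x, Laplacian.laplacian φ x ^ 2 =
      ∑ k, ∑ l, ∫ x, InvCond.pd k (InvCond.pd l φ) x ^ 2 := by
    simp_rw [h.laplacian_eq, pow_two, Finset.sum_mul, Finset.mul_sum]
    rw [integral_finsetSum _ fun k _ => integrable_finsetSum _ fun l _ => hint k l]
    refine Finset.sum_congr rfl fun k _ => ?_
    rw [integral_finsetSum _ fun l _ => hint k l]
    refine Finset.sum_congr rfl fun l _ => ?_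
    rw [← integral_sq_pd_pd h k l]
    simp_rw [pow_two]
  rw [e]
  have nn : ∀ k l, 0 ≤ ∫ x, InvCond.pd k (InvCond.pd l φ) x ^ 2 := fun k l =>
    integral_nonneg fun x => sq_nonneg _
  exact (Finset.single_le_sum (f := fun l => ∫ x, InvCond.pd i (InvCond.pd l φ) x ^ 2)
    (fun l _ => nn i l) (Finset.mem_univ j)).trans (Finset.single_le_sum
      (f := fun k => ∑ l, ∫ x, InvCond.pd k (InvCond.pd l φ) x ^ 2)
      (fun k _ => Finset.sum_nonneg fun l _ => nn k l) (Finset.mem_univ i))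

theorem eLpNorm_fderiv_fderiv_le (h : IsTestFunction Ω φ) :
    eLpNorm (fderiv ℝ (fderiv ℝ φ)) 2 volume ≤
      (n * n : ℝ≥0∞) * eLpNorm (Laplacian.laplacian φ) 2 volume := by
  let G : Fin n → Fin n → Euc n → ℝ := fun i j x => ‖pd i (pd j φ) x‖
  have h1 : ∀ x, ‖fderiv ℝ (fderiv ℝ φ) x‖ ≤ (∑ i, ∑ j, G i j) x := by
    intro x
    refine (clm_norm_le_sum _).trans ?_
    simp only [Finset.sum_apply]
    refine Finset.sum_le_sum fun i _ => (clm_norm_le_sum _).trans (Finset.sum_le_sum fun j _ => ?_)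
    simp only [G]
    rw [pd_pd (h.contDiff 2).contDiffAt]
  have hm : ∀ i j, AEStronglyMeasurable (G i j) volume :=
    fun i j => ((h.pd j).pd i).1.continuous.norm.aestronglyMeasurable
  have h2 : ∀ i j, eLpNorm (G i j) 2 volume ≤ eLpNorm (Laplacian.laplacian φ) 2 volume :=
    fun i j => by
      simp only [G]
      rw [eLpNorm_norm]
      exact eLpNorm_pd_pd_le h i j
  obtain ⟨S, hSdef⟩ : ∃ S, S = ∑ i, ∑ j, G i j := ⟨_, rfl⟩
  rw [← hSdef] at h1
  have hS : eLpNorm (fderiv ℝ (fderiv ℝ φ)) 2 volume ≤ eLpNorm S 2 volume := by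
    rw [← eLpNorm_norm (fderiv ℝ (fderiv ℝ φ))]
    refine eLpNorm_mono_real fun x => ?_
    rw [norm_norm]
    exact h1 x
  calc eLpNorm (fderiv ℝ (fderiv ℝ φ)) 2 volume
      ≤ eLpNorm S 2 volume := hS
    _ ≤ ∑ i, eLpNorm (∑ j, G i j) 2 volume := hSdef ▸
        eLpNorm_sum_le (fun i _ => Finset.aestronglyMeasurable_sum _ fun j _ => hm i j) one_le_two
    _ ≤ ∑ i : Fin n, ∑ j : Fin n, eLpNorm (Laplacian.laplacian φ) 2 volume :=
        Finset.sum_le_sum fun i _ => (eLpNorm_sum_le (fun j _ => hm i j) one_le_two).trans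
          (Finset.sum_le_sum fun j _ => h2 i j)
    _ = _ := by simp [mul_assoc]

theorem eLpNorm_restrict_eq_of_norm_eq_zero {α E : Type*} [MeasurableSpace α] {μ : Measure α}
    [NormedAddCommGroup E] {f : α → E} {s : Set α} (h : ∀ x ∉ s, ‖f x‖ = 0) (p : ℝ≥0∞) :
    eLpNorm f p (μ.restrict s) = eLpNorm f p μ :=
  eLpNorm_restrict_eq_of_support_subset fun x hx => by
    by_contra hxs
    exact hx (norm_eq_zero.1 (h x hxs))

/-- The Gagliardo–Nirenberg–Sobolev inequality with `L²` norm of the derivative, in dimensions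
two and three. -/
theorem exists_eLpNorm_le_fderiv (hn : n = 2 ∨ n = 3) (hΩb : Bornology.IsBounded Ω)
    (F : Type*) [NormedAddCommGroup F] [NormedSpace ℝ F] [FiniteDimensional ℝ F] {q : NNReal}
    (hq : 1 / 4 ≤ (q : ℝ)⁻¹) :
    ∃ C : ℝ≥0∞, C ≠ ⊤ ∧ ∀ u : Euc n → F, ContDiff ℝ 1 u → tsupport u ⊆ Ω →
      eLpNorm u q volume ≤ C * eLpNorm (fderiv ℝ u) 2 volume := by
  -- The Sobolev inequality requires p < n, which excludes p = 2 in the plane, and 1/p - 1/n ≤ 1/q.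
  -- With 1/p = 7/12 the left side is 1/12 for n = 2 and 1/4 for n = 3, whence the hypothesis on
  -- `q`. Hölder's inequality on the bounded set then passes from p to 2.
  let p : NNReal := 12 / 7
  have hp : ((p : ℝ≥0∞)).toReal = 12 / 7 := by simp [p]
  have hp2 : (p : ℝ≥0∞) ≤ 2 := by
    have : p ≤ 2 := by
      rw [← NNReal.coe_le_coe]; simp only [p]; push_cast; norm_num
    exact_mod_cast this
  refine ⟨eLpNormLESNormFDerivOfLeConst F (volume : Measure (Euc n)) Ω p q *
    volume Ω ^ (1 / (p : ℝ≥0∞).toReal - 1 / (2 : ℝ≥0∞).toReal), ?_, fun u hu hs => ?_⟩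
  · refine ENNReal.mul_ne_top ENNReal.coe_ne_top (ENNReal.rpow_ne_top_of_nonneg ?_
      hΩb.measure_lt_top.ne)
    rw [hp]; norm_num
  · have h1 := eLpNorm_le_eLpNorm_fderiv_of_le (volume : Measure (Euc n)) (p := p) (q := q) hu
      ((subset_tsupport u).trans hs) ?_ ?_ ?_ hΩb
    · refine h1.trans ?_
      rw [mul_assoc]
      gcongr
      have hsub : ∀ x ∉ Ω, ‖fderiv ℝ u x‖ = 0 := fun x hx => by
        rw [image_eq_zero_of_notMem_tsupport fun h => hx (hs (tsupport_fderiv_subset ℝ h)),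
          norm_zero]
      rw [← eLpNorm_restrict_eq_of_norm_eq_zero hsub p, mul_comm,
        ← eLpNorm_restrict_eq_of_norm_eq_zero hsub 2]
      have := eLpNorm_le_eLpNorm_mul_rpow_measure_univ (μ := volume.restrict Ω) hp2
        (hu.continuous_fderiv one_ne_zero).aestronglyMeasurable
      rwa [Measure.restrict_apply_univ] at this
    · rw [← NNReal.coe_le_coe]; simp only [p]; push_cast; norm_num
    · rw [← NNReal.coe_lt_coe]
      rcases hn with rfl | rfl <;> simp only [p, finrank_euclideanSpace, Fintype.card_fin] <;>
        push_cast <;> norm_num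
    · refine le_trans ?_ hq
      rcases hn with rfl | rfl <;> simp only [p, finrank_euclideanSpace, Fintype.card_fin] <;>
        push_cast <;> norm_num

/-- A Morrey-type bound: represent φ by its gradient and apply Hölder's inequality with exponents
4/3 and 4. The kernel |z|^(1-n) is locally in L^(4/3) because (n-1)·4/3 < n for n < 4. -/
theorem exists_norm_le_eLpNorm_pd (hn : n = 2 ∨ n = 3) (hΩb : Bornology.IsBounded Ω) :
    ∃ C : ℝ≥0∞, C ≠ ⊤ ∧ ∀ φ, IsTestFunction Ω φ → ∀ x,
      ‖φ x‖ₑ ≤ C * ∑ i, eLpNorm (pd i φ) (ENNReal.ofReal 4) volume := by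
  obtain ⟨R, hR0, hR⟩ : ∃ R, 0 < R ∧ Ω ⊆ Metric.ball 0 R := by
    obtain ⟨R, hR⟩ := hΩb.subset_ball 0
    exact ⟨max R 1, by positivity, hR.trans (Metric.ball_subset_ball (le_max_left _ _))⟩
  have hn0 : 0 < n := by omega
  set m := ∫ z : Euc n, rieszDiv 1 z with hm
  have hm0 : 0 < m := integral_rieszDiv_one_pos hn0
  have hm' : ‖m‖ₑ ≠ 0 := by simpa using hm0.ne'
  have hB := rieszBound_ne_top (n := n) hn0 (s := 4 / 3) (R := 2 * R) (by norm_num)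
    (by rcases hn with rfl | rfl <;> norm_num) (by positivity)
  refine ⟨‖m‖ₑ⁻¹ * rieszBound n (4 / 3) (2 * R), ENNReal.mul_ne_top (by simpa using hm0.ne') hB,
    fun φ h x => ?_⟩
  by_cases hx : x ∈ Ω
  swap
  · rw [h.eq_zero hx]; simp
  have hc : (4 / 3 : ℝ).HolderConjugate 4 := by
    rw [Real.holderConjugate_iff]; norm_num
  have : (ENNReal.ofReal (4 / 3)).HolderConjugate (ENNReal.ofReal 4) := hc.ennrealOfReal
  obtain ⟨M, hM⟩ := h.2.1.exists_bound_of_continuous h.1.continuous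
  have hlim := (tendsto_rieszMean h.1.continuous hM x).enorm
  have hle : ∀ ε : ℝ, 0 < ε → ‖rieszMean (ε ^ 2) φ x‖ₑ ≤
      rieszBound n (4 / 3) (2 * R) * ∑ i, eLpNorm (pd i φ) (ENNReal.ofReal 4) volume := by
    intro ε hε
    rw [rieszMean_eq_sum (by positivity) h, Finset.mul_sum]
    refine (enorm_sum_le _ _).trans (Finset.sum_le_sum fun i _ => ?_)
    refine (enorm_integral_sub_mul_le (s := ENNReal.ofReal (4 / 3)) (q := ENNReal.ofReal 4) hR
      (hR hx) (measurable_riesz _ i) (h.pd i).1.continuous.aestronglyMeasurable).trans ?_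
    gcongr
    · exact eLpNorm_riesz_le (by positivity) i (by norm_num) _
    · exact Measure.restrict_le_self
  have h2 := le_of_tendsto hlim (eventually_of_mem self_mem_nhdsWithin fun ε hε => hle ε hε)
  rw [enorm_mul] at h2
  rw [mul_assoc]
  exact (ENNReal.mul_le_iff_le_inv hm' (by simp)).1 h2

/-- All norms of a test function are controlled by the `L²` norm of its Laplacian. -/
theorem exists_bound_of_laplacian (hn : n = 2 ∨ n = 3) (hΩb : Bornology.IsBounded Ω) :
    ∃ C : ℝ≥0∞, C ≠ ⊤ ∧ ∀ φ, IsTestFunction Ω φ →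
      (∀ x, ‖φ x‖ₑ ≤ C * eLpNorm (Laplacian.laplacian φ) 2 volume) ∧
      ∀ m ≤ 2, eLpNorm (iteratedFDeriv ℝ m φ) 2 volume ≤
        C * eLpNorm (Laplacian.laplacian φ) 2 volume := by
  obtain ⟨C1, hC1, h1⟩ := exists_norm_le_eLpNorm_pd hn hΩb
  obtain ⟨C4, hC4, h4⟩ := exists_eLpNorm_le_fderiv hn hΩb (Euc n →L[ℝ] ℝ) (q := 4) (by norm_num)
  obtain ⟨C2, hC2, h2⟩ := exists_eLpNorm_le_fderiv hn hΩb (Euc n →L[ℝ] ℝ) (q := 2) (by norm_num)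
  obtain ⟨C0, hC0, h0⟩ := exists_eLpNorm_le_fderiv hn hΩb ℝ (q := 2) (by norm_num)
  set N : ℝ≥0∞ := n * n with hN
  have hNt : N ≠ ⊤ := ENNReal.mul_ne_top (ENNReal.natCast_ne_top n) (ENNReal.natCast_ne_top n)
  -- One summand for each estimate: the supremum (Sobolev for the gradient in L⁴, then Morrey), then
  -- the L² norms of orders zero, one and two. All of them start from the bound of the Hessian by
  -- the Laplacian.
  refine ⟨C1 * (n * (C4 * N)) + (C0 * (C2 * N) + (C2 * N + N)), ?_, fun φ h => ?_⟩
  · simp [ENNReal.mul_eq_top, hC1, hC2, hC4, hC0, hNt]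
  set D := eLpNorm (Laplacian.laplacian φ) 2 volume
  have hd : ContDiff ℝ 1 (fderiv ℝ φ) := (h.contDiff 2).fderiv_right le_rfl
  have hds : tsupport (fderiv ℝ φ) ⊆ Ω := (tsupport_fderiv_subset ℝ).trans h.2.2
  have b2 : eLpNorm (fderiv ℝ (fderiv ℝ φ)) 2 volume ≤ N * D := eLpNorm_fderiv_fderiv_le h
  have b1 : eLpNorm (fderiv ℝ φ) 2 volume ≤ C2 * N * D := by
    rw [mul_assoc]; exact (h2 _ hd hds).trans (by gcongr)
  have b14 : eLpNorm (fderiv ℝ φ) 4 volume ≤ C4 * N * D := by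
    rw [mul_assoc]; exact (h4 _ hd hds).trans (by gcongr)
  have b0 : eLpNorm φ 2 volume ≤ C0 * (C2 * N) * D := by
    rw [mul_assoc]; exact (h0 _ (h.contDiff 1) h.2.2).trans (by gcongr)
  refine ⟨fun x => ?_, fun m hm => ?_⟩
  · refine (h1 φ h x).trans ?_
    have : ∀ i, eLpNorm (pd i φ) (ENNReal.ofReal 4) volume ≤ C4 * N * D := by
      intro i
      refine le_trans ?_ b14
      rw [show ENNReal.ofReal 4 = 4 by simp]
      refine eLpNorm_mono fun y => ?_
      simpa [InvCond.pd] using (fderiv ℝ φ y).le_opNorm (EuclideanSpace.single i 1)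
    calc C1 * ∑ i, eLpNorm (pd i φ) (ENNReal.ofReal 4) volume
        ≤ C1 * ∑ _i : Fin n, C4 * N * D := by gcongr with i; exact this i
      _ = C1 * (n * (C4 * N)) * D := by simp [mul_assoc]
      _ ≤ _ := by gcongr; exact le_self_add
  · interval_cases m
    · rw [eLpNorm_congr_norm_ae (g := φ) (Eventually.of_forall fun x => norm_iteratedFDeriv_zero)]
      refine b0.trans ?_
      gcongr
      exact le_add_left le_self_add
    · rw [eLpNorm_congr_norm_ae (g := fderiv ℝ φ)
        (Eventually.of_forall fun x => norm_iteratedFDeriv_one φ)]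
      refine b1.trans ?_
      gcongr
      exact le_add_left (le_add_left le_self_add)
    · rw [eLpNorm_congr_norm_ae (g := fderiv ℝ (fderiv ℝ φ)) (Eventually.of_forall fun x => by
        rw [← norm_iteratedFDeriv_one, norm_iteratedFDeriv_fderiv])]
      refine b2.trans ?_
      gcongr
      exact le_add_left (le_add_left (le_add_self))

end Estimates

/-! ### The limit potential -/

theorem exists_tendsto_of_eLpNorm_sub_le {α E : Type*} [MeasurableSpace α] {μ : Measure α}
    [NormedAddCommGroup E] [CompleteSpace E] {f : ℕ → α → E} (hf : ∀ i, MemLp (f i) 2 μ)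
    {a : ℕ → ℕ → ℝ≥0∞} (ha : ∀ ε > 0, ∃ N, ∀ i, N ≤ i → ∀ j, N ≤ j → a i j < ε)
    (h : ∀ i j, eLpNorm (f i - f j) 2 μ ≤ a i j) :
    ∃ F, MemLp F 2 μ ∧ Tendsto (fun i => eLpNorm (fun x => f i x - F x) 2 μ) atTop (𝓝 0) := by
  have hc : CauchySeq fun i => (hf i).toLp (f i) := by
    rw [EMetric.cauchySeq_iff]
    intro ε hε
    obtain ⟨N, hN⟩ := ha ε hε
    refine ⟨N, fun i hi j hj => ?_⟩
    rw [Lp.edist_toLp_toLp]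
    exact (h i j).trans_lt (hN i hi j hj)
  obtain ⟨F, hF⟩ := cauchySeq_tendsto_of_complete hc
  refine ⟨F, Lp.memLp F, ?_⟩
  rw [← Lp.toLp_coeFn F (Lp.memLp F)] at hF
  exact (Lp.tendsto_Lp_iff_tendsto_eLpNorm'' f hf F (Lp.memLp F)).1 hF

theorem exists_lt_of_tendsto_eLpNorm_sub {α E : Type*} [MeasurableSpace α] {μ : Measure α}
    [NormedAddCommGroup E] {f : ℕ → α → E} {F : α → E} (hf : ∀ i, MemLp (f i) 2 μ)
    (hF : MemLp F 2 μ) (h : Tendsto (fun i => eLpNorm (fun x => f i x - F x) 2 μ) atTop (𝓝 0))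
    {C : ℝ≥0∞} (hC : C ≠ ⊤) :
    ∀ ε > 0, ∃ N, ∀ i, N ≤ i → ∀ j, N ≤ j → C * eLpNorm (f i - f j) 2 μ < ε := by
  intro ε hε
  have h2 : Tendsto (fun p : ℕ × ℕ => C * (eLpNorm (fun x => f p.1 x - F x) 2 μ +
      eLpNorm (fun x => f p.2 x - F x) 2 μ)) (atTop ×ˢ atTop) (𝓝 0) := by
    have := ENNReal.Tendsto.const_mul (a := C) ((h.comp tendsto_fst).add (h.comp tendsto_snd))
      (Or.inr hC)
    simpa using this
  rw [prod_atTop_atTop_eq] at h2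
  obtain ⟨⟨N1, N2⟩, hN⟩ := eventually_atTop.1 (h2.eventually_lt_const hε)
  refine ⟨max N1 N2, fun i hi j hj => lt_of_le_of_lt ?_ (hN (i, j)
    ⟨(le_max_left _ _).trans hi, (le_max_right _ _).trans hj⟩)⟩
  gcongr
  have e : f i - f j = (fun x => f i x - F x) - fun x => f j x - F x := by
    ext x; simp
  rw [e]
  exact eLpNorm_sub_le ((hf i).sub hF).1 ((hf j).sub hF).1 one_le_two

theorem IsTestFunction.sub {Ω : Set (Euc n)} {φ ψ : Euc n → ℝ} (h : IsTestFunction Ω φ)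
    (h' : IsTestFunction Ω ψ) : IsTestFunction Ω (φ - ψ) := by
  have := h.add (h'.const_smul (-1))
  rwa [neg_smul, one_smul, ← sub_eq_add_neg] at this

theorem IsTestFunction.eLpNorm_restrict {Ω : Set (Euc n)} {φ : Euc n → ℝ}
    (h : IsTestFunction Ω φ) (p : ℝ≥0∞) :
    eLpNorm φ p (volume.restrict Ω) = eLpNorm φ p volume :=
  eLpNorm_restrict_eq_of_support_subset ((subset_tsupport _).trans h.2.2)

/-- If the Laplacians of test functions converge in `L²`, then the test functions converge
uniformly and in `H²`. -/
theorem exists_limit_of_laplacian (hn : n = 2 ∨ n = 3) {Ω : Set (Euc n)}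
    (hΩb : Bornology.IsBounded Ω) {φ : ℕ → Euc n → ℝ} (hφ : ∀ i, IsTestFunction Ω (φ i))
    {g : Euc n → ℝ} (hg : MemL2 Ω g) (h : Tendsto (fun i =>
      eLpNorm (fun x => Laplacian.laplacian (φ i) x - g x) 2 (volume.restrict Ω)) atTop (𝓝 0)) :
    ∃ Φ : Euc n → ℝ, TendstoUniformly φ Φ atTop ∧ MemL2 Ω Φ ∧
      Tendsto (fun i => eLpNorm (fun x => φ i x - Φ x) 2 (volume.restrict Ω)) atTop (𝓝 0) ∧
      ∀ m ≤ 2, ∃ F : Euc n → ContinuousMultilinearMap ℝ (fun _ : Fin m => Euc n) ℝ,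
        MemLp F 2 (volume.restrict Ω) ∧
        Tendsto (fun i => eLpNorm (fun x => iteratedFDeriv ℝ m (φ i) x - F x) 2
          (volume.restrict Ω)) atTop (𝓝 0) := by
  obtain ⟨C, hC, hbd⟩ := exists_bound_of_laplacian hn hΩb
  -- Differences of test functions are test functions, so the a priori bound turns a Cauchy sequence
  -- of Laplacians into Cauchy sequences in every controlled norm.
  have hcau := exists_lt_of_tendsto_eLpNorm_sub
    (fun i => (hφ i).laplacian.memLp 2 (volume.restrict Ω)) hg h hC
  have hlap : ∀ i j, eLpNorm (Laplacian.laplacian (φ i - φ j)) 2 volume =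
      eLpNorm (Laplacian.laplacian (φ i) - Laplacian.laplacian (φ j)) 2 (volume.restrict Ω) := by
    intro i j
    rw [← ((hφ i).sub (hφ j)).laplacian.eLpNorm_restrict]
    congr 1
    ext x
    exact ((hφ i).contDiff 2).contDiffAt.laplacian_sub ((hφ j).contDiff 2).contDiffAt
  have hunif : UniformCauchySeqOn φ atTop univ := by
    rw [Metric.uniformCauchySeqOn_iff]
    intro ε hε
    obtain ⟨N, hN⟩ := hcau (ENNReal.ofReal ε) (by simpa using hε)
    refine ⟨N, fun i hi j hj x _ => ?_⟩
    rw [dist_eq_norm, ← ENNReal.ofReal_lt_ofReal_iff hε, ofReal_norm]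
    refine lt_of_le_of_lt ?_ (hN i hi j hj)
    rw [← hlap]
    exact (hbd _ ((hφ i).sub (hφ j))).1 x
  have hpt : ∀ x, ∃ y, Tendsto (fun i => φ i x) atTop (𝓝 y) := fun x =>
    cauchySeq_tendsto_of_complete (hunif.cauchySeq (mem_univ x))
  choose Φ hΦ using hpt
  have hU : TendstoUniformly φ Φ atTop :=
    tendstoUniformlyOn_univ.1 (hunif.tendstoUniformlyOn_of_tendsto fun x _ => hΦ x)
  have hcont : Continuous Φ := hU.continuous (Frequently.of_forall fun i => (hφ i).1.continuous)
  have hΦ0 : ∀ x, x ∉ Ω → Φ x = 0 := fun x hx =>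
    tendsto_nhds_unique (hΦ x) (tendsto_const_nhds.congr fun i => ((hφ i).eq_zero hx).symm)
  have hΦcs : HasCompactSupport Φ := HasCompactSupport.intro hΩb.isCompact_closure
    fun x hx => hΦ0 x fun hx' => hx (subset_closure hx')
  have hL2 : Tendsto (fun i => eLpNorm (fun x => φ i x - Φ x) 2 (volume.restrict Ω)) atTop
      (𝓝 0) := by
    rw [ENNReal.tendsto_nhds_zero]
    intro ε hε
    set V : ℝ≥0∞ := (volume.restrict Ω) univ ^ (2 : ℝ≥0∞).toReal⁻¹ with hV
    have hVt : V ≠ ⊤ := by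
      refine ENNReal.rpow_ne_top_of_nonneg (by positivity) ?_
      rw [Measure.restrict_apply_univ]; exact hΩb.measure_lt_top.ne
    have ht : Tendsto (fun δ : ℝ => V * ENNReal.ofReal δ) (𝓝[>] 0) (𝓝 0) := by
      have h1 : Tendsto (fun δ : ℝ => ENNReal.ofReal δ) (𝓝[>] 0) (𝓝 0) := by
        simpa using (ENNReal.continuous_ofReal.tendsto 0).mono_left nhdsWithin_le_nhds
      simpa using ENNReal.Tendsto.const_mul h1 (Or.inr hVt)
    obtain ⟨δ, hδ1, hδ0⟩ := ((ht.eventually_le_const hε).and self_mem_nhdsWithin).exists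
    filter_upwards [Metric.tendstoUniformly_iff.1 hU δ hδ0] with i hi
    refine (eLpNorm_le_of_ae_bound (Eventually.of_forall fun x => ?_)).trans hδ1
    rw [norm_sub_rev, ← dist_eq_norm]
    exact (hi x).le
  refine ⟨Φ, hU, hcont.memLp_of_hasCompactSupport hΦcs, hL2, fun m hm => ?_⟩
  have hcm : ∀ i, Continuous (iteratedFDeriv ℝ m (φ i)) := fun i =>
    ((hφ i).contDiff m).continuous_iteratedFDeriv le_rfl
  refine exists_tendsto_of_eLpNorm_sub_le
    (fun i => (hcm i).memLp_of_hasCompactSupport ((hφ i).2.1.iteratedFDeriv m)) hcau fun i j => ?_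
  rw [← hlap, ← iteratedFDeriv_sub ((hφ i).contDiff m) ((hφ j).contDiff m)]
  exact (eLpNorm_mono_measure _ Measure.restrict_le_self).trans
    ((hbd _ ((hφ i).sub (hφ j))).2 m hm)

/-! ### Functions orthogonal to harmonic functions are limits of Laplacians -/

/-- In a Hilbert space the closure of a subspace is its double orthogonal complement. For the
subspace of Laplacians of test functions, Weyl's lemma says that orthogonal elements are represented
by harmonic functions, and `Y` is orthogonal to those. -/
theorem OrthogonalToHarmonic.exists_tendsto_laplacian (hn : 0 < n) {Ω : Set (Euc n)}
    (hΩo : IsOpen Ω) (hΩb : Bornology.IsBounded Ω) {Y : Euc n → ℝ}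
    (hY : OrthogonalToHarmonic Ω Y) :
    ∃ φ : ℕ → Euc n → ℝ, (∀ i, IsTestFunction Ω (φ i)) ∧ Tendsto (fun i =>
      eLpNorm (fun x => Laplacian.laplacian (φ i) x - -Y x) 2 (volume.restrict Ω)) atTop
        (𝓝 0) := by
  let μ := volume.restrict Ω
  have hYn : MemLp (fun x => -Y x) 2 μ := hY.1.neg
  let S : Submodule ℝ (Lp ℝ 2 μ) :=
    { carrier := {f | ∃ φ, ∃ h : IsTestFunction Ω φ, f = (h.laplacian.memLp 2 μ).toLp _}
      zero_mem' := by
        refine ⟨0, isTestFunction_zero, ?_⟩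
        symm
        rw [Lp.eq_zero_iff_ae_eq_zero]
        refine (MemLp.coeFn_toLp _).trans (Eventually.of_forall fun x => ?_)
        rw [Pi.zero_def, InnerProductSpace.laplacian_const]
        rfl
      add_mem' := by
        rintro _ _ ⟨φ, h, rfl⟩ ⟨ψ, h', rfl⟩
        refine ⟨φ + ψ, h.add h', ?_⟩
        rw [← MemLp.toLp_add]
        refine MemLp.toLp_congr _ _ (Eventually.of_forall fun x => ?_)
        exact ((h.contDiff 2).contDiffAt.laplacian_add (h'.contDiff 2).contDiffAt).symm
      smul_mem' := by
        rintro c _ ⟨φ, h, rfl⟩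
        refine ⟨c • φ, h.const_smul c, ?_⟩
        rw [← MemLp.toLp_const_smul]
        refine MemLp.toLp_congr _ _ (Eventually.of_forall fun x => ?_)
        exact (InnerProductSpace.laplacian_smul c (h.contDiff 2).contDiffAt).symm }
  have hmem : hYn.toLp _ ∈ Sᗮᗮ := by
    rw [Submodule.mem_orthogonal]
    intro w hw
    rw [Submodule.mem_orthogonal] at hw
    have hw2 : MemL2 Ω w := Lp.memLp w
    obtain ⟨h, -, hh, hhw⟩ := exists_harmonic_ae_eq hn hΩo hΩb hw2 fun φ hφ => by
      have := hw _ ⟨φ, hφ, rfl⟩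
      rw [L2.inner_def] at this
      rw [← this]
      refine integral_congr_ae ?_
      filter_upwards [(hφ.laplacian.memLp 2 μ).coeFn_toLp] with x hx
      rw [hx]; simp
    have h1 := hY.2 h hh ((memLp_congr_ae hhw).2 hw2)
    rw [L2.inner_def, ← neg_eq_zero, ← h1, ← integral_neg]
    refine integral_congr_ae ?_
    filter_upwards [hYn.coeFn_toLp, hhw] with x hx hx'
    rw [hx, hx']; simp
  rw [Submodule.orthogonal_orthogonal_eq_closure, ← SetLike.mem_coe,
    Submodule.topologicalClosure_coe, mem_closure_iff_seq_limit] at hmem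
  obtain ⟨f, hf, hlim⟩ := hmem
  choose φ hφ hfφ using hf
  refine ⟨φ, hφ, ?_⟩
  have e : f = fun i => ((hφ i).laplacian.memLp 2 μ).toLp _ := funext hfφ
  rw [e] at hlim
  exact (Lp.tendsto_Lp_iff_tendsto_eLpNorm'' _ (fun i => (hφ i).laplacian.memLp 2 μ) _ hYn).1 hlim

/-! ### Continuous differentiability of the potential -/

theorem tendstoUniformlyOn_linForm {ι X : Type*} {l : Filter ι} {s : Set X}
    {V : ι → X → Fin n → ℝ} {W : X → Fin n → ℝ} {a : ι → Fin n → ℝ≥0∞}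
    (h : ∀ᶠ i in l, ∀ x ∈ s, ∀ j, ‖V i x j - W x j‖ₑ ≤ a i j)
    (ha : ∀ j, Tendsto (fun i => a i j) l (𝓝 0)) :
    TendstoUniformlyOn (fun i x => linForm (V i x)) (fun x => linForm (W x)) l s := by
  rw [EMetric.tendstoUniformlyOn_iff]
  intro ε hε
  have h0 : Tendsto (fun i => ∑ j, a i j) l (𝓝 0) := by
    simpa using tendsto_finsetSum Finset.univ fun j _ => ha j
  filter_upwards [h, h0.eventually_lt_const hε] with i hi hi' x hx
  refine lt_of_le_of_lt ?_ hi'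
  rw [edist_comm, edist_eq_enorm_sub]
  have e : linForm (V i x) - linForm (W x) = linForm (fun j => V i x j - W x j) := by
    ext u
    simp [linForm_apply, sub_mul]
  rw [e]
  calc ‖linForm (fun j => V i x j - W x j)‖ₑ
      ≤ ENNReal.ofReal (∑ j, |V i x j - W x j|) := by
        rw [← ofReal_norm]
        exact ENNReal.ofReal_le_ofReal (norm_linForm_le _)
    _ = ∑ j, ‖V i x j - W x j‖ₑ := by
        rw [ENNReal.ofReal_sum_of_nonneg fun j _ => abs_nonneg _]
        refine Finset.sum_congr rfl fun j _ => ?_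
        rw [← Real.norm_eq_abs, ofReal_norm]
    _ ≤ _ := Finset.sum_le_sum fun j _ => hi x hx j

section Regularity

variable {Ω : Set (Euc n)} {R : ℝ} {g Φ : Euc n → ℝ} {φ : ℕ → Euc n → ℝ}

theorem eLpNorm_riesz_two_ne_top {c : ℝ} (hc : 0 < c) (j : Fin n) (R : ℝ) :
    eLpNorm (riesz c j) 2 (volume.restrict (Metric.ball 0 R)) ≠ ⊤ := by
  have hcont := (contDiff_riesz hc j).continuous
  refine ne_top_of_le_ne_top ?_ (eLpNorm_mono_measure _
    (Measure.restrict_mono (Metric.ball_subset_closedBall (x := (0 : Euc n)) (ε := R)) le_rfl))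
  have hK := isCompact_closedBall (0 : Euc n) R
  obtain ⟨C, hC⟩ := hK.exists_bound_of_continuousOn hcont.continuousOn
  refine ne_top_of_le_ne_top ?_ (eLpNorm_le_of_ae_bound (C := C)
    ((ae_restrict_iff' hK.measurableSet).2 (Eventually.of_forall hC)))
  refine ENNReal.mul_ne_top (ENNReal.rpow_ne_top_of_nonneg (by positivity) ?_) (by simp)
  rw [Measure.restrict_apply_univ]
  exact hK.measure_lt_top.ne

theorem continuousOn_integral_riesz (hΩo : IsOpen Ω) (hR : Ω ⊆ Metric.ball 0 R)
    (hg : Integrable g (volume.restrict Ω)) {c : ℝ} (hc : 0 < c) (j : Fin n) :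
    ContinuousOn (fun x => ∫ y in Ω, riesz c j (x - y) * g y) (Metric.ball 0 R) := by
  have hcont := (contDiff_riesz hc j).continuous
  obtain ⟨C, hC⟩ := (isCompact_closedBall (0 : Euc n) (2 * R)).exists_bound_of_continuousOn
    hcont.continuousOn
  refine continuousOn_of_dominated (bound := fun y => C * ‖g y‖) ?_ ?_ (hg.norm.const_mul C) ?_
  · exact fun x _ => (hcont.comp (by fun_prop)).aestronglyMeasurable.mul hg.aestronglyMeasurable
  · intro x hx
    refine (ae_restrict_iff' hΩo.measurableSet).2 (Eventually.of_forall fun y hy => ?_)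
    rw [norm_mul]
    gcongr
    refine hC _ ?_
    have h1 := mem_ball_zero_iff.1 (hR hy)
    have h2 := mem_ball_zero_iff.1 hx
    rw [mem_closedBall_zero_iff]
    linarith [norm_sub_le x y]
  · exact Eventually.of_forall fun y =>
      ((hcont.comp (by fun_prop : Continuous fun x => x - y)).mul continuous_const).continuousOn

/-- For fixed c > 0 the kernel is square-integrable on balls, so L² convergence of the Laplacians
makes the gradients of the means converge uniformly on the ball. Here `g` plays the role of the
Laplacian of the limit Φ. -/
theorem hasFDerivAt_rieszMean_limit (hR : Ω ⊆ Metric.ball 0 R)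
    (hφ : ∀ i, IsTestFunction Ω (φ i)) (hg : MemL2 Ω g)
    (hlim : Tendsto (fun i => eLpNorm (fun x => Laplacian.laplacian (φ i) x - g x) 2
      (volume.restrict Ω)) atTop (𝓝 0))
    (hU : TendstoUniformly φ Φ atTop) {M : ℝ} (hM : ∀ x, ‖Φ x‖ ≤ M) {c : ℝ} (hc : 0 < c)
    {x : Euc n} (hx : x ∈ Metric.ball (0 : Euc n) R) :
    HasFDerivAt (rieszMean c Φ) (linForm fun j => ∫ y in Ω, riesz c j (x - y) * g y) x := by
  refine hasFDerivAt_of_tendstoUniformlyOn (l := atTop) (s := Metric.ball 0 R)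
    (f := fun i => rieszMean c (φ i)) (g := rieszMean c Φ)
    (f' := fun i x => linForm fun j =>
      ∫ y in Ω, riesz c j (x - y) * Laplacian.laplacian (φ i) y)
    (g' := fun x => linForm fun j => ∫ y in Ω, riesz c j (x - y) * g y)
    Metric.isOpen_ball ?_ (fun i x _ => hasFDerivAt_rieszMean hc (hφ i) x) ?_ hx
  · refine tendstoUniformlyOn_linForm (a := fun i j =>
      eLpNorm (riesz c j) 2 (volume.restrict (Metric.ball 0 (2 * R))) *
        eLpNorm (fun x => Laplacian.laplacian (φ i) x - g x) 2 (volume.restrict Ω)) ?_ ?_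
    · refine Eventually.of_forall fun i x hx j => ?_
      have ht := eLpNorm_riesz_two_ne_top hc j (2 * R)
      have hl := (hφ i).laplacian.memLp 2 (volume.restrict Ω)
      rw [← integral_sub
        (integrable_comp_sub_mul hR hx (measurable_riesz c j) ht hl)
        (integrable_comp_sub_mul hR hx (measurable_riesz c j) ht hg)]
      simp_rw [← mul_sub]
      exact enorm_integral_sub_mul_le hR hx (measurable_riesz c j) (hl.sub hg).1
    · intro j
      simpa using ENNReal.Tendsto.const_mul hlim (Or.inr (eLpNorm_riesz_two_ne_top hc j (2 * R)))
  · intro x _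
    have hpt : ∀ x, Tendsto (fun i => φ i x) atTop (𝓝 (Φ x)) := fun x => hU.tendsto_at x
    refine tendsto_integral_filter_of_dominated_convergence
      (fun z => ‖rieszDiv c z‖ * (M + 1)) ?_ ?_ ((integrable_rieszDiv hc).norm.mul_const _) ?_
    · exact Eventually.of_forall fun i => ((continuous_rieszDiv hc).mul
        ((hφ i).1.continuous.comp (by fun_prop))).aestronglyMeasurable
    · filter_upwards [Metric.tendstoUniformly_iff.1 hU 1 one_pos] with i hi
      refine Eventually.of_forall fun z => ?_
      rw [norm_mul]
      gcongr
      have h1 := hi (x - z)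
      rw [dist_comm, dist_eq_norm] at h1
      have h2 := norm_sub_norm_le (φ i (x - z)) (Φ (x - z))
      linarith [hM (x - z)]
    · exact Eventually.of_forall fun z => (hpt _).const_mul _

/-- Elliptic regularity: if the Laplacian is in `L^q` with `q > n`, then the potential is
continuously differentiable. -/
theorem exists_hasFDerivAt_of_memLp (hn : 0 < n) (hΩo : IsOpen Ω) (hR0 : 0 < R)
    (hR : Ω ⊆ Metric.ball 0 R)
    (hφ : ∀ i, IsTestFunction Ω (φ i)) (hg : MemL2 Ω g)
    (hlim : Tendsto (fun i => eLpNorm (fun x => Laplacian.laplacian (φ i) x - g x) 2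
      (volume.restrict Ω)) atTop (𝓝 0))
    (hU : TendstoUniformly φ Φ atTop) {M : ℝ} (hM : ∀ x, ‖Φ x‖ ≤ M)
    {q : ℝ} (hq : n < q) (hgq : MemLp g (ENNReal.ofReal q) (volume.restrict Ω)) :
    ∃ G : Euc n → (Euc n →L[ℝ] ℝ), ContinuousOn G (Metric.ball 0 R) ∧
      ∀ x ∈ Metric.ball 0 R, HasFDerivAt Φ (G x) x := by
  have hcont : Continuous Φ := hU.continuous (Frequently.of_forall fun i => (hφ i).1.continuous)
  have hn1 : (1 : ℝ) ≤ n := by exact_mod_cast hn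
  have hq1 : 1 < q := hn1.trans_lt hq
  -- For the conjugate exponent s, the hypothesis q > n yields (n-1)s < n, the integrability
  -- condition for the singular kernel.
  set s := q.conjExponent with hsdef
  have hqs : q.HolderConjugate s := Real.HolderConjugate.conjExponent hq1
  have hs0 : 0 < s := hqs.symm.pos
  have hsn : (n - 1) * s < n := by
    rw [hsdef, Real.conjExponent, ← mul_div_assoc, div_lt_iff₀ (by linarith)]
    nlinarith
  have hHT : (ENNReal.ofReal s).HolderConjugate (ENNReal.ofReal q) := hqs.symm.ennrealOfReal
  have hgi := integrableOn_of_memL2 (Metric.isBounded_ball.subset hR) hg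
  set m := ∫ z : Euc n, rieszDiv 1 z with hm
  have hm0 : m ≠ 0 := (integral_rieszDiv_one_pos hn).ne'
  let V : ℝ → Euc n → Fin n → ℝ := fun c x j => ∫ y in Ω, riesz c j (x - y) * g y
  have hfin : ∀ c, 0 ≤ c → ∀ j, eLpNorm (riesz c j) (ENNReal.ofReal s)
      (volume.restrict (Metric.ball (0 : Euc n) (2 * R))) ≠ ⊤ := fun c hc j =>
    ne_top_of_le_ne_top (rieszBound_ne_top hn hs0 hsn (by positivity)) (eLpNorm_riesz_le hc j hs0 _)
  have hconv : TendstoUniformlyOn (fun ε x => linForm (V (ε ^ 2) x)) (fun x => linForm (V 0 x))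
      (𝓝[>] 0) (Metric.ball (0 : Euc n) R) := by
    have hsq : Tendsto (fun ε : ℝ => ε ^ 2) (𝓝[>] 0) (𝓝[>] 0) := by
      refine tendsto_nhdsWithin_iff.2 ⟨?_, ?_⟩
      · have : ContinuousAt (fun ε : ℝ => ε ^ 2) 0 := by fun_prop
        simpa using this.tendsto.mono_left nhdsWithin_le_nhds
      · filter_upwards [self_mem_nhdsWithin] with ε hε
        exact pow_pos (show (0 : ℝ) < ε from hε) 2
    refine tendstoUniformlyOn_linForm (a := fun ε j =>
      eLpNorm (fun z => riesz (ε ^ 2) j z - riesz 0 j z) (ENNReal.ofReal s)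
        (volume.restrict (Metric.ball 0 (2 * R))) *
        eLpNorm g (ENNReal.ofReal q) (volume.restrict Ω)) ?_ ?_
    · refine Eventually.of_forall fun ε x hx j => ?_
      have h1 := integrable_comp_sub_mul hR hx (measurable_riesz (ε ^ 2) j)
        (hfin _ (by positivity) j) hgq
      have h2 := integrable_comp_sub_mul hR hx (measurable_riesz 0 j) (hfin _ le_rfl j) hgq
      simp only [V]
      rw [← integral_sub h1 h2]
      simp_rw [← sub_mul]
      exact enorm_integral_sub_mul_le (κ := fun z => riesz (ε ^ 2) j z - riesz 0 j z) hR hx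
        ((measurable_riesz _ j).sub (measurable_riesz 0 j)) hgq.1
    · intro j
      have h1 := (tendsto_eLpNorm_riesz_sub hn j hs0 hsn (R := 2 * R) (by positivity)).comp hsq
      simpa using ENNReal.Tendsto.mul_const h1 (Or.inr hgq.2.ne)
  have hcV : ∀ ε : ℝ, 0 < ε → ContinuousOn (fun x => linForm (V (ε ^ 2) x))
      (Metric.ball (0 : Euc n) R) := by
    intro ε hε
    unfold linForm
    exact continuousOn_finsetSum _ fun j _ =>
      (continuousOn_integral_riesz hΩo hR hgi (by positivity) j).smul continuousOn_const
  have hev : ∀ᶠ ε in 𝓝[>] (0 : ℝ), ContinuousOn (fun x => linForm (V (ε ^ 2) x))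
      (Metric.ball (0 : Euc n) R) := eventually_of_mem self_mem_nhdsWithin fun ε hε => hcV ε hε
  have hcG : ContinuousOn (fun x => m⁻¹ • linForm (V 0 x)) (Metric.ball (0 : Euc n) R) :=
    (hconv.continuousOn hev.frequently).const_smul m⁻¹
  refine ⟨fun x => m⁻¹ • linForm (V 0 x), hcG,
    fun x hx => ?_⟩
  -- A sequence of positive numbers replaces the filter at 0⁺, because the theorem on
  -- differentiating limits asks for differentiability at every index.
  obtain ⟨ε, hε0, hε⟩ : ∃ ε : ℕ → ℝ, (∀ k, 0 < ε k) ∧ Tendsto ε atTop (𝓝[>] 0) :=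
    ⟨fun k => 1 / ((k : ℝ) + 1), fun k => by positivity,
      tendsto_nhdsWithin_iff.2 ⟨tendsto_one_div_add_atTop_nhds_zero_nat,
        Eventually.of_forall fun k => by simp only [mem_Ioi]; positivity⟩⟩
  have key := hasFDerivAt_of_tendstoUniformlyOn (l := atTop) (s := Metric.ball (0 : Euc n) R)
    (f := fun k => rieszMean (ε k ^ 2) Φ) (g := fun x => m * Φ x)
    (f' := fun k x => linForm (V (ε k ^ 2) x)) (g' := fun x => linForm (V 0 x))
    Metric.isOpen_ball (fun u hu => hε.eventually (hconv u hu))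
    (fun k x hx => hasFDerivAt_rieszMean_limit hR hφ hg hlim hU hM (pow_pos (hε0 k) 2) hx)
    (fun x _ => (tendsto_rieszMean hcont hM x).comp hε) hx
  have key2 := key.const_mul m⁻¹
  simpa only [inv_mul_cancel_left₀ hm0] using key2

end Regularity

/-! ### Boundary behaviour -/

theorem IsLocalDefining.hasDerivAt {Ω U : Set (Euc n)} {ρ : Euc n → ℝ} {z : Euc n}
    (h : IsLocalDefining Ω z U ρ) (v : Euc n) :
    HasDerivAt (fun t : ℝ => ρ (z + t • v)) ⟪gradient ρ z, v⟫_ℝ 0 := by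
  have hd : DifferentiableAt ℝ ρ z :=
    (h.2.2.1.contDiffAt (h.1.mem_nhds h.2.1)).differentiableAt two_ne_zero
  have hl : HasDerivAt (fun t : ℝ => z + t • v) v 0 := by
    simpa using ((hasDerivAt_id (0 : ℝ)).smul_const v).const_add z
  have h1 : HasFDerivAt ρ (fderiv ℝ ρ z) (z + (0 : ℝ) • v) := by simpa using hd.hasFDerivAt
  have h2 := h1.comp_hasDerivAt (0 : ℝ) hl
  rwa [gradient, InnerProductSpace.toDual_symm_apply]

/-- A boundary point of an open set is outside it, so ρ(z) ≥ 0. The derivative of ρ along ν is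
positive, hence ρ > 0 just beyond z. -/
theorem IsOutwardNormal.eventually_notMem {Ω : Set (Euc n)} (hΩo : IsOpen Ω) {z ν : Euc n}
    (hz : z ∈ frontier Ω) (hν : IsOutwardNormal Ω z ν) :
    ∀ᶠ t : ℝ in 𝓝[>] 0, z + t • ν ∉ Ω := by
  obtain ⟨U, ρ, h, rfl⟩ := hν
  have hd := h.hasDerivAt (‖gradient ρ z‖⁻¹ • gradient ρ z)
  have hpos : 0 < ⟪gradient ρ z, ‖gradient ρ z‖⁻¹ • gradient ρ z⟫_ℝ := by
    rw [inner_smul_right, real_inner_self_eq_norm_sq]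
    have := norm_pos_iff.2 h.2.2.2.1
    positivity
  have hzΩ : z ∉ Ω := fun h' => (hΩo.frontier_eq ▸ hz).2 h'
  have hρ : 0 ≤ ρ z := by
    by_contra! hlt
    exact hzΩ (h.2.2.2.2.superset ⟨h.2.1, hlt⟩).1
  have hs := ((hasDerivAt_iff_tendsto_slope.1 hd).eventually_const_lt hpos).filter_mono
    (nhdsWithin_mono 0 fun t (ht : 0 < t) => ht.ne')
  have hU : ∀ᶠ t : ℝ in 𝓝[>] 0, z + t • (‖gradient ρ z‖⁻¹ • gradient ρ z) ∈ U := by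
    have hc : Continuous fun t : ℝ => z + t • (‖gradient ρ z‖⁻¹ • gradient ρ z) := by fun_prop
    exact (hc.tendsto 0).mono_left nhdsWithin_le_nhds (h.1.mem_nhds (by simpa using h.2.1))
  filter_upwards [hs, hU, self_mem_nhdsWithin] with t h1 h2 (h3 : 0 < t) hΩ
  have h4 : ρ (z + t • (‖gradient ρ z‖⁻¹ • gradient ρ z)) < 0 :=
    (h.2.2.2.2.subset ⟨hΩ, h2⟩).2
  rw [slope_def_field, sub_zero, zero_smul, add_zero, div_pos_iff_of_pos_right h3] at h1
  linarith

/-- Full differentiability at z makes the derivative along ν two-sided. It can be computed from the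
outer side, where Φ vanishes identically. -/
theorem hasNormalDeriv_zero {Ω : Set (Euc n)} (hΩo : IsOpen Ω) {Φ : Euc n → ℝ} {z : Euc n}
    (hz : z ∈ frontier Ω) (h0 : ∀ x, x ∉ Ω → Φ x = 0) (hd : DifferentiableAt ℝ Φ z) :
    HasNormalDeriv Ω Φ z 0 := by
  intro ν hν
  have hl : HasDerivAt (fun t : ℝ => z + t • ν) ν 0 := by
    simpa using ((hasDerivAt_id (0 : ℝ)).smul_const ν).const_add z
  have h1 : HasFDerivAt Φ (fderiv ℝ Φ z) (z + (0 : ℝ) • ν) := by simpa using hd.hasFDerivAt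
  have h2 : HasDerivAt (fun t : ℝ => Φ (z + t • ν)) (fderiv ℝ Φ z ν) 0 :=
    h1.comp_hasDerivAt (0 : ℝ) hl
  have hzΩ : z ∉ Ω := fun h' => (hΩo.frontier_eq ▸ hz).2 h'
  have h3 : HasDerivWithinAt (fun t : ℝ => Φ (z + t • ν)) 0 (Ioi 0) 0 := by
    refine (hasDerivWithinAt_const (0 : ℝ) (Ioi 0) (0 : ℝ)).congr_of_eventuallyEq ?_
      (by simpa using h0 z hzΩ)
    filter_upwards [hν.eventually_notMem hΩo hz] with t ht using h0 _ ht
  have h4 := (uniqueDiffWithinAt_Ioi (0 : ℝ)).eq_deriv _ h2.hasDerivWithinAt h3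
  rw [h4] at h2
  exact h2.hasDerivWithinAt

theorem hasNormalDeriv_add_iff {Ω : Set (Euc n)} {Φ : Euc n → ℝ} {z : Euc n}
    (h : HasNormalDeriv Ω Φ z 0) (Ψ : Euc n → ℝ) (d : ℝ) :
    HasNormalDeriv Ω Ψ z d ↔ HasNormalDeriv Ω (Ψ + Φ) z d := by
  constructor
  · intro h' ν hν
    have := (h' ν hν).add (h ν hν)
    rwa [add_zero] at this
  · intro h' ν hν
    have := (h' ν hν).sub (h ν hν)
    rw [sub_zero] at this
    refine this.congr_of_mem (fun t _ => ?_) self_mem_Iic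
    simp

/-! ### The invisible potential -/

/-- The limit `Φ` of test functions whose Laplacians converge to `-Y`. -/
theorem OrthogonalToHarmonic.exists_potential (hn : n = 2 ∨ n = 3) {Ω : Set (Euc n)}
    (hΩo : IsOpen Ω) (hΩb : Bornology.IsBounded Ω) {Y : Euc n → ℝ}
    (hY : OrthogonalToHarmonic Ω Y) :
    ∃ (φ : ℕ → Euc n → ℝ) (Φ : Euc n → ℝ), (∀ i, IsTestFunction Ω (φ i)) ∧
      Tendsto (fun i => eLpNorm (fun x => Laplacian.laplacian (φ i) x - -Y x) 2
        (volume.restrict Ω)) atTop (𝓝 0) ∧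
      Tendsto (fun i => eLpNorm (fun x => φ i x - Φ x) 2 (volume.restrict Ω)) atTop (𝓝 0) ∧
      TendstoUniformly φ Φ atTop ∧ MemSobolevZero Ω 2 Φ ∧
      HasWeakLaplacian Ω Φ (fun x => -Y x) := by
  obtain ⟨φ, hφ, hlim⟩ := hY.exists_tendsto_laplacian (by omega) hΩo hΩb
  have hYn : MemL2 Ω (fun x => -Y x) := hY.1.neg
  obtain ⟨Φ, hU, hΦ2, hL2, hF⟩ := exists_limit_of_laplacian hn hΩb hφ hYn hlim
  refine ⟨φ, Φ, hφ, hlim, hL2, hU, ⟨hΦ2, φ, hφ, hL2, hF⟩, fun ψ hψ => ?_⟩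
  have h1 := tendsto_integral_mul_of_L2 (fun i => (hφ i).memLp 2 _) hΦ2
    (hψ.laplacian.memLp 2 _) hL2
  have h2 := tendsto_integral_mul_of_L2 (fun i => (hφ i).laplacian.memLp 2 _) hYn
    (hψ.memLp 2 _) hlim
  refine tendsto_nhds_unique h1 (h2.congr fun i => ?_)
  rw [hψ.setIntegral_mul, hψ.laplacian.setIntegral_mul,
    integral_mul_laplacian_comm ((hφ i).contDiff 2) hψ]

theorem exists_invisible_potential (hn : n = 2 ∨ n = 3) {Ω : Set (Euc n)}
    (hΩo : IsOpen Ω) (hΩb : Bornology.IsBounded Ω) {Y : Euc n → ℝ}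
    (hY : OrthogonalToHarmonic Ω Y) :
    ∃ Φ : Euc n → ℝ,
      HasWeakLaplacian Ω Φ (fun x => - Y x) ∧ MemSobolevZero Ω 2 Φ ∧
      ContinuousOn Φ (closure Ω) ∧ (∀ z ∈ frontier Ω, Φ z = 0) ∧
      ((∃ p : ℝ≥0∞, (n : ℝ≥0∞) < p ∧ MemLp Y p (volume.restrict Ω)) →
        IsC1UpToBoundary Ω Φ ∧ ∀ z ∈ frontier Ω, HasNormalDeriv Ω Φ z 0) := by
  obtain ⟨φ, Φ, hφ, hlim, hL2, hU, hS, hW⟩ := hY.exists_potential hn hΩo hΩb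
  have hcont : Continuous Φ := hU.continuous (Frequently.of_forall fun i => (hφ i).1.continuous)
  have h0 : ∀ x, x ∉ Ω → Φ x = 0 := fun x hx => tendsto_nhds_unique (hU.tendsto_at x)
    (tendsto_const_nhds.congr fun i => ((hφ i).eq_zero hx).symm)
  have hcs : HasCompactSupport Φ := HasCompactSupport.intro hΩb.isCompact_closure
    fun x hx => h0 x fun hx' => hx (subset_closure hx')
  refine ⟨Φ, hW, hS, hcont.continuousOn, fun z hz => h0 z fun h' =>
    (hΩo.frontier_eq ▸ hz).2 h', ?_⟩
  rintro ⟨p, hp, hYp⟩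
  -- The exponent p may be infinite; a finite q strictly between n and p suffices since Ω has finite
  -- measure.
  obtain ⟨q, hq1, hq2⟩ := ENNReal.lt_iff_exists_nnreal_btwn.1 hp
  obtain ⟨M, hM⟩ := hcs.exists_bound_of_continuous hcont
  obtain ⟨R, hR0, hR⟩ := hΩb.closure.subset_ball_lt 0 0
  have : IsFiniteMeasure (volume.restrict Ω) := ⟨by
    rw [Measure.restrict_apply_univ]; exact hΩb.measure_lt_top⟩
  have hYq : MemLp (fun x => -Y x) (ENNReal.ofReal q) (volume.restrict Ω) := by
    rw [ENNReal.ofReal_coe_nnreal]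
    exact (hYp.mono_exponent hq2.le).neg
  obtain ⟨G, hG, hd⟩ := exists_hasFDerivAt_of_memLp (by omega) hΩo hR0
    (subset_closure.trans hR) hφ hY.1.neg hlim hU hM (q := q) (by exact_mod_cast hq1) hYq
  refine ⟨⟨hcont.continuousOn, fun x => (InnerProductSpace.toDual ℝ (Euc n)).symm (G x), ?_,
    fun x hx => (hd x (hR (subset_closure hx))).hasGradientAt⟩, fun z hz =>
      hasNormalDeriv_zero hΩo hz h0 (hd z (hR (frontier_subset_closure hz))).differentiableAt⟩
  exact (InnerProductSpace.toDual ℝ (Euc n)).symm.continuous.comp_continuousOn (hG.mono hR)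

/-! ### Segments into the domain, cutoff functions -/

section Segment

variable {Ω : Set (Euc n)}

/-- Near each point of the closure, a fixed direction points into the domain. -/
theorem HasC2Boundary.exists_segment (hΩ2 : HasC2Boundary Ω) (hΩo : IsOpen Ω) {z : Euc n}
    (hz : z ∈ closure Ω) :
    ∃ W : Set (Euc n), IsOpen W ∧ z ∈ W ∧ ∃ (v : Euc n) (r : ℝ), 0 < r ∧
      ∀ x ∈ closure Ω ∩ W, ∀ t ∈ Ioo 0 r, x - t • v ∈ Ω := by
  by_cases hzΩ : z ∈ Ω
  · exact ⟨Ω, hΩo, hzΩ, 0, 1, one_pos, fun x hx t _ => by simpa using hx.2⟩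
  obtain ⟨U, ρ, hUo, hzU, hρ, hgrad, hΩU⟩ := hΩ2 z ⟨hz, by rwa [hΩo.interior_eq]⟩
  set v := gradient ρ z with hv
  have hv0 : 0 < ‖v‖ := norm_pos_iff.2 hgrad
  have hpos : 0 < fderiv ℝ ρ z v := by
    have : fderiv ℝ ρ z v = ⟪v, v⟫_ℝ := by
      rw [hv]; conv_rhs => rw [gradient, InnerProductSpace.toDual_symm_apply]
      rfl
    rw [this, real_inner_self_eq_norm_sq]; positivity
  have hcont : ContinuousAt (fun y => fderiv ℝ ρ y v) z :=
    ((hρ.continuousOn_fderiv_of_isOpen hUo one_le_two).continuousAt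
      (hUo.mem_nhds hzU)).clm_apply continuousAt_const
  obtain ⟨ε, hε, hball⟩ := Metric.mem_nhds_iff.1
    (Filter.inter_mem (hUo.mem_nhds hzU) (hcont.eventually_const_lt hpos))
  have hdiff : ∀ y ∈ U, HasFDerivAt ρ (fderiv ℝ ρ y) y := fun y hy =>
    ((hρ.contDiffAt (hUo.mem_nhds hy)).differentiableAt two_ne_zero).hasFDerivAt
  -- Half of ε is spent on the distance from z to x, the other half on the segment, which therefore
  -- stays where ρ increases strictly in the direction v. Since ρ ≤ 0 on the closure near z, moving
  -- backwards along v makes ρ negative.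
  refine ⟨Metric.ball z (ε / 2), Metric.isOpen_ball, Metric.mem_ball_self (by positivity), v,
    ε / 2 / ‖v‖, by positivity, ?_⟩
  rintro x ⟨hxΩ, hxz⟩ t ⟨ht0, ht⟩
  have hseg : ∀ s ∈ Icc 0 t, x - s • v ∈ U ∧ 0 < fderiv ℝ ρ (x - s • v) v := by
    intro s hs
    refine hball (Metric.mem_ball.2 ?_)
    have h1 : dist (x - s • v) x = s * ‖v‖ := by
      rw [dist_eq_norm, sub_sub_cancel_left, norm_neg, norm_smul, Real.norm_of_nonneg hs.1]
    have h2 : s * ‖v‖ < ε / 2 := (lt_div_iff₀ hv0).1 (hs.2.trans_lt ht)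
    have h3 := Metric.mem_ball.1 hxz
    linarith [dist_triangle (x - s • v) x z]
  have hxU : x ∈ U := by simpa using (hseg 0 ⟨le_rfl, ht0.le⟩).1
  have hx0 : ρ x ≤ 0 := by
    have h1 : x ∈ closure (Ω ∩ U) := by
      rw [inter_comm]; exact hUo.inter_closure ⟨hxU, hxΩ⟩
    have h2 : Tendsto ρ (𝓝[Ω ∩ U] x) (𝓝 (ρ x)) :=
      (hdiff x hxU).continuousAt.mono_left nhdsWithin_le_nhds
    have := mem_closure_iff_nhdsWithin_neBot.1 h1
    refine le_of_tendsto h2 ?_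
    filter_upwards [self_mem_nhdsWithin] with y hy
    exact (hΩU.subset hy).2.le
  have hder : ∀ s ∈ Icc 0 t, HasDerivAt (fun s : ℝ => ρ (x - s • v))
      (-fderiv ℝ ρ (x - s • v) v) s := by
    intro s hs
    have hl : HasDerivAt (fun s : ℝ => x - s • v) (-v) s := by
      simpa using ((hasDerivAt_id s).smul_const v).const_sub x
    have := (hdiff _ (hseg s hs).1).comp_hasDerivAt s hl
    rwa [map_neg] at this
  have hanti := strictAntiOn_of_deriv_neg (convex_Icc 0 t)
    (fun s hs => (hder s hs).continuousAt.continuousWithinAt) fun s hs => by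
      have hs' := interior_subset hs
      rw [(hder s hs').deriv]
      linarith [(hseg s hs').2]
  have hlt := hanti ⟨le_rfl, ht0.le⟩ ⟨ht0.le, le_rfl⟩ ht0
  simp only [zero_smul, sub_zero] at hlt
  exact (hΩU.superset ⟨(hseg t ⟨ht0.le, le_rfl⟩).1, hlt.trans_le hx0⟩).1

theorem exists_cutoff (hΩo : IsOpen Ω) {K : Set (Euc n)} (hK : IsCompact K) (hKΩ : K ⊆ Ω) :
    ∃ η, IsTestFunction Ω η ∧ ∀ x ∈ K, η =ᶠ[𝓝 x] 1 := by
  obtain ⟨L, hL, hKL, hLΩ⟩ := exists_compact_between hK hΩo hKΩ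
  obtain ⟨f, hf1, hf0, -⟩ := exists_contMDiffMap_one_nhds_of_subset_interior (n := ⊤)
    (modelWithCornersSelf ℝ (Euc n)) hK.isClosed hKL
  have hts : tsupport f ⊆ L := closure_minimal
    (fun _ hx => by by_contra h; exact hx (hf0 _ h)) hL.isClosed
  exact ⟨f, ⟨f.contMDiff.contDiff, hL.of_isClosed_subset (isClosed_tsupport _) hts,
    hts.trans hLΩ⟩, fun x hx => eventually_nhdsSet_iff_forall.1 hf1 x hx⟩

theorem IsTestFunction.contDiff_mul {η h : Euc n → ℝ} (hη : IsTestFunction Ω η)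
    {k : ℕ∞} (hh : ∀ x ∈ Ω, ContDiffAt ℝ k h x) : ContDiff ℝ k (fun x => η x * h x) := by
  rw [contDiff_iff_contDiffAt]
  intro x
  by_cases hx : x ∈ tsupport η
  · exact (hη.1.contDiffAt.of_le (by exact_mod_cast le_top)).mul (hh x (hη.2.2 hx))
  · refine (contDiffAt_const (c := (0 : ℝ))).congr_of_eventuallyEq ?_
    filter_upwards [notMem_tsupport_iff_eventuallyEq.1 hx] with y hy
    simp [hy]

theorem IsTestFunction.mul_right {η h : Euc n → ℝ} (hη : IsTestFunction Ω η) (hΩo : IsOpen Ω)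
    (hh : ContDiffOn ℝ ∞ h Ω) : IsTestFunction Ω (fun x => η x * h x) :=
  ⟨hη.contDiff_mul (k := ⊤) fun _ hx => hh.contDiffAt (hΩo.mem_nhds hx), hη.2.1.mul_right,
    tsupport_mul_subset_left.trans hη.2.2⟩

theorem integral_harmonic_mul_laplacian {h φ : Euc n → ℝ} (hΩo : IsOpen Ω)
    (hh : InnerProductSpace.HarmonicOnNhd h Ω) (hφ : IsTestFunction Ω φ) :
    ∫ x in Ω, h x * Laplacian.laplacian φ x = 0 := by
  obtain ⟨η, hη, hη1⟩ := exists_cutoff hΩo hφ.2.1.isCompact hφ.2.2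
  have hc : ContDiff ℝ 2 (fun x => η x * h x) :=
    hη.contDiff_mul (k := 2) fun x hx => (hh x hx).1
  rw [hφ.laplacian.setIntegral_mul]
  have h1 : ∫ x, h x * Laplacian.laplacian φ x =
      ∫ x, (η x * h x) * Laplacian.laplacian φ x := by
    congr 1; ext x
    by_cases hx : x ∈ tsupport φ
    · rw [(hη1 x hx).self_of_nhds]; simp
    · rw [image_eq_zero_of_notMem_tsupport fun h' => hx (tsupport_laplacian_subset φ h')]; simp
  rw [h1, integral_mul_laplacian_comm hc hφ]
  refine integral_eq_zero_of_ae (Eventually.of_forall fun x => ?_)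
  by_cases hx : x ∈ tsupport φ
  · have e : (fun x => η x * h x) =ᶠ[𝓝 x] h := by
      filter_upwards [hη1 x hx] with y hy
      simp [hy]
    have := (InnerProductSpace.laplacian_congr_nhds e).self_of_nhds
    simp only [this, (hh x (hφ.2.2 hx)).2.self_of_nhds, Pi.zero_apply, zero_mul]
  · simp only [image_eq_zero_of_notMem_tsupport hx, mul_zero, Pi.zero_apply]

/-- Harmonicity as defined provides only C² regularity. A smooth representative is needed so that a
cutoff times h is a test function. -/
theorem exists_smooth_harmonic_ae_eq (hn : 0 < n) (hΩo : IsOpen Ω) (hΩb : Bornology.IsBounded Ω)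
    {h : Euc n → ℝ} (hh : InnerProductSpace.HarmonicOnNhd h Ω) (h2 : MemL2 Ω h) :
    ∃ h' : Euc n → ℝ, ContDiffOn ℝ ∞ h' Ω ∧ InnerProductSpace.HarmonicOnNhd h' Ω ∧
      h' =ᵐ[volume.restrict Ω] h :=
  exists_harmonic_ae_eq hn hΩo hΩb h2 fun _ hφ => integral_harmonic_mul_laplacian hΩo hh hφ

end Segment

/-! ### Overdetermined solutions annihilate harmonic functions -/

section Annihilate

variable {Ω : Set (Euc n)} {u Y χ ψ h : Euc n → ℝ} {g : Fin n → Euc n → ℝ}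

theorem MemL2.continuous_mul {f c : Euc n → ℝ} (hf : MemL2 Ω f) (hΩo : IsOpen Ω)
    (hΩb : Bornology.IsBounded Ω) (hc : Continuous c) : MemL2 Ω (fun x => c x * f x) := by
  obtain ⟨C, hC⟩ := hΩb.isCompact_closure.exists_bound_of_continuousOn hc.continuousOn
  refine MemLp.of_le_mul (c := C) hf (hc.aestronglyMeasurable.mul hf.1) ?_
  filter_upwards [ae_restrict_mem hΩo.measurableSet] with x hx
  rw [norm_mul]
  gcongr
  exact hC x (subset_closure hx)

/-- The source term of the equation satisfied by `χ u`, where `g` is the gradient of `u`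
and `-Y` its Laplacian. -/
def cutoffSource (u Y : Euc n → ℝ) (g : Fin n → Euc n → ℝ) (χ : Euc n → ℝ) (x : Euc n) : ℝ :=
  -(χ x * Y x) + 2 * ∑ j, pd j χ x * g j x + Laplacian.laplacian χ x * u x

theorem memL2_cutoffSource (hΩo : IsOpen Ω) (hΩb : Bornology.IsBounded Ω) (hu : MemL2 Ω u)
    (hg : ∀ j, MemL2 Ω (g j)) (hY : MemL2 Ω Y) (hχ : ContDiff ℝ ∞ χ) :
    MemL2 Ω (cutoffSource u Y g χ) :=
  (((hY.continuous_mul hΩo hΩb hχ.continuous).neg).add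
    ((memLp_finsetSum _ fun j _ =>
      (hg j).continuous_mul hΩo hΩb (contDiff_pd hχ j).continuous).const_mul 2)).add
    (hu.continuous_mul hΩo hΩb (contDiff_laplacian hχ).continuous)

theorem cutoffSource_eq_zero {x : Euc n} (hx : x ∉ tsupport χ) : cutoffSource u Y g χ x = 0 := by
  have h1 : ∀ j, pd j χ x = 0 := fun j =>
    image_eq_zero_of_notMem_tsupport fun h => hx (tsupport_pd_subset χ j h)
  have h2 : Laplacian.laplacian χ x = 0 :=
    image_eq_zero_of_notMem_tsupport fun h => hx (tsupport_laplacian_subset χ h)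
  simp [cutoffSource, h1, h2, image_eq_zero_of_notMem_tsupport hx]

/-- Both `hgrad` and `hdiv` allow test functions that do not vanish near the boundary: they encode
zero Dirichlet and Neumann data of u. Hence the product rule for Δ(χu) holds weakly across the
boundary. -/
theorem integral_cutoffSource_mul (hu : MemL2 Ω u) (hg : ∀ j, MemL2 Ω (g j)) (hY : MemL2 Ω Y)
    (hgrad : ∀ j ψ, IsTestFunction univ ψ → ∫ x in Ω, u x * pd j ψ x = -∫ x in Ω, g j x * ψ x)
    (hdiv : ∀ ψ, IsTestFunction univ ψ →
      ∑ j, ∫ x in Ω, g j x * pd j ψ x = ∫ x in Ω, Y x * ψ x)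
    (hχ : ContDiff ℝ ∞ χ) (hψ : IsTestFunction univ ψ) :
    ∫ x in Ω, cutoffSource u Y g χ x * ψ x = ∫ x in Ω, u x * (χ x * Laplacian.laplacian ψ x) := by
  have hint : ∀ {f θ : Euc n → ℝ}, MemL2 Ω f → IsTestFunction univ θ →
      Integrable (fun x => f x * θ x) (volume.restrict Ω) := fun hf hθ =>
    hf.integrable_mul (hθ.memLp 2 _)
  have hL : ∀ θ, IsTestFunction univ θ →
      ∫ x in Ω, u x * Laplacian.laplacian θ x = -∫ x in Ω, Y x * θ x := by
    intro θ hθ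
    simp_rw [hθ.laplacian_eq, Finset.mul_sum]
    rw [integral_finsetSum _ fun j _ => hint hu ((hθ.pd j).pd j), ← hdiv θ hθ,
      ← Finset.sum_neg_distrib]
    exact Finset.sum_congr rfl fun j _ => hgrad j _ (hθ.pd j)
  have t1 : IsTestFunction univ (fun x => χ x * ψ x) := hψ.mul_left hχ
  have t2 : IsTestFunction univ (fun x => Laplacian.laplacian χ x * ψ x) :=
    hψ.mul_left (contDiff_laplacian hχ)
  have t3 : ∀ j, IsTestFunction univ (fun x => pd j χ x * ψ x) := fun j =>
    hψ.mul_left (contDiff_pd hχ j)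
  -- The identity χΔψ = Δ(χψ) + (Δχ)ψ - 2 Σ ∂_j((∂_jχ)ψ): every derivative of ψ now falls on a test
  -- function, to which the weak equations apply.
  have e : ∀ x, u x * (χ x * Laplacian.laplacian ψ x) =
      u x * Laplacian.laplacian (fun x => χ x * ψ x) x
        + u x * (Laplacian.laplacian χ x * ψ x)
        - 2 * ∑ j, u x * pd j (fun x => pd j χ x * ψ x) x := by
    intro x
    have h1 : ∀ j, pd j (fun x => pd j χ x * ψ x) x =
        pd j (pd j χ) x * ψ x + pd j χ x * pd j ψ x := fun j =>
      pd_mul ((contDiff_pd hχ j).differentiable (by simp) x) (hψ.1.differentiable (by simp) x) j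
    rw [laplacian_mul hχ hψ.1, laplacian_eq_sum_pd (hχ.nat 2).contDiffAt, ← Finset.mul_sum]
    simp_rw [h1]
    rw [Finset.sum_add_distrib, ← Finset.sum_mul]
    ring
  have e' : ∀ x, cutoffSource u Y g χ x * ψ x = -(Y x * (χ x * ψ x))
      + 2 * ∑ j, g j x * (pd j χ x * ψ x) + u x * (Laplacian.laplacian χ x * ψ x) := by
    intro x
    have : ∑ j, g j x * (pd j χ x * ψ x) = (∑ j, pd j χ x * g j x) * ψ x := by
      rw [Finset.sum_mul]; exact Finset.sum_congr rfl fun j _ => by ring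
    rw [this, cutoffSource]; ring
  simp_rw [e, e']
  rw [integral_add, integral_add, integral_sub, integral_add, integral_neg, integral_const_mul,
    integral_const_mul, integral_finsetSum, integral_finsetSum, hL _ t1]
  · have : ∀ j, ∫ x in Ω, u x * pd j (fun x => pd j χ x * ψ x) x =
        -∫ x in Ω, g j x * (pd j χ x * ψ x) := fun j => hgrad j _ (t3 j)
    simp_rw [this]
    rw [Finset.sum_neg_distrib]
    ring
  · exact fun j _ => hint hu ((t3 j).pd j)
  · exact fun j _ => hint (hg j) (t3 j)
  · exact hint hu t1.laplacian
  · exact hint hu t2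
  · exact (hint hu t1.laplacian).add (hint hu t2)
  · exact (integrable_finsetSum _ fun j _ => hint hu ((t3 j).pd j)).const_mul 2
  · exact (hint hY t1).neg
  · exact (integrable_finsetSum _ fun j _ => hint (hg j) (t3 j)).const_mul 2
  · exact (hint hY t1).neg.add ((integrable_finsetSum _ fun j _ => hint (hg j) (t3 j)).const_mul 2)
  · exact hint hu t2

theorem laplacian_comp_sub_right {f : Euc n → ℝ} (a x : Euc n) (hf : ContDiffAt ℝ 2 f (x - a)) :
    Laplacian.laplacian (fun y => f (y - a)) x = Laplacian.laplacian f (x - a) := by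
  have h1 : ∀ (f : Euc n → ℝ) j, pd j (fun y => f (y - a)) = fun y => pd j f (y - a) := by
    intro f j; ext y; simp only [pd, fderiv_comp_sub]
  rw [laplacian_eq_sum_pd hf, laplacian_eq_sum_pd]
  · simp_rw [h1]
  · exact hf.comp x (contDiffAt_id.sub contDiffAt_const)

/-- The shift by `a` carries the compact set closure Ω ∩ supp χ into the open set Ω. So the
translate of h is smooth and harmonic near that set, and after a cutoff it is an admissible test
function. -/
theorem integral_cutoffSource_mul_translate (hΩo : IsOpen Ω) (hΩb : Bornology.IsBounded Ω)
    (hu : MemL2 Ω u) (hg : ∀ j, MemL2 Ω (g j)) (hY : MemL2 Ω Y)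
    (hgrad : ∀ j ψ, IsTestFunction univ ψ → ∫ x in Ω, u x * pd j ψ x = -∫ x in Ω, g j x * ψ x)
    (hdiv : ∀ ψ, IsTestFunction univ ψ →
      ∑ j, ∫ x in Ω, g j x * pd j ψ x = ∫ x in Ω, Y x * ψ x)
    (hχ : ContDiff ℝ ∞ χ) (hs : ContDiffOn ℝ ∞ h Ω) (hh : InnerProductSpace.HarmonicOnNhd h Ω)
    {a : Euc n} (ha : ∀ x ∈ closure Ω ∩ tsupport χ, x - a ∈ Ω) :
    ∫ x in Ω, cutoffSource u Y g χ x * h (x - a) = 0 := by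
  have hK : IsCompact ((fun x => x - a) '' (closure Ω ∩ tsupport χ)) :=
    (hΩb.isCompact_closure.inter_right (isClosed_tsupport χ)).image (by fun_prop)
  obtain ⟨η, hη, hη1⟩ := exists_cutoff hΩo hK (by rintro _ ⟨x, hx, rfl⟩; exact ha x hx)
  have hθ : IsTestFunction Ω (fun x => η x * h x) := hη.mul_right hΩo hs
  have hψ : IsTestFunction univ (fun x => η (x - a) * h (x - a)) :=
    ⟨hθ.1.comp (contDiff_id.sub contDiff_const),
      hθ.2.1.comp_homeomorph (Homeomorph.subRight a), subset_univ _⟩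
  have key := integral_cutoffSource_mul hu hg hY hgrad hdiv hχ hψ
  have e1 : ∫ x in Ω, cutoffSource u Y g χ x * h (x - a) =
      ∫ x in Ω, cutoffSource u Y g χ x * (η (x - a) * h (x - a)) := by
    refine setIntegral_congr_fun hΩo.measurableSet fun x hx => ?_
    by_cases hxχ : x ∈ tsupport χ
    · simp [(hη1 (x - a) ⟨x, ⟨subset_closure hx, hxχ⟩, rfl⟩).self_of_nhds]
    · simp [cutoffSource_eq_zero hxχ]
  rw [e1, key]
  refine setIntegral_eq_zero_of_forall_eq_zero fun x hx => ?_
  by_cases hxχ : x ∈ tsupport χ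
  · have e : (fun x => η x * h x) =ᶠ[𝓝 (x - a)] h := by
      filter_upwards [hη1 (x - a) ⟨x, ⟨subset_closure hx, hxχ⟩, rfl⟩] with y hy
      simp [hy]
    have h1 := laplacian_comp_sub_right a x ((hθ.contDiff 2).contDiffAt)
    have h2 := (InnerProductSpace.laplacian_congr_nhds e).self_of_nhds
    rw [h1, h2, (hh _ (ha x ⟨subset_closure hx, hxχ⟩)).2.self_of_nhds]
    simp
  · simp [image_eq_zero_of_notMem_tsupport hxχ]

theorem tendsto_integral_mul_translate {f h : Euc n → ℝ} (hf : MemLp f 2 volume)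
    (hh : MemLp h 2 volume) (v : Euc n) :
    Tendsto (fun t : ℝ => ∫ x, f x * h (x - t • v)) (𝓝 0) (𝓝 (∫ x, f x * h x)) := by
  have hmp : ∀ t : ℝ, MeasurePreserving (fun x : Euc n => x - t • v) volume volume := fun t =>
    measurePreserving_sub_right volume (t • v)
  let τ : ℝ → C(Euc n, Euc n) := fun t => ⟨fun x => x - t • v, by fun_prop⟩
  have hτ : Continuous τ := by
    refine ContinuousMap.continuous_of_continuous_uncurry _ ?_
    change Continuous fun p : ℝ × Euc n => p.2 - p.1 • v
    fun_prop
  have h1 := Tendsto.compMeasurePreservingLp (p := 2) (l := 𝓝 (0 : ℝ)) (f := fun _ => hh.toLp h)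
    tendsto_const_nhds (hτ.tendsto 0) hmp (hmp 0) (by simp)
  have h2 := (tendsto_const_nhds (x := hf.toLp f) (f := 𝓝 (0 : ℝ))).inner (𝕜 := ℝ) h1
  have e : ∀ t : ℝ, inner ℝ (hf.toLp f) (Lp.compMeasurePreserving (τ t) (hmp t) (hh.toLp h)) =
      ∫ x, f x * h (x - t • v) := by
    intro t
    rw [L2.inner_def]
    refine integral_congr_ae ?_
    filter_upwards [hf.coeFn_toLp, Lp.coeFn_compMeasurePreserving (hh.toLp h) (hmp t),
      (hmp t).quasiMeasurePreserving.ae_eq_comp hh.coeFn_toLp] with x h1 h2 h3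
    simp only [Function.comp_apply] at h2 h3
    change inner ℝ _ (((Lp.compMeasurePreserving (fun x => x - t • v) (hmp t)) (hh.toLp h)) x) = _
    rw [h1, h2, h3]
    simp [mul_comm]
  refine (h2.congr e).trans_eq ?_
  have := e 0
  simp only [zero_smul, sub_zero] at this
  rw [← this]

theorem integral_cutoffSource_mul_harmonic (hΩo : IsOpen Ω) (hΩb : Bornology.IsBounded Ω)
    (hu : MemL2 Ω u) (hg : ∀ j, MemL2 Ω (g j)) (hY : MemL2 Ω Y)
    (hgrad : ∀ j ψ, IsTestFunction univ ψ → ∫ x in Ω, u x * pd j ψ x = -∫ x in Ω, g j x * ψ x)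
    (hdiv : ∀ ψ, IsTestFunction univ ψ →
      ∑ j, ∫ x in Ω, g j x * pd j ψ x = ∫ x in Ω, Y x * ψ x)
    (hχ : ContDiff ℝ ∞ χ) (hs : ContDiffOn ℝ ∞ h Ω) (hh : InnerProductSpace.HarmonicOnNhd h Ω)
    (h2 : MemL2 Ω h) {v : Euc n} {r : ℝ} (hr : 0 < r)
    (hv : ∀ x ∈ closure Ω ∩ tsupport χ, ∀ t ∈ Ioo 0 r, x - t • v ∈ Ω) :
    ∫ x in Ω, cutoffSource u Y g χ x * h x = 0 := by
  have hF := memL2_cutoffSource hΩo hΩb hu hg hY hχ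
  have hF' := (memLp_indicator_iff_restrict hΩo.measurableSet).2 hF
  have hh' := (memLp_indicator_iff_restrict hΩo.measurableSet).2 h2
  -- Continuity of translations in L² is applied to the extensions by zero. For small t > 0 the
  -- translated point stays in Ω wherever the source lives, so the extension does not affect the
  -- integrals, which all vanish.
  have key := tendsto_integral_mul_translate hF' hh' v
  have e0 : ∫ x, Ω.indicator (cutoffSource u Y g χ) x * Ω.indicator h x =
      ∫ x in Ω, cutoffSource u Y g χ x * h x := by
    rw [← integral_indicator hΩo.measurableSet]
    congr 1; ext x
    by_cases hx : x ∈ Ω <;> simp [hx]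
  rw [e0] at key
  refine tendsto_nhds_unique (key.mono_left (nhdsWithin_le_nhds (s := Ioi 0)))
    (tendsto_const_nhds.congr' ?_)
  filter_upwards [Ioo_mem_nhdsGT hr] with t ht
  rw [← integral_cutoffSource_mul_translate hΩo hΩb hu hg hY hgrad hdiv hχ hs hh
    (a := t • v) fun x hx => hv x hx t ht, ← integral_indicator hΩo.measurableSet]
  congr 1; ext x
  by_cases hx : x ∈ Ω
  · by_cases hxχ : x ∈ tsupport χ
    · simp [hx, hv x ⟨subset_closure hx, hxχ⟩ t ht]
    · simp [hx, cutoffSource_eq_zero hxχ]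
  · simp [hx]

theorem pd_sum {ι : Type*} {s : Finset ι} {f : ι → Euc n → ℝ} (hf : ∀ k ∈ s, Differentiable ℝ (f k))
    (j : Fin n) : pd j (fun y => ∑ k ∈ s, f k y) = fun y => ∑ k ∈ s, pd j (f k) y := by
  ext y
  simp only [pd]
  rw [fderiv_fun_sum fun k hk => hf k hk y]
  simp

theorem laplacian_sum {ι : Type*} {s : Finset ι} {f : ι → Euc n → ℝ}
    (hf : ∀ k ∈ s, ContDiff ℝ ∞ (f k)) (x : Euc n) :
    Laplacian.laplacian (fun y => ∑ k ∈ s, f k y) x = ∑ k ∈ s, Laplacian.laplacian (f k) x := by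
  rw [laplacian_eq_sum_pd ((ContDiff.sum hf).nat 2).contDiffAt,
    Finset.sum_congr rfl fun k hk => laplacian_eq_sum_pd ((hf k hk).nat 2).contDiffAt,
    Finset.sum_comm]
  refine Finset.sum_congr rfl fun j _ => ?_
  rw [pd_sum fun k hk => (hf k hk).differentiable (by simp),
    pd_sum fun k hk => (contDiff_pd (hf k hk) j).differentiable (by simp)]

/-- Since the cutoffs sum to 1 in a neighbourhood of x, their first derivatives and Laplacians sum
to zero there, and only the term with `Y` remains. -/
theorem sum_cutoffSource {ι : Type*} {s : Finset ι} {χ : ι → Euc n → ℝ}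
    (hχ : ∀ k ∈ s, ContDiff ℝ ∞ (χ k)) {x : Euc n} (h1 : (fun y => ∑ k ∈ s, χ k y) =ᶠ[𝓝 x] 1) :
    ∑ k ∈ s, cutoffSource u Y g (χ k) x = -Y x := by
  have e1 : ∑ k ∈ s, χ k x = 1 := h1.self_of_nhds
  have e2 : ∀ j, ∑ k ∈ s, pd j (χ k) x = 0 := by
    intro j
    have := congrFun (pd_sum (fun k hk => (hχ k hk).differentiable (by simp)) j) x
    rw [← this, pd, h1.fderiv_eq]
    simp
  have e3 : ∑ k ∈ s, Laplacian.laplacian (χ k) x = 0 := by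
    rw [← laplacian_sum hχ, (InnerProductSpace.laplacian_congr_nhds h1).self_of_nhds,
      Pi.one_def, InnerProductSpace.laplacian_const]
    rfl
  simp only [cutoffSource]
  rw [Finset.sum_add_distrib, Finset.sum_add_distrib, Finset.sum_neg_distrib, ← Finset.sum_mul,
    ← Finset.sum_mul, ← Finset.mul_sum, Finset.sum_comm, e1, e3]
  simp_rw [← Finset.sum_mul, e2]
  simp

/-- If `-Δu = Y` with vanishing Cauchy data, in the sense that the equations hold weakly against
all smooth functions, then `Y` is orthogonal to harmonic functions. -/
theorem integral_mul_harmonic_eq_zero (hn : 0 < n) (hΩo : IsOpen Ω) (hΩb : Bornology.IsBounded Ω)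
    (hΩ2 : HasC2Boundary Ω) (hu : MemL2 Ω u) (hg : ∀ j, MemL2 Ω (g j)) (hY : MemL2 Ω Y)
    (hgrad : ∀ j ψ, IsTestFunction univ ψ → ∫ x in Ω, u x * pd j ψ x = -∫ x in Ω, g j x * ψ x)
    (hdiv : ∀ ψ, IsTestFunction univ ψ →
      ∑ j, ∫ x in Ω, g j x * pd j ψ x = ∫ x in Ω, Y x * ψ x)
    (hh : InnerProductSpace.HarmonicOnNhd h Ω) (h2 : MemL2 Ω h) :
    ∫ x in Ω, Y x * h x = 0 := by
  obtain ⟨h', hs, hh', hae⟩ := exists_smooth_harmonic_ae_eq hn hΩo hΩb hh h2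
  have h2' : MemL2 Ω h' := (memLp_congr_ae hae).2 h2
  choose! W hWo hzW v r hr hv using fun z (hz : z ∈ closure Ω) => hΩ2.exists_segment hΩo hz
  obtain ⟨t, htΩ, hcov⟩ := hΩb.isCompact_closure.elim_nhds_subcover W
    fun z hz => (hWo z hz).mem_nhds (hzW z hz)
  -- Each member of the partition is supported in a set on which a single direction points into Ω.
  obtain ⟨f, hf⟩ := SmoothPartitionOfUnity.exists_isSubordinate (modelWithCornersSelf ℝ (Euc n))
    isClosed_closure (fun z : t => W z) (fun z => hWo z (htΩ z z.2)) (by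
      intro x hx
      obtain ⟨z, hz, hxz⟩ := mem_iUnion₂.1 (hcov hx)
      exact mem_iUnion.2 ⟨⟨z, hz⟩, hxz⟩)
  have hfs : ∀ k, ContDiff ℝ ∞ (f k) := fun k => (f k).contMDiff.contDiff
  have hz : ∀ k, ∫ x in Ω, cutoffSource u Y g (f k) x * h' x = 0 := fun k =>
    integral_cutoffSource_mul_harmonic hΩo hΩb hu hg hY hgrad hdiv (hfs k) hs hh' h2'
      (hr k (htΩ k k.2)) fun x hx => hv k (htΩ k k.2) x ⟨hx.1, hf k hx.2⟩
  have hsum : ∑ k, ∫ x in Ω, cutoffSource u Y g (f k) x * h' x = -∫ x in Ω, Y x * h x := by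
    have hint : ∀ k ∈ Finset.univ, Integrable (fun x => cutoffSource u Y g (f k) x * h' x)
        (volume.restrict Ω) := fun k _ =>
      (memL2_cutoffSource hΩo hΩb hu hg hY (hfs k)).integrable_mul h2'
    rw [← integral_finsetSum _ hint, ← integral_neg]
    refine integral_congr_ae ?_
    filter_upwards [ae_restrict_mem hΩo.measurableSet, hae] with x hx hxe
    rw [← Finset.sum_mul, sum_cutoffSource (fun k _ => hfs k), hxe, neg_mul]
    filter_upwards [hΩo.mem_nhds hx] with y hy
    rw [← finsum_eq_sum_of_fintype, f.sum_eq_one (subset_closure hy)]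
    rfl
  rw [← neg_eq_zero, ← hsum]
  exact Finset.sum_eq_zero fun k _ => hz k

end Annihilate

/-! ### The space `H^1_0` -/

section Sobolev

variable {Ω : Set (Euc n)} {u : Euc n → ℝ}

theorem MemSobolevZero.exists_pd (h : MemSobolevZero Ω 1 u) :
    ∃ (φ : ℕ → Euc n → ℝ) (G : Fin n → Euc n → ℝ), (∀ i, IsTestFunction Ω (φ i)) ∧
      (∀ j, MemL2 Ω (G j)) ∧
      Tendsto (fun i => eLpNorm (fun x => φ i x - u x) 2 (volume.restrict Ω)) atTop (𝓝 0) ∧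
      ∀ j, Tendsto (fun i => eLpNorm (fun x => pd j (φ i) x - G j x) 2 (volume.restrict Ω))
        atTop (𝓝 0) := by
  obtain ⟨-, φ, hφ, hu, hF⟩ := h
  obtain ⟨F, hF2, hFt⟩ := hF 1 le_rfl
  have happ : ∀ (j : Fin n) (A : ContinuousMultilinearMap ℝ (fun _ : Fin 1 => Euc n) ℝ),
      ‖A fun _ => EuclideanSpace.single j 1‖ ≤ ‖A‖ := fun j A => by
    simpa using A.le_opNorm fun _ => EuclideanSpace.single j 1
  refine ⟨φ, fun j x => F x fun _ => EuclideanSpace.single j 1, hφ, fun j => ?_, hu, fun j => ?_⟩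
  · refine hF2.mono ?_ (Eventually.of_forall fun x => happ j (F x))
    exact (ContinuousMultilinearMap.apply ℝ (fun _ : Fin 1 => Euc n) ℝ
      (fun _ => EuclideanSpace.single j 1)).continuous.comp_aestronglyMeasurable hF2.1
  · refine tendsto_of_tendsto_of_tendsto_of_le_of_le tendsto_const_nhds hFt (fun _ => zero_le)
      fun i => eLpNorm_mono fun x => ?_
    refine le_trans (le_of_eq ?_) (happ j _)
    simp [pd, iteratedFDeriv_one_apply]

/-- The approximating functions have compact support in Ω, so no boundary term arises even though ψ
need not vanish on the boundary. This is the weak form of a zero trace. -/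
theorem integral_mul_pd_of_tendsto {φ : ℕ → Euc n → ℝ} {G : Fin n → Euc n → ℝ}
    (hφ : ∀ i, IsTestFunction Ω (φ i)) (hu2 : MemL2 Ω u) (hG : ∀ j, MemL2 Ω (G j))
    (hu : Tendsto (fun i => eLpNorm (fun x => φ i x - u x) 2 (volume.restrict Ω)) atTop (𝓝 0))
    (hGt : ∀ j, Tendsto (fun i => eLpNorm (fun x => pd j (φ i) x - G j x) 2 (volume.restrict Ω))
        atTop (𝓝 0)) (j : Fin n) {ψ : Euc n → ℝ} (hψ : IsTestFunction univ ψ) :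
    ∫ x in Ω, u x * pd j ψ x = -∫ x in Ω, G j x * ψ x := by
  have h1 := tendsto_integral_mul_of_L2 (fun i => (hφ i).memLp 2 _) hu2
    ((hψ.pd j).memLp 2 _) hu
  have h2 := (tendsto_integral_mul_of_L2 (fun i => ((hφ i).pd j).memLp 2 _) (hG j)
    (hψ.memLp 2 _) (hGt j)).neg
  refine tendsto_nhds_unique h1 (h2.congr fun i => ?_)
  rw [(hφ i).setIntegral_mul_left, ((hφ i).pd j).setIntegral_mul_left,
    integral_mul_pd ((hφ i).contDiff 1) (hψ.contDiff 1) hψ.2.1]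

theorem MemSobolevZero.mono {k l : ℕ} (h : MemSobolevZero Ω k u) (hlk : l ≤ k) :
    MemSobolevZero Ω l u := by
  obtain ⟨hu2, φ, hφ, hu, hF⟩ := h
  exact ⟨hu2, φ, hφ, hu, fun m hm => hF m (hm.trans hlk)⟩

theorem MemSobolevZero.sub {k : ℕ} {v : Euc n → ℝ} (hu : MemSobolevZero Ω k u)
    (hv : MemSobolevZero Ω k v) : MemSobolevZero Ω k (fun x => u x - v x) := by
  obtain ⟨hu2, φ, hφ, hut, hF⟩ := hu
  obtain ⟨hv2, ψ, hψ, hvt, hG⟩ := hv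
  refine ⟨hu2.sub hv2, fun i => φ i - ψ i, fun i => (hφ i).sub (hψ i), ?_, fun m hm => ?_⟩
  · refine tendsto_of_tendsto_of_tendsto_of_le_of_le tendsto_const_nhds
      (by simpa using hut.add hvt) (fun _ => zero_le) fun i => ?_
    refine le_trans (le_of_eq ?_) (eLpNorm_sub_le (((hφ i).memLp 2 _).sub hu2).1
      (((hψ i).memLp 2 _).sub hv2).1 one_le_two)
    congr 1; ext x; simp; ring
  · obtain ⟨F, hF2, hFt⟩ := hF m hm
    obtain ⟨G, hG2, hGt⟩ := hG m hm
    refine ⟨F - G, hF2.sub hG2, ?_⟩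
    have hcm : ∀ {φ : Euc n → ℝ}, IsTestFunction Ω φ →
        MemLp (iteratedFDeriv ℝ m φ) 2 (volume.restrict Ω) := fun hφ =>
      ((hφ.contDiff m).continuous_iteratedFDeriv le_rfl).memLp_of_hasCompactSupport
        (hφ.2.1.iteratedFDeriv m)
    refine tendsto_of_tendsto_of_tendsto_of_le_of_le tendsto_const_nhds
      (by simpa using hFt.add hGt) (fun _ => zero_le) fun i => ?_
    refine le_trans (le_of_eq ?_) (eLpNorm_sub_le ((hcm (hφ i)).sub hF2).1
      ((hcm (hψ i)).sub hG2).1 one_le_two)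
    congr 1; ext x : 1
    rw [iteratedFDeriv_sub ((hφ i).contDiff m) ((hψ i).contDiff m)]
    simp only [Pi.sub_apply]
    abel

/-- Uniqueness for the Dirichlet problem. -/
theorem MemSobolevZero.ae_eq_zero (hn : n = 2 ∨ n = 3) (hΩb : Bornology.IsBounded Ω)
    (h : MemSobolevZero Ω 1 u) (hw : HasWeakLaplacian Ω u 0) : u =ᵐ[volume.restrict Ω] 0 := by
  obtain ⟨φ, G, hφ, hG, hut, hGt⟩ := h.exists_pd
  have hu2 := h.1
  have hgrad := fun j {ψ} hψ => integral_mul_pd_of_tendsto hφ hu2 hG hut hGt j (ψ := ψ) hψ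
  have hdiv : ∀ ψ, IsTestFunction Ω ψ → ∑ j, ∫ x in Ω, pd j ψ x * G j x = 0 := by
    intro ψ hψ
    have h1 := hw ψ hψ
    simp only [Pi.zero_apply, zero_mul, integral_zero] at h1
    simp_rw [hψ.laplacian_eq, Finset.mul_sum] at h1
    have hint : ∀ j ∈ Finset.univ, Integrable (fun x => u x * pd j (pd j ψ) x)
        (volume.restrict Ω) := fun j _ => hu2.integrable_mul (((hψ.pd j).pd j).memLp 2 _)
    rw [integral_finsetSum _ hint] at h1
    rw [← neg_eq_zero, ← h1, ← Finset.sum_neg_distrib]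
    refine Finset.sum_congr rfl fun j _ => ?_
    rw [hgrad j ((hψ.pd j).mono (subset_univ _))]
    simp_rw [mul_comm]
  -- The energy identity: the weak equation is tested with the approximations of u itself and passed
  -- to the limit.
  have h0 : ∑ j, ∫ x in Ω, G j x * G j x = 0 :=
    tendsto_nhds_unique (tendsto_finsetSum _ fun j _ =>
      tendsto_integral_mul_of_L2 (fun i => ((hφ i).pd j).memLp 2 _) (hG j) (hG j) (hGt j))
      (tendsto_const_nhds.congr fun i => (hdiv _ (hφ i)).symm)
  have hG0 : ∀ j, G j =ᵐ[volume.restrict Ω] 0 := by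
    intro j
    have h1 := (Finset.sum_eq_zero_iff_of_nonneg fun j _ =>
      integral_nonneg fun x => mul_self_nonneg (G j x)).1 h0 j (Finset.mem_univ j)
    have h2 := (integral_eq_zero_iff_of_nonneg (fun x => mul_self_nonneg (G j x))
      ((hG j).integrable_mul (hG j))).1 h1
    filter_upwards [h2] with x hx using by simpa using hx
  have hpd : ∀ j, Tendsto (fun i => eLpNorm (pd j (φ i)) 2 volume) atTop (𝓝 0) := by
    intro j
    refine (hGt j).congr fun i => ?_
    rw [← ((hφ i).pd j).eLpNorm_restrict]
    refine eLpNorm_congr_ae ?_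
    filter_upwards [hG0 j] with x hx
    simp [hx]
  -- The Sobolev inequality with q = 2 serves as Poincaré's inequality: the gradients of the
  -- approximations tend to zero, hence so do the approximations.
  obtain ⟨C, hC, hbd⟩ := exists_eLpNorm_le_fderiv hn hΩb ℝ (q := 2) (by norm_num)
  have hlim : Tendsto (fun i => C * ∑ j, eLpNorm (pd j (φ i)) 2 volume) atTop (𝓝 0) := by
    simpa using ENNReal.Tendsto.const_mul (tendsto_finsetSum Finset.univ fun j _ => hpd j)
      (Or.inr hC)
  have hφ0 : Tendsto (fun i => eLpNorm (φ i) 2 (volume.restrict Ω)) atTop (𝓝 0) := by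
    refine tendsto_of_tendsto_of_tendsto_of_le_of_le tendsto_const_nhds hlim
      (fun _ => zero_le) fun i => ?_
    simp only
    rw [(hφ i).eLpNorm_restrict]
    refine (hbd _ ((hφ i).contDiff 1) (hφ i).2.2).trans ?_
    gcongr
    refine le_trans ?_ (eLpNorm_sum_le (fun j _ => (((hφ i).pd j).memLp 2 volume).norm.1)
      one_le_two) |>.trans_eq (Finset.sum_congr rfl fun j _ => eLpNorm_norm _)
    refine eLpNorm_mono_real fun x => ?_
    rw [Finset.sum_apply]
    exact clm_norm_le_sum _
  have hfin : eLpNorm u 2 (volume.restrict Ω) = 0 := by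
    refine le_antisymm (ge_of_tendsto' (by simpa using hφ0.add hut) fun i => ?_) zero_le
    refine le_trans (le_of_eq ?_) (eLpNorm_sub_le ((hφ i).memLp 2 _).1
      (((hφ i).memLp 2 _).sub hu2).1 one_le_two)
    congr 1; ext x; simp
  exact (eLpNorm_eq_zero_iff hu2.1 two_ne_zero).1 hfin

end Sobolev

/-! ### Integral operators with square-integrable kernels -/

section Kernels

variable {Ω : Set (Euc n)} {G : Euc n → Euc n → ℝ} {f k u v Y : Euc n → ℝ}

theorem isFiniteMeasure_restrict (hΩb : Bornology.IsBounded Ω) :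
    IsFiniteMeasure (volume.restrict Ω) :=
  ⟨by rw [Measure.restrict_apply_univ]; exact hΩb.measure_lt_top⟩

theorem IsL2Kernel.ae_integrable (hG : IsL2Kernel Ω G) (hΩb : Bornology.IsBounded Ω)
    (hf : MemL2 Ω f) :
    ∀ᵐ x ∂(volume.restrict Ω), Integrable (fun y => G x y * f y) (volume.restrict Ω) := by
  have := isFiniteMeasure_restrict hΩb
  exact (MemLp.integrable_mul hG (MemLp.comp_snd hf (volume.restrict Ω))).prod_right_ae

theorem kernelOp_sub_ae {G' : Euc n → Euc n → ℝ} (hG : IsL2Kernel Ω G) (hG' : IsL2Kernel Ω G')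
    (hΩb : Bornology.IsBounded Ω) (hf : MemL2 Ω f) :
    ∀ᵐ x ∂(volume.restrict Ω),
      kernelOp Ω (fun x y => G x y - G' x y) f x = kernelOp Ω G f x - kernelOp Ω G' f x := by
  filter_upwards [hG.ae_integrable hΩb hf, hG'.ae_integrable hΩb hf] with x h1 h2
  simp only [kernelOp, sub_mul]
  exact integral_sub h1 h2

theorem integral_kernelOp_mul_comm (hΩo : IsOpen Ω) (hG : IsL2Kernel Ω G)
    (hsym : ∀ x ∈ Ω, ∀ y ∈ Ω, G x y = G y x) (hf : MemL2 Ω f) (hk : MemL2 Ω k) :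
    ∫ x in Ω, kernelOp Ω G f x * k x = ∫ x in Ω, f x * kernelOp Ω G k x := by
  have hfk : MemLp (fun p : Euc n × Euc n => k p.1 * f p.2) 2
      ((volume.restrict Ω).prod (volume.restrict Ω)) := by
    refine (memLp_two_iff_integrable_sq (hk.1.comp_fst.mul hf.1.comp_snd)).2 ?_
    simp_rw [Pi.mul_apply, mul_pow]
    exact hk.integrable_sq.mul_prod hf.integrable_sq
  have hint : Integrable (Function.uncurry fun x y => G x y * (k x * f y))
      ((volume.restrict Ω).prod (volume.restrict Ω)) := MemLp.integrable_mul hG hfk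
  have key := integral_integral_swap hint
  have e1 : ∀ x, ∫ y in Ω, G x y * (k x * f y) = kernelOp Ω G f x * k x := fun x => by
    rw [kernelOp, ← integral_mul_const]; congr 1; ext y; ring
  simp_rw [e1] at key
  rw [key]
  refine setIntegral_congr_fun hΩo.measurableSet fun y hy => ?_
  simp only [kernelOp]
  rw [← integral_const_mul]
  refine setIntegral_congr_fun hΩo.measurableSet fun x hx => ?_
  simp only [hsym x hx y hy]
  ring

end Kernels

/-! ### Neumann solutions -/

section Neumann

variable {Ω : Set (Euc n)} {f u v Y : Euc n → ℝ} {g : Euc n → Euc n}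

theorem memLp_coord (hg : MemLp g 2 (volume.restrict Ω)) (j : Fin n) :
    MemL2 Ω (fun x => g x j) := by
  refine hg.mono ((EuclideanSpace.proj (𝕜 := ℝ) j).continuous.comp_aestronglyMeasurable hg.1)
    (Eventually.of_forall fun x => PiLp.norm_apply_le (g x) j)

theorem IsTestFunction.memLp_gradient {φ : Euc n → ℝ} (hφ : IsTestFunction Ω φ) :
    MemLp (fun x => gradient φ x) 2 (volume.restrict Ω) := by
  have hc : Continuous (gradient φ) := (InnerProductSpace.toDual ℝ (Euc n)).symm.continuous.comp
    ((hφ.contDiff 1).continuous_fderiv one_ne_zero)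
  refine hc.memLp_of_hasCompactSupport ?_
  exact (hφ.2.1.fderiv ℝ).comp_left (g := (InnerProductSpace.toDual ℝ (Euc n)).symm) (map_zero _)

theorem HasWeakGradient.integral_mul_pd (h : HasWeakGradient Ω v g) (hv : MemL2 Ω v)
    (hg : MemLp g 2 (volume.restrict Ω)) {φ : Euc n → ℝ} (hφ : IsTestFunction Ω φ) (j : Fin n) :
    ∫ x in Ω, v x * pd j φ x = -∫ x in Ω, g x j * φ x := by
  have h1 : Integrable (fun x => v x • gradient φ x) (volume.restrict Ω) :=
    memLp_one_iff_integrable.1 (hφ.memLp_gradient.smul hv)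
  have h2 : Integrable (fun x => φ x • g x) (volume.restrict Ω) :=
    memLp_one_iff_integrable.1 (hg.smul (hφ.memLp 2 _))
  have e1 := (EuclideanSpace.proj (𝕜 := ℝ) j).integral_comp_comm h1
  have e2 := (EuclideanSpace.proj (𝕜 := ℝ) j).integral_comp_comm h2
  rw [h φ hφ, map_neg, ← e2] at e1
  simpa [gradient_apply, mul_comm] using e1

theorem HasWeakGradient.integral_mul_laplacian (h : HasWeakGradient Ω v g) (hv : MemL2 Ω v)
    (hg : MemLp g 2 (volume.restrict Ω)) {φ : Euc n → ℝ} (hφ : IsTestFunction Ω φ) :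
    ∫ x in Ω, v x * Laplacian.laplacian φ x = -∫ x in Ω, ⟪g x, gradient φ x⟫_ℝ := by
  have i1 : ∀ j ∈ Finset.univ, Integrable (fun x => v x * pd j (pd j φ) x)
      (volume.restrict Ω) := fun j _ => hv.integrable_mul (((hφ.pd j).pd j).memLp 2 _)
  have i2 : ∀ j ∈ Finset.univ, Integrable (fun x => g x j * pd j φ x)
      (volume.restrict Ω) := fun j _ => (memLp_coord hg j).integrable_mul ((hφ.pd j).memLp 2 _)
  simp_rw [hφ.laplacian_eq, inner_eq_sum, gradient_apply, Finset.mul_sum]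
  rw [integral_finsetSum _ i1, integral_finsetSum _ i2, ← Finset.sum_neg_distrib]
  exact Finset.sum_congr rfl fun j _ => h.integral_mul_pd hv hg (hφ.pd j) j

theorem boundaryMean_eq_zero {φ : Euc n → ℝ} (h : ∀ z ∈ frontier Ω, φ z = 0) :
    boundaryMean Ω φ = 0 := by
  rw [boundaryMean, setAverage_congr_fun isClosed_frontier.measurableSet
    (Eventually.of_forall h) (g := fun _ => 0)]
  simp [average_eq]

theorem IsNeumannSolution.integral_mul_laplacian (hΩo : IsOpen Ω) (h : IsNeumannSolution Ω f v)
    {φ : Euc n → ℝ} (hφ : IsTestFunction Ω φ) :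
    ∫ x in Ω, v x * Laplacian.laplacian φ x = -∫ x in Ω, f x * φ x := by
  obtain ⟨hv, g, hg, hw, hN⟩ := h
  rw [hw.integral_mul_laplacian hv hg hφ, hN φ hφ.1,
    boundaryMean_eq_zero fun z hz => hφ.eq_zero fun h' => (hΩo.frontier_eq ▸ hz).2 h', mul_zero,
    sub_zero]

theorem memL2_one (hΩb : Bornology.IsBounded Ω) : MemL2 Ω (fun _ => 1) :=
  have := isFiniteMeasure_restrict hΩb
  memLp_const 1

end Neumann

/-! ### The null space of the difference of the Green's functions -/

section NullSpace

variable {Ω : Set (Euc n)} {GD GN : Euc n → Euc n → ℝ} {Y : Euc n → ℝ}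

theorem OrthogonalToHarmonic.integral_eq_zero (hΩb : Bornology.IsBounded Ω)
    (hY : OrthogonalToHarmonic Ω Y) : ∫ x in Ω, Y x = 0 := by
  simpa using hY.2 (fun _ => 1) (InnerProductSpace.harmonicOnNhd_const 1) (memL2_one hΩb)

theorem OrthogonalToHarmonic.inKernel (hn : n = 2 ∨ n = 3) (hΩo : IsOpen Ω)
    (hΩb : Bornology.IsBounded Ω) (hD : IsDirichletGreen Ω GD) (hN : IsNeumannGreen Ω GN)
    (hY : OrthogonalToHarmonic Ω Y) : InKernel Ω (fun x y => GD x y - GN x y) Y := by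
  obtain ⟨φ, Φ, hφ, hlim, hL2, -, hS, hW⟩ := hY.exists_potential hn hΩo hΩb
  have hYn : MemL2 Ω (fun x => -Y x) := hY.1.neg
  have hDY := hD.2 Y hY.1
  have hNY := (hN.2.2 Y hY.1).1
  have hDΦ : (fun x => kernelOp Ω GD Y x - Φ x) =ᵐ[volume.restrict Ω] 0 := by
    refine (hDY.1.sub (hS.mono one_le_two)).ae_eq_zero hn hΩb fun ψ hψ => ?_
    have i1 := hDY.1.1.integrable_mul (hψ.laplacian.memLp 2 (volume.restrict Ω))
    have i2 := hS.1.integrable_mul (hψ.laplacian.memLp 2 (volume.restrict Ω))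
    have e := integral_sub i1 i2
    simp only [Pi.mul_apply] at e
    simp only [sub_mul, e, Pi.zero_apply, zero_mul, integral_zero]
    rw [hDY.2 ψ hψ, hW ψ hψ, sub_self]
  -- The Neumann problem alone determines its solution only up to a constant. Symmetry of the kernel
  -- removes the ambiguity: the operator is moved onto f, and Δφ_i → -Y is paired with the Neumann
  -- solution for f.
  have hpair : ∀ f, MemL2 Ω f →
      ∫ x in Ω, kernelOp Ω GN Y x * f x = ∫ x in Ω, Φ x * f x := by
    intro f hf
    have hs := hN.2.2 f hf
    rw [integral_kernelOp_mul_comm hΩo hN.1 hN.2.1 hY.1 hf]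
    have t1 := (tendsto_integral_mul_of_L2 (fun i => (hφ i).laplacian.memLp 2 _) hYn hs.1
      hlim).neg
    have t2 := tendsto_integral_mul_of_L2 (fun i => (hφ i).memLp 2 _) hS.1 hf hL2
    simp_rw [neg_mul, integral_neg, neg_neg] at t1
    refine tendsto_nhds_unique t1 (t2.congr fun i => ?_)
    have := hs.integral_mul_laplacian hΩo (hφ i)
    simp_rw [mul_comm] at this ⊢
    rw [this, neg_neg]
  have hNΦ : (fun x => (kernelOp Ω GN Y x - Φ x) * (kernelOp Ω GN Y x - Φ x))
      =ᵐ[volume.restrict Ω] 0 := by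
    have hd : MemL2 Ω (fun x => kernelOp Ω GN Y x - Φ x) := hNY.sub hS.1
    rw [← integral_eq_zero_iff_of_nonneg (fun x => mul_self_nonneg _) (hd.integrable_mul hd)]
    have e := integral_sub (hNY.integrable_mul hd) (hS.1.integrable_mul hd)
    simp only [Pi.mul_apply] at e
    conv_lhs => simp only [sub_mul (kernelOp Ω GN Y _) (Φ _)]
    rw [e, hpair _ hd, sub_self]
  refine ⟨hY.1, ?_⟩
  filter_upwards [kernelOp_sub_ae hD.1 hN.1 hΩb hY.1, hDΦ, hNΦ] with x h1 h2 h3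
  have h3' := mul_self_eq_zero.1 h3
  simp only [Pi.zero_apply] at h2
  rw [h1]
  linarith

/-- The two Green potentials of `Y` coincide a.e., so one function has zero trace, from the
Dirichlet side, and zero normal derivative, from the Neumann side, where the mean-zero condition
kills the boundary flux. -/
theorem InKernel.orthogonalToHarmonic (hn : 0 < n) (hΩo : IsOpen Ω)
    (hΩb : Bornology.IsBounded Ω) (hΩ2 : HasC2Boundary Ω) (hD : IsDirichletGreen Ω GD)
    (hN : IsNeumannGreen Ω GN) (hY : InKernel Ω (fun x y => GD x y - GN x y) Y)
    (hY0 : ∫ x in Ω, Y x = 0) : OrthogonalToHarmonic Ω Y := by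
  have hS := (hD.2 Y hY.1).1
  obtain ⟨hv, g, hg, hw, hNeu⟩ := hN.2.2 Y hY.1
  have huv : kernelOp Ω GD Y =ᵐ[volume.restrict Ω] kernelOp Ω GN Y := by
    filter_upwards [kernelOp_sub_ae hD.1 hN.1 hΩb hY.1, hY.2] with x h1 h2
    rw [h1] at h2
    linarith
  obtain ⟨φ, G, hφ, hG, hut, hGt⟩ := hS.exists_pd
  have hgrad := fun j ψ hψ => integral_mul_pd_of_tendsto hφ hS.1 hG hut hGt j (ψ := ψ) hψ
  -- Uniqueness of weak gradients: `G` comes from the H¹_0 approximation and `g` from the Neumann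
  -- problem, but both differentiate the same function.
  have hGg : ∀ j, (fun x => G j x) =ᵐ[volume.restrict Ω] fun x => g x j := by
    intro j
    have hd : MemL2 Ω (fun x => G j x - g x j) := (hG j).sub (memLp_coord hg j)
    have := hΩo.ae_eq_zero_of_integral_contDiff_smul_eq_zero (μ := volume)
      (integrableOn_of_memL2 hΩb hd).locallyIntegrableOn fun ψ h1 h2 h3 => by
        have hψ : IsTestFunction Ω ψ := ⟨h1, h2, h3⟩
        simp_rw [smul_eq_mul]
        rw [← hψ.setIntegral_mul_left]
        have e := integral_sub ((hG j).integrable_mul (hψ.memLp 2 _))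
          ((memLp_coord hg j).integrable_mul (hψ.memLp 2 _))
        simp only [Pi.mul_apply] at e
        simp_rw [mul_comm (ψ _), sub_mul]
        have h4 := hgrad j ψ (hψ.mono (subset_univ _))
        have h5 := hw.integral_mul_pd hv hg hψ j
        have h6 : ∫ x in Ω, kernelOp Ω GD Y x * pd j ψ x =
            ∫ x in Ω, kernelOp Ω GN Y x * pd j ψ x := by
          refine integral_congr_ae ?_
          filter_upwards [huv] with x hx
          rw [hx]
        rw [e]
        linarith
    rw [Filter.EventuallyEq, ae_restrict_iff' hΩo.measurableSet]
    filter_upwards [this] with x hx hxΩ using sub_eq_zero.1 (hx hxΩ)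
  have hdiv : ∀ ψ, IsTestFunction univ ψ →
      ∑ j, ∫ x in Ω, G j x * pd j ψ x = ∫ x in Ω, Y x * ψ x := by
    intro ψ hψ
    have h1 := hNeu ψ hψ.1
    have i2 : ∀ j ∈ Finset.univ, Integrable (fun x => g x j * pd j ψ x)
        (volume.restrict Ω) := fun j _ => (memLp_coord hg j).integrable_mul ((hψ.pd j).memLp 2 _)
    simp_rw [hY0, zero_mul, sub_zero, inner_eq_sum, gradient_apply] at h1
    rw [integral_finsetSum _ i2] at h1
    rw [← h1]
    refine Finset.sum_congr rfl fun j _ => integral_congr_ae ?_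
    filter_upwards [hGg j] with x hx
    rw [hx]
  exact ⟨hY.1, fun h hh h2 =>
    integral_mul_harmonic_eq_zero hn hΩo hΩb hΩ2 hS.1 hG hY.1 hgrad hdiv hh h2⟩

end NullSpace

end InvCond

end

theorem theorem3 (n : ℕ) (hn : n = 2 ∨ n = 3) (Ω : Set (Euc n)) (hΩo : IsOpen Ω)
    (hΩb : Bornology.IsBounded Ω) (hΩ2 : InvCond.HasC2Boundary Ω) :
    -- the null space of `G_D - G_N`
    (∀ GD GN : Euc n → Euc n → ℝ,
      InvCond.IsDirichletGreen Ω GD → InvCond.IsNeumannGreen Ω GN →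
      ∀ Y : Euc n → ℝ,
        InvCond.OrthogonalToHarmonic Ω Y ↔
          (InvCond.InKernel Ω (fun x y => GD x y - GN x y) Y ∧ ∫ x in Ω, Y x = 0)) ∧
    -- the invisible potential
    (∀ Y : Euc n → ℝ, InvCond.OrthogonalToHarmonic Ω Y →
      ∃ Φ : Euc n → ℝ,
        InvCond.HasWeakLaplacian Ω Φ (fun x => - Y x) ∧
        InvCond.MemSobolevZero Ω 2 Φ ∧
        ContinuousOn Φ (closure Ω) ∧
        (∀ z ∈ frontier Ω, Φ z = 0) ∧
        ((∃ p : ℝ≥0∞, (n : ℝ≥0∞) < p ∧ MemLp Y p (volume.restrict Ω)) →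
          InvCond.IsC1UpToBoundary Ω Φ ∧
          (∀ z ∈ frontier Ω, InvCond.HasNormalDeriv Ω Φ z 0) ∧
          -- adding `Φ` to a potential changes none of its boundary data
          (∀ Ψ : Euc n → ℝ, ∀ z ∈ frontier Ω,
            (Ψ + Φ) z = Ψ z ∧
            ∀ d : ℝ, InvCond.HasNormalDeriv Ω Ψ z d ↔
              InvCond.HasNormalDeriv Ω (Ψ + Φ) z d))) := by
  refine ⟨fun GD GN hD hN Y => ⟨fun hY => ⟨hY.inKernel hn hΩo hΩb hD hN,
    hY.integral_eq_zero hΩb⟩, fun hY =>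
      hY.1.orthogonalToHarmonic (by omega) hΩo hΩb hΩ2 hD hN hY.2⟩, fun Y hY => ?_⟩
  obtain ⟨Φ, hW, hS, hc, h0, hp⟩ := InvCond.exists_invisible_potential hn hΩo hΩb hY
  refine ⟨Φ, hW, hS, hc, h0, fun h => ⟨(hp h).1, (hp h).2, fun Ψ z hz => ⟨?_, fun d =>
    InvCond.hasNormalDeriv_add_iff ((hp h).2 z hz) Ψ d⟩⟩⟩
  simp [h0 z hz]
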